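/- **Setting.** Let $G$ be a locally compact second countable Hausdorff group, $H$ a closed subgroup, $\mu_G,\mu_H$ left Haar measures, $\Delta_G,\Delta_H$ the modular functions (normalised by $\mu(Ag)=\Delta(g)\mu(A)$), $X=G/H$ with its Borel sets $\mathcal B(X)$, and $p:G\to X$ the projection. Let $\theta:G\to[0,\infty)$ be continuous with $\int_H\theta(gh)\,d\mu_H(h)=1$ for all $g\in G$ and $KH\cap\operatorname{supp}\theta$ compact for every compact $K\subset G$. Hilbert spaces are complex and separable, with scalar product linear in the first variable; representations are unitary and strongly continuous. Let $\pi$ be a representation of $G$ on $\mathcal H$; its Gårding domain $\mathcal G_\pi$ is the linear span of the vectors $\pi(f)u=\int_G f(g)\pi(g)u\,d\mu_G(g)$ with $f\in C_c(G)$, $u\in\mathcal H$. *Localisation observables.* A localisation observable based on $X$ and covariant with respect to $\pi$ is a map $E$ from $\mathcal B(X)$ to the positive operators on $\mathcal H$ such that $E(\emptyset)=0$, $E(X)$ is injective, $E(\bigcup_n Y_n)=\sum_n E(Y_n)$ strongly for disjoint sequences, and $\pi(g)E(Y)\pi(g)^{-1}=E(g[Y])$. It is normalised if $E(X)=I$.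 *Induced representation.* For a representation $\sigma$ of $H$ on $\mathcal K$, let $\mathcal F^\sigma$ be the space of ($\mu_G$-a.e. classes of) $\mu_G$-measurable $F:G\to\mathcal K$ such that, for each $h\in H$, $F(gh)=\sqrt{\Delta_H(h)/\Delta_G(h)}\,\sigma(h^{-1})F(g)$ for almost every $g$, and $\|F\|^2=\int_G\|F(g)\|^2\theta(g)\,d\mu_G(g)<\infty$; put $(L^\sigma_gF)(g')=F(g^{-1}g')$ and $(E^\sigma(Y)F)(g)=\chi_Y(p(g))F(g)$. The representation $\pi$ is square-integrable modulo $(H,\sigma)$ if it is equivalent to a subrepresentation of $L^\sigma$. *The representation $\sigma_E$.* For a localisation observable $E$ as above, $\sigma_E$ denotes a representation $\sigma$ of $H$ (it is determined up to equivalence) for which there is an isometry $W:\mathcal H\to\mathcal F^{\sigma}$ with $W\pi(g)=L^{\sigma}_gW$ for all $g$, $E(Y)=E(X)^{1/2}W^*E^{\sigma}(Y)WE(X)^{1/2}$ for all $Y\in\mathcal B(X)$, and $\mathcal F^{\sigma}=\overline{\operatorname{span}}\{E^{\sigma}(Y)Wv : Y\in\mathcal B(X),\ v\in\mathcal H\}$.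 *Admissible maps.* A linear map $A:\mathcal G_\pi\to\mathcal K$ is admissible for $\pi$ modulo $(H,\sigma)$ if $\sigma(h)Av=\sqrt{\Delta_H(h)/\Delta_G(h)}\,A\pi(h)v$ for all $h\in H$, $v\in\mathcal G_\pi$; the map $g\mapsto A\pi(g^{-1})v$ is $\mu_G$-measurable for every $v\in\mathcal G_\pi$; and there is $\beta>0$ with $\int_G\|A\pi(g^{-1})v\|^2\theta(g)\,d\mu_G(g)\le\beta\|v\|^2$ for all $v\in\mathcal G_\pi$. It is tight if $\int_G\|A\pi(g^{-1})v\|^2\theta(g)\,d\mu_G(g)=\|v\|^2$ for all $v\in\mathcal G_\pi$. **Statement.** (1) Let $E$ be a normalised localisation observable based on $X$ and covariant with respect to $\pi$. Then a representation $\sigma_E$ exists, and for every choice of it there is a tight admissible map $A$ for $\pi$ modulo $(H,\sigma_E)$ such that $$\langle E(Y)u,v\rangle=\int_{p^{-1}(Y)}\langle A\pi(g^{-1})u,A\pi(g^{-1})v\rangle\,\theta(g)\,d\mu_G(g)\qquad(u,v\in\mathcal G_\pi,\ Y\in\mathcal B(X)).\tag{$*$}$$ In particular $\pi$ is square-integrable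 modulo $(H,\sigma_E)$. (2) Conversely, let $\sigma$ be a representation of $H$ and $A$ a tight admissible map for $\pi$ modulo $(H,\sigma)$. Then there is exactly one map $E$ from $\mathcal B(X)$ to the bounded operators on $\mathcal H$ that satisfies $(*)$, and it is a normalised localisation observable based on $X$ and covariant with respect to $\pi$. -/

import Mathlib

open MeasureTheory TopologicalSpace
open scoped ENNReal NNReal Pointwise

universe u v w

noncomputable section

/-- A closed subgroup of a locally compact group is locally compact. -/
instance Subgroup.locallyCompactSpace_of_isClosed {G : Type*} [Group G] [TopologicalSpace G]
    [LocallyCompactSpace G] (H : Subgroup G) [hH : IsClosed (H : Set G)] :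
    LocallyCompactSpace H :=
  hH.locallyCompactSpace

/-- A representation of the topological group `G` in `V`: a homomorphism into the unitary operators
of `V` which is continuous for the strong operator topology. -/
structure UnitaryRep (G : Type*) [Group G] [TopologicalSpace G]
    (V : Type*) [NormedAddCommGroup V] [InnerProductSpace ℂ V] where
  toHom : G →* (V ≃ₗᵢ[ℂ] V)
  continuous_apply : ∀ v : V, Continuous fun g => toHom g v

namespace UnitaryRep

section Garding

variable {G : Type*} [Group G] [TopologicalSpace G] [IsTopologicalGroup G] [MeasurableSpace G]
  [BorelSpace G] {V : Type*} [NormedAddCommGroup V] [InnerProductSpace ℂ V]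

instance : CoeFun (UnitaryRep G V) (fun _ => G → V ≃ₗᵢ[ℂ] V) := ⟨fun π => π.toHom⟩

theorem mul_apply (π : UnitaryRep G V) (g g' : G) (v : V) : π (g * g') v = π g (π g' v) := by
  rw [map_mul]; rfl

/-- `π(f) u = ∫ f(g) π(g) u dμ(g)`. -/
def smear (μ : Measure G) (π : UnitaryRep G V) (f : G → ℂ) (u : V) : V :=
  ∫ g, f g • π g u ∂μ

/-- The Gårding domain: the span of the vectors `π(f) u`, with `f` continuous of compact support
and `u` an arbitrary vector. -/
def garding (μ : Measure G) (π : UnitaryRep G V) : Submodule ℂ V :=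
  Submodule.span ℂ {w | ∃ (f : G → ℂ) (u : V), Continuous f ∧ HasCompactSupport f ∧
    w = smear μ π f u}

theorem apply_smear (μ : Measure G) [μ.IsMulLeftInvariant] (π : UnitaryRep G V) (g : G)
    (f : G → ℂ) (u : V) : π g (smear μ π f u) = smear μ π (fun x => f (g⁻¹ * x)) u := by
  unfold smear
  rw [← integral_mul_left_eq_self (fun x => f (g⁻¹ * x) • π x u) g]
  simp only [inv_mul_cancel_left, mul_apply]
  have := (π g).toContinuousLinearEquiv.integral_comp_comm (μ := μ) (fun x => f x • π x u)
  simpa using this.symm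

theorem apply_mem_garding (μ : Measure G) [μ.IsMulLeftInvariant] (π : UnitaryRep G V) (g : G)
    {v : V} (hv : v ∈ garding μ π) : π g v ∈ garding μ π := by
  have h : garding μ π ≤ (garding μ π).comap ((π g).toLinearEquiv : V →ₗ[ℂ] V) := by
    refine Submodule.span_le.2 ?_
    rintro _ ⟨f, u, hf, hc, rfl⟩
    refine Submodule.subset_span ⟨fun x => f (g⁻¹ * x), u, by fun_prop, ?_, apply_smear μ π g f u⟩
    exact hc.comp_homeomorph (Homeomorph.mulLeft g⁻¹)
  exact h hv

/-- `π(g)` as a map of the Gårding domain to itself. -/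
def gardingAct (μ : Measure G) [μ.IsMulLeftInvariant] (π : UnitaryRep G V) (g : G)
    (v : garding μ π) : garding μ π :=
  ⟨π g v, apply_mem_garding μ π g v.2⟩

end Garding

end UnitaryRep

section Setting

variable {G : Type u} [Group G] [TopologicalSpace G] [IsTopologicalGroup G]
  [LocallyCompactSpace G] [SecondCountableTopology G] [MeasurableSpace G] [BorelSpace G]
  {H : Subgroup G}
  {V : Type v} [NormedAddCommGroup V] [InnerProductSpace ℂ V]
  {K : Type w} [NormedAddCommGroup K] [InnerProductSpace ℂ K]

/-- The function `Δ_H(h) / Δ_G(h)` on `H`, where `Δ` is the modular function normalised by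
`μ(A g) = Δ(g) μ(A)` for a left Haar measure `μ`. The function `modularCharacter` is the inverse
of `Δ`, as it satisfies `μ(A g⁻¹) = modularCharacter g * μ(A)`; hence the order of the quotient. -/
def modularRatio [IsClosed (H : Set G)] (h : H) : ℝ :=
  (Measure.modularCharacter (h : G) : ℝ) / (Measure.modularCharacter h : ℝ)

/-- The weights for `G/H`: the continuous functions `θ : G → [0, ∞)` such that `∫_H θ(g h) dh = 1` for all `g`,
and `K H ∩ supp θ` is compact for every compact `K`. -/
structure IsWeight (μH : Measure H) (θ : C(G, ℝ)) : Prop where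
  nonneg : ∀ g, 0 ≤ θ g
  integral_eq_one : ∀ g, ∫ h : H, θ (g * h) ∂μH = 1
  isCompact_inter : ∀ C : Set G, IsCompact C → IsCompact ((C * (H : Set G)) ∩ tsupport θ)

/-- The preimage `p⁻¹(Y)` of `Y ⊆ G/H` under the projection `p : G → G/H`. -/
def cosetPreimage (Y : Set (G ⧸ H)) : Set G := (QuotientGroup.mk : G → G ⧸ H) ⁻¹' Y

/-- `Y` is a Borel subset of `G/H` (for the quotient topology). -/
def IsBorel (Y : Set (G ⧸ H)) : Prop := MeasurableSet[borel (G ⧸ H)] Y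

theorem IsBorel.measurableSet_cosetPreimage {Y : Set (G ⧸ H)} (hY : IsBorel Y) :
    MeasurableSet (cosetPreimage Y) := by
  let _ : MeasurableSpace (G ⧸ H) := borel (G ⧸ H)
  have : BorelSpace (G ⧸ H) := ⟨rfl⟩
  exact (QuotientGroup.continuous_mk (N := H)).measurable hY

/-! ### Localisation observables -/

/-- `E` is a localisation observable based on `G/H`, acting in `V` and covariant with respect to
`π`. Only the values of `E` on Borel sets matter. -/
structure IsLocalisationObservable (π : UnitaryRep G V) (E : Set (G ⧸ H) → V →L[ℂ] V) : Prop where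
  isPositive : ∀ Y, IsBorel Y → (E Y).IsPositive
  empty : E ∅ = 0
  injective : Function.Injective (E Set.univ)
  hasSum : ∀ Y : ℕ → Set (G ⧸ H), (∀ n, IsBorel (Y n)) → Pairwise (Function.onFun Disjoint Y) →
    ∀ v, HasSum (fun n => E (Y n) v) (E (⋃ n, Y n) v)
  covariant : ∀ (g : G) (Y : Set (G ⧸ H)), IsBorel Y →
    ∀ v, π g (E Y (π g⁻¹ v)) = E ((fun x => g • x) '' Y) v

/-- A localisation observable is normalised if `E(X) = I`, where `X = G/H`. -/
structure IsNormalisedLocalisationObservable (π : UnitaryRep G V)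
    (E : Set (G ⧸ H) → V →L[ℂ] V) : Prop extends IsLocalisationObservable π E where
  normalised : E Set.univ = 1

/-! ### The induced representation

The space of the representation induced by `σ` consists of the classes, modulo equality `μG`-almost
everywhere, of `μG`-measurable functions `F : G → K` such that
`F(g h) = √(Δ_H(h)/Δ_G(h)) σ(h⁻¹) F(g)` for every `h ∈ H` and almost every `g`, and
`∫ ‖F(g)‖² θ(g) dg < ∞`. -/

/-- The squared norm `∫ ‖F(g)‖² θ(g) dg`. -/
def inducedNormSq (μG : Measure G) (θ : C(G, ℝ)) (F : G →ₘ[μG] K) : ℝ≥0∞ :=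
  ∫⁻ g, ‖F g‖ₑ ^ 2 * ENNReal.ofReal (θ g) ∂μG

/-- The scalar product `∫ ⟨F₁(g), F₂(g)⟩ θ(g) dg`, linear in `F₁` (whereas `inner` is linear in its
second variable). -/
def inducedInner (μG : Measure G) (θ : C(G, ℝ)) (F₁ F₂ : G →ₘ[μG] K) : ℂ :=
  ∫ g, inner ℂ (F₂ g) (F₁ g) * (θ g : ℂ) ∂μG

/-- The space of the induced representation. -/
def inducedSpace [IsClosed (H : Set G)] (μG : Measure G) [μG.IsMulLeftInvariant] [SFinite μG]
    (θ : C(G, ℝ)) (σ : UnitaryRep H K) : Submodule ℂ (G →ₘ[μG] K) where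
  carrier := {F | (∀ h : H, ∀ᵐ g ∂μG,
      F (g * h) = (Real.sqrt (modularRatio h) : ℂ) • σ h⁻¹ (F g)) ∧
    inducedNormSq μG θ F < ∞}
  zero_mem' := by
    refine ⟨fun h => ?_, ?_⟩
    · have h0 := AEEqFun.coeFn_zero (α := G) (β := K) (μ := μG)
      filter_upwards [h0, (quasiMeasurePreserving_mul_right μG (h : G)).ae h0] with g h1 h2
      simp [h1, h2]
    · have h0 := AEEqFun.coeFn_zero (α := G) (β := K) (μ := μG)
      have : inducedNormSq μG θ (0 : G →ₘ[μG] K) = ∫⁻ _, 0 ∂μG := by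
        refine lintegral_congr_ae ?_
        filter_upwards [h0] with g h1
        simp [h1]
      simp [this]
  add_mem' := by
    rintro F₁ F₂ ⟨h1, h1'⟩ ⟨h2, h2'⟩
    have h0 := AEEqFun.coeFn_add F₁ F₂
    refine ⟨fun h => ?_, ?_⟩
    · filter_upwards [h0, (quasiMeasurePreserving_mul_right μG (h : G)).ae h0, h1 h, h2 h]
        with g a b c d
      simp only [a, b, c, d, Pi.add_apply, map_add, smul_add]
    · have hle : inducedNormSq μG θ (F₁ + F₂) ≤
          ∫⁻ g, 2 * (‖F₁ g‖ₑ ^ 2 * ENNReal.ofReal (θ g)) +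
            2 * (‖F₂ g‖ₑ ^ 2 * ENNReal.ofReal (θ g)) ∂μG := by
        refine lintegral_mono_ae ?_
        filter_upwards [h0] with g a
        rw [a, ← mul_assoc, ← mul_assoc, ← add_mul, ← mul_add]
        gcongr
        calc ‖F₁ g + F₂ g‖ₑ ^ 2 ≤ (‖F₁ g‖ₑ + ‖F₂ g‖ₑ) ^ 2 := by
              gcongr; exact enorm_add_le _ _
          _ ≤ 2 * (‖F₁ g‖ₑ ^ 2 + ‖F₂ g‖ₑ ^ 2) := by
              simp only [enorm_eq_nnnorm]
              exact_mod_cast add_sq_le (a := ‖F₁ g‖₊) (b := ‖F₂ g‖₊)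
      refine hle.trans_lt ?_
      have hmeas : AEMeasurable (fun g => 2 * (‖F₁ g‖ₑ ^ 2 * ENNReal.ofReal (θ g))) μG :=
        ((F₁.aestronglyMeasurable.enorm.pow_const 2).mul
          (θ.continuous.measurable.ennreal_ofReal.aemeasurable)).const_mul 2
      rw [lintegral_add_left' hmeas, lintegral_const_mul' _ _ (by simp),
        lintegral_const_mul' _ _ (by simp)]
      exact ENNReal.add_lt_top.2 ⟨ENNReal.mul_lt_top (by simp) h1', ENNReal.mul_lt_top (by simp) h2'⟩
  smul_mem' := by
    rintro c F ⟨h1, h1'⟩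
    have h0 := AEEqFun.coeFn_smul c F
    refine ⟨fun h => ?_, ?_⟩
    · filter_upwards [h0, (quasiMeasurePreserving_mul_right μG (h : G)).ae h0, h1 h]
        with g a b d
      simp only [a, b, d, Pi.smul_apply, map_smul]
      rw [smul_comm]
    · have : inducedNormSq μG θ (c • F) =
          ∫⁻ g, ‖c‖ₑ ^ 2 * (‖F g‖ₑ ^ 2 * ENNReal.ofReal (θ g)) ∂μG := by
        refine lintegral_congr_ae ?_
        filter_upwards [h0] with g a
        rw [a, Pi.smul_apply, enorm_smul, mul_pow, mul_assoc]
      rw [this, lintegral_const_mul' _ _ (by simp)]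
      exact ENNReal.mul_lt_top (by simp) h1'

/-- The action of the induced representation: `(L_g F)(g') = F(g⁻¹ g')` for almost all `g'`. -/
def inducedAct (μG : Measure G) [μG.IsMulLeftInvariant] (g : G) (F : G →ₘ[μG] K) : G →ₘ[μG] K :=
  F.compMeasurePreserving (fun g' => g⁻¹ * g') (measurePreserving_mul_left μG g⁻¹)

/-- The canonical projective localisation observable of the induced representation:
`(P(Y) F)(g) = χ_Y(p(g)) F(g)` for almost all `g`. -/
def inducedLocalisation (μG : Measure G) {Y : Set (G ⧸ H)} (hY : IsBorel Y) (F : G →ₘ[μG] K) :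
    G →ₘ[μG] K :=
  AEEqFun.mk ((cosetPreimage Y).indicator F)
    (F.aestronglyMeasurable.indicator hY.measurableSet_cosetPreimage)

variable [IsClosed (H : Set G)] (μG : Measure G) [μG.IsMulLeftInvariant] [SFinite μG] (θ : C(G, ℝ))
  (π : UnitaryRep G V) (σ : UnitaryRep H K)

/-- `W` is an isometry of `V` into the space of the induced representation, intertwining `π` with
the induced representation. -/
structure IsIsometricIntertwiner (W : V →ₗ[ℂ] inducedSpace μG θ σ) : Prop where
  isometry : ∀ v, inducedNormSq μG θ (W v : G →ₘ[μG] K) = ‖v‖ₑ ^ 2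
  intertwines : ∀ (g : G) (v : V), (W (π g v) : G →ₘ[μG] K) = inducedAct μG g (W v)

/-- `π` is square-integrable modulo `(H, σ)`: it is equivalent to a subrepresentation of the
representation induced by `σ`. (If `V` is complete then the range of an isometric intertwiner `W`
is a closed invariant subspace, and `W` is a unitary equivalence of `V` with it.) -/
def IsSquareIntegrableModulo : Prop :=
  ∃ W : V →ₗ[ℂ] inducedSpace μG θ σ, IsIsometricIntertwiner μG θ π σ W

/-- `σ` is (a representative of) the representation `σ_E` of `H` determined up to equivalence by the
localisation observable `E`: there is an isometry `W` intertwining `π` and the representation induced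
by `σ`, with canonical localisation observable `P`, such that
`E(Y) = E(X)^{1/2} W* P(Y) W E(X)^{1/2}` for all Borel sets `Y`, and the vectors `P(Y) W v` span a
dense subspace of the space of the induced representation. -/
def IsAssociatedRep [CompleteSpace V] (E : Set (G ⧸ H) → V →L[ℂ] V) : Prop :=
  ∃ W : V →ₗ[ℂ] inducedSpace μG θ σ, IsIsometricIntertwiner μG θ π σ W ∧
    (∀ (Y : Set (G ⧸ H)) (hY : IsBorel Y) (u v : V),
      inner ℂ v (E Y u) = inducedInner μG θ
        (inducedLocalisation μG hY (W (CFC.sqrt (E Set.univ) u)))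
        (W (CFC.sqrt (E Set.univ) v) : G →ₘ[μG] K)) ∧
    ∀ F ∈ inducedSpace μG θ σ, ∀ ε : ℝ≥0∞, 0 < ε →
      ∃ F' ∈ Submodule.span ℂ {F' : G →ₘ[μG] K | ∃ (Y : Set (G ⧸ H)) (hY : IsBorel Y) (v : V),
          F' = inducedLocalisation μG hY (W v)},
        inducedNormSq μG θ (F - F') < ε

/-! ### Admissible maps -/

variable {π}

/-- The function `g ↦ A π(g⁻¹) v`. -/
def waveletFun (A : π.garding μG →ₗ[ℂ] K) (v : π.garding μG) (g : G) : K :=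
  A (π.gardingAct μG g⁻¹ v)

/-- `A`, defined on the Gårding domain of `π`, is an admissible map for `π` modulo `(H, σ)`. -/
structure IsAdmissible (A : π.garding μG →ₗ[ℂ] K) : Prop where
  semiInvariant : ∀ (h : H) (v : π.garding μG),
    σ h (A v) = (Real.sqrt (modularRatio h) : ℂ) • A (π.gardingAct μG (h : G) v)
  measurable : ∀ v, AEStronglyMeasurable (waveletFun μG A v) μG
  bound : ∃ β : ℝ, 0 < β ∧ ∀ v : π.garding μG,
    ∫⁻ g, ‖waveletFun μG A v g‖ₑ ^ 2 * ENNReal.ofReal (θ g) ∂μG ≤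
      ENNReal.ofReal (β * ‖(v : V)‖ ^ 2)

/-- Tight admissible maps: `∫ ‖A π(g⁻¹) v‖² θ(g) dg = ‖v‖²` for all `v` in the Gårding domain. -/
structure IsTightAdmissible (A : π.garding μG →ₗ[ℂ] K) : Prop
    extends IsAdmissible μG θ σ A where
  tight : ∀ v : π.garding μG,
    ∫⁻ g, ‖waveletFun μG A v g‖ₑ ^ 2 * ENNReal.ofReal (θ g) ∂μG = ENNReal.ofReal (‖(v : V)‖ ^ 2)

/-- The formula `⟨E(Y) u, v⟩ = ∫_{p⁻¹(Y)} ⟨A π(g⁻¹) u, A π(g⁻¹) v⟩ θ(g) dg` for all `u`, `v` in the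
Gårding domain and all Borel sets `Y`, the integrand being integrable. Scalar products are here
linear in the first variable, whereas `inner` is linear in the second one. -/
def IsGivenBy (E : Set (G ⧸ H) → V →L[ℂ] V) (A : π.garding μG →ₗ[ℂ] K) : Prop :=
  ∀ (Y : Set (G ⧸ H)), IsBorel Y → ∀ u v : π.garding μG,
    IntegrableOn (fun g => inner ℂ (waveletFun μG A v g) (waveletFun μG A u g) * (θ g : ℂ))
      (cosetPreimage Y) μG ∧
    inner ℂ (v : V) (E Y u) =
      ∫ g in cosetPreimage Y, inner ℂ (waveletFun μG A v g) (waveletFun μG A u g) * (θ g : ℂ) ∂μG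

end Setting

end

/-!
Write `r(h) = Δ_H(h) / Δ_G(h)` for the modular ratio, `T*` for adjoints and `𝒢` for the Gårding
domain of `π`.

The tool used throughout is a form of Weil's integration formula which needs no invariant measure on
`G/H` (`IsWeight.lintegral_mul_eq`): if `φ(gh) = r(h) φ(g)` then
`∫ φ ψ dg = ∫ φ(g) θ(g) ∫_H ψ(gh) dh dg`. It shows that `∫ φ θ dg` does not depend on the weight `θ`,
in particular that it is invariant under left translations of `φ`; that `φ` is integrable over compact
sets as soon as `φ θ` is integrable; and that `H`-invariant sets are null for Haar measure when they
are null for `θ dg`. Consequently the space `F^σ` of the induced representation is a closed subspace of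
`L²(G, θ dg; K)` on which `G` acts unitarily (`IsWeight.isClosed_range_inducedToLp`).

*From a tight admissible map to an observable.* Tightness says that `v ↦ A π(·⁻¹) v` extends from `𝒢`
to an isometry `T` from `V` to `L²(G, θ dg; K)`, and `E(Y) = T* χ_Y T` is the required observable
(`compressedObservable_isNormalised`). It is unique because `𝒢` is dense.

*From a given `σ_E` to a tight admissible map.* Let `W` be the isometric intertwiner. Then
`W π(f) u` is the convolution of `f` with the locally integrable function `W u`, hence is represented
by a continuous function (`IsIsometricIntertwiner.apply_smear`). Therefore `A v = (W v)(1)` makes sense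
for `v ∈ 𝒢`. The intertwining property gives `W v = A π(·⁻¹) v`, and the properties of `A` are those
of `W` read off from this formula.

*Existence of `σ_E`.* This does not go through the imprimitivity theorem. For `u, v ∈ 𝒢` the complex
measure `Y ↦ ⟨E(Y) u, v⟩` on `G/H` has a continuous density `b`, that is,
`⟨E(Y) u, v⟩ = ∫_{p⁻¹(Y)} b θ dg` with `b(gh) = r(h) b(g)` (`exists_density`). Indeed, by covariance
`⟨E(Y) π(f₁) u, π(f₂) v⟩ = ∫∫ f₁(yz) conj(f₂(y)) ⟨E(y⁻¹ Y) π(z) u, v⟩ dz dy`, and after polarisation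
this is an average, over the finite measures `⟨E(·) w, w⟩`, of images of compactly supported
continuous densities under the orbit maps `y ↦ y s` with `s ∈ G/H`; the density of such an image is an
integral over a coset of `H`. Continuous densities are unique, so the value of `b` at the identity is
a sesquilinear form on `𝒢`, and it is positive since `E` is. Let `K` be the completion of `𝒢` for this
form and `A : 𝒢 → K` the canonical map (`exists_factorisation`). Covariance of `E` gives
`⟨A π(g⁻¹) u, A π(g⁻¹) v⟩ = b(g)`, so `E` is given by `A`. For `g ∈ H` it shows that
`A v ↦ √r(h) A π(h) v` is isometric, hence defines a representation `σ` of `H` on `K`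
(`exists_unitaryRep_of_factorisation`), and `E(G/H) = 1` is tightness of `A`.

It remains to see that the functions `χ_Y A π(·⁻¹) v` span a dense subspace of `F^σ`
(`IsTightAdmissible.isAssociatedRep`). Let `F ∈ F^σ` be orthogonal to them. Then so are its
convolutions `f ⋆ F`, which are continuous; their pairings with `A π(·⁻¹) v` are continuous covariant
functions with vanishing integrals over all `p⁻¹(Y)`, hence vanish. At the identity, `(f ⋆ F)(1)` is
orthogonal to the dense range of `A`, so it is zero for all `f ∈ C_c(G)`, and `F = 0`.
-/

set_option linter.unusedSectionVars false

noncomputable section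

/-! ### The modular character -/

instance Subgroup.secondCountableTopology_coe {G : Type*} [Group G] [TopologicalSpace G]
    [SecondCountableTopology G] (H : Subgroup G) : SecondCountableTopology H :=
  inferInstanceAs (SecondCountableTopology (H : Set G))

namespace MeasureTheory.Measure

variable {G : Type*} [Group G] [TopologicalSpace G] [IsTopologicalGroup G] [LocallyCompactSpace G]

theorem modularCharacter_pos (g : G) : 0 < modularCharacter g := modularCharacterFun_pos g

variable [SecondCountableTopology G] [MeasurableSpace G] [BorelSpace G]

section

variable (μ : Measure G) [μ.IsHaarMeasure]

/-- Mathlib normalises the modular character by `μ (A g⁻¹) = modularCharacter g * μ A`, so that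
`modularCharacter g` is the inverse of the modular function `Δ(g)` with `μ (A g) = Δ(g) μ A`. -/
theorem map_mul_right_eq_modularCharacter_smul (g : G) :
    map (· * g) μ = modularCharacter g • μ :=
  map_right_mul_eq_modularCharacterFun_smul μ g

theorem lintegral_comp_mul_right (f : G → ℝ≥0∞) (g : G) :
    ∫⁻ x, f (x * g) ∂μ = modularCharacter g * ∫⁻ x, f x ∂μ := by
  have := lintegral_map_equiv (μ := μ) f (MeasurableEquiv.mulRight g)
  simp only [MeasurableEquiv.coe_mulRight] at this
  rw [← this, map_mul_right_eq_modularCharacter_smul, lintegral_smul_measure]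
  rfl

theorem integral_comp_mul_right_eq_smul {E : Type*} [NormedAddCommGroup E] [NormedSpace ℝ E]
    (f : G → E) (g : G) :
    ∫ x, f (x * g) ∂μ = (modularCharacter g : ℝ) • ∫ x, f x ∂μ := by
  have := integral_map_equiv (μ := μ) (MeasurableEquiv.mulRight g) f
  simp only [MeasurableEquiv.coe_mulRight] at this
  rw [← this, map_mul_right_eq_modularCharacter_smul, integral_smul_nnreal_measure]
  rfl

end

/-- The modular character is the quotient of the integrals of a right translate of a compactly
supported function and of the function itself; the former is continuous in the translation. -/
theorem continuous_modularCharacter : Continuous (modularCharacter : G → ℝ≥0) := by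
  let μ : Measure G := haar
  obtain ⟨⟨f, f_cont⟩, f_comp, f_nonneg, f_one⟩ :
    ∃ f : C(G, ℝ), HasCompactSupport f ∧ 0 ≤ f ∧ f 1 ≠ 0 := exists_continuous_nonneg_pos 1
  have hpos : 0 < ∫ x, f x ∂μ :=
    f_cont.integral_pos_of_hasCompactSupport_nonneg_nonzero f_comp f_nonneg f_one
  have h1 : Continuous fun g => ∫ x, f (x * g) ∂μ := by
    refine continuous_iff_continuousAt.2 fun g₀ => ?_
    obtain ⟨C, hC, hCg⟩ := exists_compact_mem_nhds g₀
    refine ContinuousOn.continuousAt (s := C) ?_ hCg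
    refine continuousOn_integral_of_compact_support (k := tsupport f * C⁻¹)
      (f_comp.isCompact.mul hC.inv) (by unfold Function.uncurry; fun_prop) ?_
    intro g x hg hx
    by_contra hne
    refine hx ⟨x * g, subset_tsupport _ hne, g⁻¹, Set.inv_mem_inv.2 hg, by simp⟩
  have h2 : ∀ g, (modularCharacter g : ℝ) = (∫ x, f (x * g) ∂μ) / ∫ x, f x ∂μ := by
    intro g
    rw [integral_comp_mul_right_eq_smul, smul_eq_mul, mul_div_cancel_right₀ _ hpos.ne']
  have h3 : Continuous fun g : G => (modularCharacter g : ℝ) := by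
    simp_rw [h2]; exact h1.div_const _
  exact NNReal.isEmbedding_coe.continuous_iff.2 h3

variable (μ : Measure G) [μ.IsHaarMeasure]

/-- The inversion formula for a left Haar measure: the measure on the left is left invariant, hence
a multiple `c • μ`, and applying the formula twice gives `c ^ 2 = 1`. -/
theorem lintegral_inv_mul_modularCharacter {f : G → ℝ≥0∞} (hf : Measurable f) :
    ∫⁻ x, f x⁻¹ * modularCharacter x ∂μ = ∫⁻ x, f x ∂μ := by
  have hmc : Measurable fun x : G => (modularCharacter x : ℝ≥0∞) :=
    continuous_modularCharacter.measurable.coe_nnreal_ennreal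
  set ν : Measure G := (μ.withDensity fun x => (modularCharacter x : ℝ≥0∞)).map (fun x => x⁻¹)
    with hν
  have hνf : ∀ k : G → ℝ≥0∞, Measurable k →
      ∫⁻ x, k x ∂ν = ∫⁻ x, k x⁻¹ * modularCharacter x ∂μ := by
    intro k hk
    rw [hν, lintegral_map hk measurable_inv,
      lintegral_withDensity_eq_lintegral_mul _ hmc (by fun_prop)]
    simp only [Pi.mul_apply, mul_comm]
  -- the density turns the right translation by `a` produced by the inversion into an invariance
  have hinv : ν.IsMulLeftInvariant := by
    refine ⟨fun a => ?_⟩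
    refine ext_of_lintegral _ fun k hk => ?_
    rw [lintegral_map hk (measurable_const_mul a), hνf _ hk,
      hνf (fun x => k (a * x)) (by fun_prop)]
    have h := lintegral_comp_mul_right μ (fun x => k (a * x⁻¹) * modularCharacter x) a
    simp only [mul_inv_rev, mul_inv_cancel_left, map_mul, ENNReal.coe_mul] at h
    have hne : (modularCharacter a : ℝ≥0∞) ≠ 0 := by
      simpa using (modularCharacter_pos a).ne'
    rw [← ENNReal.mul_right_inj hne ENNReal.coe_ne_top, ← h,
      ← lintegral_const_mul (modularCharacter a : ℝ≥0∞) (f := fun x => k x⁻¹ * modularCharacter x)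
        (by fun_prop)]
    refine lintegral_congr fun x => ?_
    ring
  have hfin : IsFiniteMeasureOnCompacts ν := by
    refine ⟨fun C hC => ?_⟩
    rw [hν]
    change (map (MeasurableEquiv.inv G) _) C < ∞
    rw [MeasurableEquiv.map_apply]
    have hC' : IsCompact ((fun x : G => x⁻¹) ⁻¹' C) := hC.inv
    have hlf : IsLocallyFiniteMeasure (μ.withDensity fun x => (modularCharacter x : ℝ≥0∞)) :=
      IsLocallyFiniteMeasure.withDensity_coe continuous_modularCharacter
    exact hC'.measure_lt_top
  have hc := isMulLeftInvariant_eq_smul ν μ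
  set c := haarScalarFactor ν μ
  have hJ : ∀ k : G → ℝ≥0∞, Measurable k →
      ∫⁻ x, k x⁻¹ * modularCharacter x ∂μ = c * ∫⁻ x, k x ∂μ := by
    intro k hk
    rw [← hνf k hk, hc, lintegral_smul_measure]; rfl
  obtain ⟨C, hC, hCg⟩ := exists_compact_mem_nhds (1 : G)
  have hCc : IsCompact (closure C) := hC.closure
  have hpos : 0 < μ (closure C) :=
    measure_pos_of_mem_nhds μ (Filter.mem_of_superset hCg subset_closure)
  have hlt : μ (closure C) < ∞ := hCc.measure_lt_top
  have hc1 : (c : ℝ≥0∞) = 1 := by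
    set k : G → ℝ≥0∞ := (closure C).indicator 1
    have hk : Measurable k := measurable_one.indicator isClosed_closure.measurableSet
    have h1 : ∫⁻ x, k x ∂μ = μ (closure C) := lintegral_indicator_one isClosed_closure.measurableSet
    -- apply the formula to `x ↦ k x⁻¹ * modularCharacter x`, whose own transform is `k`
    have h2 := hJ _ ((hk.comp measurable_inv).mul hmc)
    simp only [Function.comp_apply, inv_inv, Pi.mul_apply] at h2
    rw [hJ k hk, h1] at h2
    have h3 : ∫⁻ x, k x * modularCharacter x⁻¹ * modularCharacter x ∂μ = μ (closure C) := by
      rw [← h1]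
      refine lintegral_congr fun x => ?_
      rw [mul_assoc, ← ENNReal.coe_mul, ← map_mul, inv_mul_cancel, map_one, ENNReal.coe_one,
        mul_one]
    rw [h3, ← mul_assoc] at h2
    have h4 : (c * c : ℝ≥0∞) = 1 := by
      rw [← ENNReal.mul_left_inj hpos.ne' hlt.ne, ← h2, one_mul]
    have h5 : c * c = 1 := by exact_mod_cast h4
    have h6 : c = 1 := by
      have := pow_eq_one_iff_of_nonneg (zero_le : 0 ≤ c) (two_ne_zero)
      rw [← this, sq, h5]
    exact_mod_cast h6
  rw [hJ f hf, hc1, one_mul]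

end MeasureTheory.Measure

/-! ### Covariant functions and weights -/

section Weil

variable {G : Type u} [Group G] [TopologicalSpace G] [IsTopologicalGroup G]
  [LocallyCompactSpace G] {H : Subgroup G} [IsClosed (H : Set G)]

theorem modularRatio_pos (h : H) : 0 < modularRatio h :=
  div_pos (NNReal.coe_pos.2 (Measure.modularCharacter_pos _))
    (NNReal.coe_pos.2 (Measure.modularCharacter_pos _))

theorem modularRatio_mul (h k : H) : modularRatio (h * k) = modularRatio h * modularRatio k := by
  simp only [modularRatio, Subgroup.coe_mul, map_mul, NNReal.coe_mul]
  exact mul_div_mul_comm _ _ _ _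

theorem modularRatio_one : modularRatio (1 : H) = 1 := by simp [modularRatio]

theorem modularRatio_inv (h : H) : modularRatio h⁻¹ = (modularRatio h)⁻¹ := by
  refine eq_inv_of_mul_eq_one_left ?_
  rw [← modularRatio_mul, inv_mul_cancel, modularRatio_one]

variable [SecondCountableTopology G] [MeasurableSpace G] [BorelSpace G]

theorem continuous_modularRatio : Continuous (modularRatio : H → ℝ) := by
  refine Continuous.div ?_ ?_ fun h => (NNReal.coe_pos.2 (Measure.modularCharacter_pos _)).ne'
  · exact NNReal.continuous_coe.comp
      (Measure.continuous_modularCharacter.comp continuous_subtype_val)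
  · exact NNReal.continuous_coe.comp Measure.continuous_modularCharacter

variable {μH : Measure H} [μH.IsHaarMeasure] {θ : C(G, ℝ)}

theorem IsWeight.lintegral_eq_one (hθ : IsWeight μH θ) (g : G) :
    ∫⁻ h : H, ENNReal.ofReal (θ (g * h)) ∂μH = 1 := by
  have h1 := hθ.integral_eq_one g
  have hi : Integrable (fun h : H => θ (g * h)) μH := by
    by_contra hn
    rw [integral_undef hn] at h1
    exact zero_ne_one h1
  rw [← ofReal_integral_eq_lintegral_ofReal hi (Filter.Eventually.of_forall fun h => hθ.nonneg _),
    h1, ENNReal.ofReal_one]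

theorem IsWeight.exists_pos (hθ : IsWeight μH θ) (g : G) : ∃ h : H, 0 < θ (g * h) := by
  by_contra! hn
  have h1 := hθ.integral_eq_one g
  have : ∀ h : H, θ (g * h) = 0 := fun h => le_antisymm (hn h) (hθ.nonneg _)
  simp [this] at h1

variable (μG : Measure G) [μG.IsHaarMeasure]

/-- Weil's formula in the form used for quotients without invariant measure: a covariant function
`φ`, integrated against `ψ`, gives the integral of `φ θ` against the fibre integral of `ψ`. -/
theorem IsWeight.lintegral_mul_eq (hθ : IsWeight μH θ) {φ ψ : G → ℝ≥0∞}
    (hφ : AEMeasurable φ μG) (hψ : Measurable ψ)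
    (hcov : ∀ h : H, ∀ᵐ g ∂μG, φ (g * h) = ENNReal.ofReal (modularRatio h) * φ g) :
    ∫⁻ g, φ g * ψ g ∂μG =
      ∫⁻ g, φ g * ENNReal.ofReal (θ g) * ∫⁻ h : H, ψ (g * h) ∂μH ∂μG := by
  wlog hφm : Measurable φ generalizing φ
  · have he := hφ.ae_eq_mk
    have := this (φ := hφ.mk φ) hφ.measurable_mk.aemeasurable (fun h => ?_) hφ.measurable_mk
    · refine (lintegral_congr_ae ?_).trans (this.trans (lintegral_congr_ae ?_)) <;>
        filter_upwards [he] with g hg <;> rw [hg]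
    · filter_upwards [he, (quasiMeasurePreserving_mul_right μG (h : G)).ae he, hcov h]
        with g h1 h2 h3
      rw [← h1, ← h2, h3]
  have hθm : Measurable fun g => ENNReal.ofReal (θ g) :=
    θ.continuous.measurable.ennreal_ofReal
  have hHm : Measurable fun h : H => (h : G) := measurable_subtype_coe
  have hmH : Measurable fun h : H => (Measure.modularCharacter h : ℝ≥0∞) :=
    Measure.continuous_modularCharacter.measurable.coe_nnreal_ennreal
  -- insert `1 = ∫ θ (g h) dh`, interchange the integrals, substitute `g h⁻¹` for `g`, and finally invert `h`
  calc ∫⁻ g, φ g * ψ g ∂μG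
      = ∫⁻ g, ∫⁻ h : H, φ g * ψ g * ENNReal.ofReal (θ (g * h)) ∂μH ∂μG := by
        refine lintegral_congr fun g => ?_
        rw [lintegral_const_mul _ (by fun_prop), hθ.lintegral_eq_one, mul_one]
    _ = ∫⁻ h : H, ∫⁻ g, φ g * ψ g * ENNReal.ofReal (θ (g * h)) ∂μG ∂μH :=
        lintegral_lintegral_swap (by unfold Function.uncurry; fun_prop)
    _ = ∫⁻ h : H, ∫⁻ g, φ g * ENNReal.ofReal (θ g) *
          (ψ (g * (h⁻¹ : H)) * Measure.modularCharacter h) ∂μG ∂μH := by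
        refine lintegral_congr fun h => ?_
        have h1 := Measure.lintegral_comp_mul_right μG
          (fun g => φ (g * (h⁻¹ : H)) * ψ (g * (h⁻¹ : H)) * ENNReal.ofReal (θ g)) (h : G)
        simp only [InvMemClass.coe_inv, mul_inv_cancel_right] at h1
        rw [h1, ← lintegral_const_mul _ (by fun_prop)]
        refine lintegral_congr_ae ?_
        filter_upwards [hcov h⁻¹] with g hg
        simp only [InvMemClass.coe_inv] at hg ⊢
        rw [hg, modularRatio_inv, modularRatio, inv_div]
        have e : (Measure.modularCharacter (h : G) : ℝ≥0∞) * ENNReal.ofReal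
            ((Measure.modularCharacter h : ℝ) / (Measure.modularCharacter (h : G) : ℝ)) =
            Measure.modularCharacter h := by
          rw [← ENNReal.ofReal_coe_nnreal, ← ENNReal.ofReal_mul (by positivity),
            mul_div_cancel₀, ENNReal.ofReal_coe_nnreal]
          exact (NNReal.coe_pos.2 (Measure.modularCharacter_pos _)).ne'
        rw [← e]
        ring
    _ = ∫⁻ g, ∫⁻ h : H, φ g * ENNReal.ofReal (θ g) *
          (ψ (g * (h⁻¹ : H)) * Measure.modularCharacter h) ∂μH ∂μG := by
        refine lintegral_lintegral_swap (Measurable.aemeasurable ?_)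
        have h1 : Measurable fun p : H × G => ψ (p.2 * (p.1⁻¹ : H)) :=
          hψ.comp (measurable_snd.mul (hHm.comp measurable_fst.inv))
        exact ((hφm.comp measurable_snd).mul (hθm.comp measurable_snd)).mul
          (h1.mul (hmH.comp measurable_fst))
    _ = ∫⁻ g, φ g * ENNReal.ofReal (θ g) * ∫⁻ h : H, ψ (g * h) ∂μH ∂μG := by
        refine lintegral_congr fun g => ?_
        rw [lintegral_const_mul _ (by fun_prop)]
        congr 1
        exact Measure.lintegral_inv_mul_modularCharacter μH (f := fun h : H => ψ (g * h))
          (by fun_prop)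

end Weil

section WeilConsequences

variable {G : Type u} [Group G] [TopologicalSpace G] [IsTopologicalGroup G] [T2Space G]
  [LocallyCompactSpace G] [SecondCountableTopology G] [MeasurableSpace G] [BorelSpace G]
  {H : Subgroup G} [IsClosed (H : Set G)]
  {μH : Measure H} [μH.IsHaarMeasure] {θ : C(G, ℝ)} (μG : Measure G) [μG.IsHaarMeasure]

/-- The integral of a covariant function against a weight does not depend on the weight; here the
second weight is a left translate of the first. -/
theorem IsWeight.lintegral_translate (hθ : IsWeight μH θ) {φ : G → ℝ≥0∞}
    (hφ : AEMeasurable φ μG)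
    (hcov : ∀ h : H, ∀ᵐ g ∂μG, φ (g * h) = ENNReal.ofReal (modularRatio h) * φ g) (x : G) :
    ∫⁻ g, φ g * ENNReal.ofReal (θ (x * g)) ∂μG = ∫⁻ g, φ g * ENNReal.ofReal (θ g) ∂μG := by
  rw [hθ.lintegral_mul_eq μG hφ (by fun_prop) hcov]
  refine lintegral_congr fun g => ?_
  simp_rw [← mul_assoc x g]
  rw [hθ.lintegral_eq_one, mul_one]

/-- The form for real functions of the independence of the weight, by splitting into positive and
negative parts. -/
theorem IsWeight.integral_translate_real (hθ : IsWeight μH θ) {φ : G → ℝ}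
    (hφ : AEMeasurable φ μG)
    (hcov : ∀ h : H, ∀ᵐ g ∂μG, φ (g * h) = modularRatio h * φ g)
    (hi : Integrable (fun g => φ g * θ g) μG) (x : G) :
    Integrable (fun g => φ g * θ (x * g)) μG ∧
      ∫ g, φ g * θ (x * g) ∂μG = ∫ g, φ g * θ g ∂μG := by
  have hi' : Integrable (fun g => φ g * θ (x * g)) μG := by
    refine ⟨by fun_prop, ?_⟩
    have h1 := hi.2
    unfold HasFiniteIntegral at h1 ⊢
    have e : ∀ y : G, ∫⁻ g, ‖φ g * θ (y * g)‖ₑ ∂μG =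
        ∫⁻ g, ‖φ g‖ₑ * ENNReal.ofReal (θ (y * g)) ∂μG := fun y => by
      refine lintegral_congr fun g => ?_
      rw [enorm_mul, Real.enorm_of_nonneg (hθ.nonneg _)]
    have e1 := e 1
    simp only [one_mul] at e1
    rw [e x, hθ.lintegral_translate μG hφ.enorm (fun h => ?_), ← e1]
    · exact h1
    · filter_upwards [hcov h] with g hg
      rw [hg, enorm_mul, Real.enorm_of_nonneg (modularRatio_pos h).le]
  refine ⟨hi', ?_⟩
  rw [integral_eq_lintegral_pos_part_sub_lintegral_neg_part hi',
    integral_eq_lintegral_pos_part_sub_lintegral_neg_part hi]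
  have key : ∀ ψ : G → ℝ, AEMeasurable ψ μG →
      (∀ h : H, ∀ᵐ g ∂μG, ψ (g * h) = modularRatio h * ψ g) →
      ∫⁻ g, ENNReal.ofReal (ψ g * θ (x * g)) ∂μG = ∫⁻ g, ENNReal.ofReal (ψ g * θ g) ∂μG := by
    intro ψ hψ hc
    simp_rw [ENNReal.ofReal_mul' (hθ.nonneg _)]
    refine hθ.lintegral_translate μG hψ.ennreal_ofReal (fun h => ?_) x
    filter_upwards [hc h] with g hg
    rw [hg, ENNReal.ofReal_mul (modularRatio_pos h).le]
  have h2 := key (fun g => -φ g) hφ.neg fun h => by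
    filter_upwards [hcov h] with g hg
    rw [hg, mul_neg]
  simp only [neg_mul] at h2
  rw [key φ hφ hcov, h2]

/-- The form for complex functions of the independence of the weight. -/
theorem IsWeight.integral_translate (hθ : IsWeight μH θ) {φ : G → ℂ}
    (hφ : AEMeasurable φ μG)
    (hcov : ∀ h : H, ∀ᵐ g ∂μG, φ (g * h) = modularRatio h * φ g)
    (hi : Integrable (fun g => φ g * (θ g : ℂ)) μG) (x : G) :
    Integrable (fun g => φ g * (θ (x * g) : ℂ)) μG ∧
      ∫ g, φ g * (θ (x * g) : ℂ) ∂μG = ∫ g, φ g * (θ g : ℂ) ∂μG := by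
  have e1 : ∀ (z : ℂ) (t : ℝ), RCLike.re (z * (t : ℂ)) = RCLike.re z * t := by simp
  have e2 : ∀ (z : ℂ) (t : ℝ), RCLike.im (z * (t : ℂ)) = RCLike.im z * t := by simp
  have hre := hi.re
  have him := hi.im
  simp only [e1, e2] at hre him
  have h1 := hθ.integral_translate_real μG (φ := fun g => RCLike.re (φ g))
    (RCLike.measurable_re.comp_aemeasurable hφ)
    (fun h => by filter_upwards [hcov h] with g hg; rw [hg]; simp) hre x
  have h2 := hθ.integral_translate_real μG (φ := fun g => RCLike.im (φ g))
    (RCLike.measurable_im.comp_aemeasurable hφ)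
    (fun h => by filter_upwards [hcov h] with g hg; rw [hg]; simp) him x
  have hi' : Integrable (fun g => φ g * (θ (x * g) : ℂ)) μG := by
    refine (h1.1.ofReal (𝕜 := ℂ)).add ((h2.1.ofReal (𝕜 := ℂ)).mul_const Complex.I) |>.congr ?_
    refine Filter.Eventually.of_forall fun g => ?_
    apply Complex.ext <;> simp
  refine ⟨hi', ?_⟩
  apply Complex.ext
  · have a := integral_re hi'
    have b := integral_re hi
    simp only [e1] at a b
    rw [h1.2] at a
    exact a.symm.trans b
  · have a := integral_im hi'
    have b := integral_im hi
    simp only [e2] at a b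
    rw [h2.2] at a
    exact a.symm.trans b

/-- The `H`-measure of the part of a coset lying in a compact set is bounded uniformly. -/
theorem exists_fibre_measure_le (μH : Measure H)
    [μH.IsHaarMeasure] {C : Set G} (hC : IsCompact C) :
    ∃ c : ℝ≥0, ∀ g : G, μH {h : H | g * h ∈ C} ≤ c := by
  have hK : IsCompact ((Subtype.val : H → G) ⁻¹' (C⁻¹ * C)) :=
    (inferInstance : IsClosed (H : Set G)).isClosedEmbedding_subtypeVal.isCompact_preimage (hC.inv.mul hC)
  refine ⟨(μH ((Subtype.val : H → G) ⁻¹' (C⁻¹ * C))).toNNReal, fun g => ?_⟩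
  rw [ENNReal.coe_toNNReal hK.measure_lt_top.ne]
  by_cases hg : ∃ h₀ : H, g * h₀ ∈ C
  · obtain ⟨h₀, h₀C⟩ := hg
    rw [← measure_preimage_mul μH h₀ {h : H | g * h ∈ C}]
    refine measure_mono fun h hh => ?_
    refine ⟨(g * h₀)⁻¹, Set.inv_mem_inv.2 h₀C, g * (h₀ * h : H), hh, ?_⟩
    simp only [Subgroup.coe_mul]; group
  · push Not at hg
    have : {h : H | g * h ∈ C} = ∅ := Set.eq_empty_of_forall_notMem hg
    simp [this]

/-- A covariant function is integrable over compact sets if it is integrable against the weight: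
this is Weil's formula for the indicator function of a compact set, whose fibre integrals are
bounded. -/
theorem IsWeight.exists_setLIntegral_le (hθ : IsWeight μH θ) {C : Set G} (hC : IsCompact C) :
    ∃ c : ℝ≥0, ∀ φ : G → ℝ≥0∞, AEMeasurable φ μG →
      (∀ h : H, ∀ᵐ g ∂μG, φ (g * h) = ENNReal.ofReal (modularRatio h) * φ g) →
      ∫⁻ g in C, φ g ∂μG ≤ c * ∫⁻ g, φ g * ENNReal.ofReal (θ g) ∂μG := by
  obtain ⟨c, hc⟩ := exists_fibre_measure_le μH hC
  refine ⟨c, fun φ hφ hcov => ?_⟩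
  have hCm := hC.isClosed.measurableSet
  have h1 := hθ.lintegral_mul_eq μG hφ (ψ := C.indicator 1) (measurable_one.indicator hCm) hcov
  have h2 : ∀ g, φ g * C.indicator 1 g = C.indicator φ g := fun g => by
    by_cases hg : g ∈ C <;> simp [hg]
  simp only [h2] at h1
  rw [lintegral_indicator hCm] at h1
  rw [h1, ← lintegral_const_mul' _ _ ENNReal.coe_ne_top]
  refine lintegral_mono fun g => ?_
  rw [mul_comm]
  refine mul_le_mul_left ?_ _
  have h3 : ∀ h : H, C.indicator (1 : G → ℝ≥0∞) (g * h) =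
      Set.indicator {h : H | g * (h : G) ∈ C} 1 h := fun h => rfl
  simp only [h3]
  rw [lintegral_indicator_one]
  · exact hc g
  · have hm : Measurable fun h : H => g * h := by fun_prop
    exact hm hCm

/-- The measure `θ(g) dg` whose `L²` norm is the norm of the induced representation. -/
def weightMeasure (μG : Measure G) (θ : C(G, ℝ)) : Measure G :=
  μG.withDensity fun g => ENNReal.ofReal (θ g)

/-- A set which is almost `H`-invariant on the right is null for Haar measure as soon as it is null
for the weighted measure. -/
theorem IsWeight.measure_eq_zero (hθ : IsWeight μH θ) {B : Set G} (hB : MeasurableSet B)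
    (hinv : ∀ h : H, ∀ᵐ g ∂μG, g * (h : G) ∈ B ↔ g ∈ B) (h0 : weightMeasure μG θ B = 0) :
    μG B = 0 := by
  have hθm : Measurable fun g => ENNReal.ofReal (θ g) := by fun_prop
  -- the function with value `∞` on `B` is covariant whatever the modular ratio
  have h1 := hθ.lintegral_mul_eq μG (φ := B.indicator fun _ => ∞) (ψ := 1)
    (measurable_const.indicator hB).aemeasurable measurable_one fun h => by
      filter_upwards [hinv h] with g hg
      have := modularRatio_pos h
      by_cases hgB : g ∈ B
      · simp [hg.2 hgB, hgB, ENNReal.mul_top, this]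
      · simp [mt hg.1 hgB, hgB]
  have h2 : (B.indicator fun _ => ∞ : G → ℝ≥0∞) =ᵐ[weightMeasure μG θ] 0 :=
    indicator_meas_zero h0
  rw [weightMeasure, Filter.EventuallyEq, ae_withDensity_iff hθm] at h2
  have h3 : ∫⁻ g, B.indicator (fun _ => ∞) g * ENNReal.ofReal (θ g) *
      ∫⁻ h : H, (1 : G → ℝ≥0∞) (g * h) ∂μH ∂μG = ∫⁻ g, 0 ∂μG := by
    refine lintegral_congr_ae ?_
    filter_upwards [h2] with g hg
    by_cases hz : ENNReal.ofReal (θ g) = 0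
    · simp [hz]
    · simp [hg hz]
  rw [h3, lintegral_zero] at h1
  simp only [Pi.one_apply, mul_one] at h1
  rw [lintegral_indicator hB, setLIntegral_const] at h1
  simpa using h1

end WeilConsequences

/-! ### Multiplication by indicator functions in `L²` -/

namespace MeasureTheory

section Indicator

variable {α : Type*} [MeasurableSpace α] {ν : Measure α} {K : Type*} [NormedAddCommGroup K]
  [InnerProductSpace ℂ K]

theorem eLpNorm_two_sq (f : α → K) : eLpNorm f 2 ν ^ 2 = ∫⁻ x, ‖f x‖ₑ ^ 2 ∂ν := by
  rw [eLpNorm_eq_lintegral_rpow_enorm_toReal (by simp) (by simp), ← ENNReal.rpow_natCast,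
    ← ENNReal.rpow_mul]
  simp

theorem Lp.enorm_sq (f : Lp K 2 ν) : ‖f‖ₑ ^ 2 = ∫⁻ x, ‖f x‖ₑ ^ 2 ∂ν := by
  rw [Lp.enorm_def, eLpNorm_two_sq]

/-- Multiplication by the indicator function of a measurable set, as an operator in `L²`. -/
def Lp.indicatorMap {s : Set α} (hs : MeasurableSet s) : Lp K 2 ν →L[ℂ] Lp K 2 ν :=
  LinearMap.mkContinuous
    { toFun := fun f => ((Lp.memLp f).indicator hs).toLp _
      map_add' := fun f g => by
        rw [← MemLp.toLp_add]
        refine MemLp.toLp_congr _ _ ?_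
        filter_upwards [Lp.coeFn_add f g] with x hx
        by_cases h : x ∈ s
        · simp only [Set.indicator_of_mem h, hx, Pi.add_apply]
        · simp [h]
      map_smul' := fun c f => by
        rw [RingHom.id_apply, ← MemLp.toLp_const_smul]
        refine MemLp.toLp_congr _ _ ?_
        filter_upwards [Lp.coeFn_smul c f] with x hx
        by_cases h : x ∈ s
        · simp only [Set.indicator_of_mem h, hx, Pi.smul_apply]
        · simp [h] }
    1 (fun f => by
      rw [one_mul]
      refine Lp.norm_le_norm_of_ae_le ?_
      filter_upwards [((Lp.memLp f).indicator hs).coeFn_toLp] with x hx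
      simp only [LinearMap.coe_mk, AddHom.coe_mk]
      rw [hx]
      exact norm_indicator_le_norm_self _ _)

theorem Lp.coeFn_indicatorMap {s : Set α} (hs : MeasurableSet s) (f : Lp K 2 ν) :
    Lp.indicatorMap hs f =ᵐ[ν] s.indicator f :=
  ((Lp.memLp f).indicator hs).coeFn_toLp

theorem Lp.inner_indicatorMap {s : Set α} (hs : MeasurableSet s) (f g : Lp K 2 ν) :
    inner ℂ f (Lp.indicatorMap hs g) = ∫ x in s, inner ℂ (f x) (g x) ∂ν := by
  rw [L2.inner_def, ← integral_indicator hs]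
  refine integral_congr_ae ?_
  filter_upwards [Lp.coeFn_indicatorMap hs g] with x hx
  rw [hx]
  by_cases h : x ∈ s <;> simp [h]

end Indicator

end MeasureTheory

/-! ### The induced representation inside the weighted `L²` space -/

section Induced

variable {G : Type u} [Group G] [TopologicalSpace G] [IsTopologicalGroup G] [T2Space G]
  [LocallyCompactSpace G] [SecondCountableTopology G] [MeasurableSpace G] [BorelSpace G]
  {H : Subgroup G} [IsClosed (H : Set G)]
  {μH : Measure H} [μH.IsHaarMeasure] {θ : C(G, ℝ)} {μG : Measure G} [μG.IsHaarMeasure]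
  {K : Type w} [NormedAddCommGroup K] [InnerProductSpace ℂ K]

theorem weightMeasure_absolutelyContinuous : weightMeasure μG θ ≪ μG :=
  withDensity_absolutelyContinuous _ _

theorem lintegral_weightMeasure (f : G → ℝ≥0∞) :
    ∫⁻ g, f g ∂weightMeasure μG θ = ∫⁻ g, f g * ENNReal.ofReal (θ g) ∂μG := by
  rw [weightMeasure, lintegral_withDensity_eq_lintegral_mul_non_measurable _ (by fun_prop)
    (Filter.Eventually.of_forall fun _ => ENNReal.ofReal_lt_top)]
  simp only [Pi.mul_apply, mul_comm]

theorem IsWeight.setIntegral_weightMeasure (hθ : IsWeight μH θ) (f : G → ℂ) {s : Set G}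
    (hs : MeasurableSet s) :
    ∫ g in s, f g ∂weightMeasure μG θ = ∫ g in s, f g * (θ g : ℂ) ∂μG := by
  rw [weightMeasure, setIntegral_withDensity_eq_setIntegral_toReal_smul (by fun_prop)
    (Filter.Eventually.of_forall fun _ => ENNReal.ofReal_lt_top) _ hs]
  refine integral_congr_ae (Filter.Eventually.of_forall fun g => ?_)
  simp only [ENNReal.toReal_ofReal (hθ.nonneg g), Complex.real_smul, mul_comm]

theorem IsWeight.integrable_weightMeasure_iff (hθ : IsWeight μH θ) {f : G → ℂ} :
    Integrable f (weightMeasure μG θ) ↔ Integrable (fun g => f g * (θ g : ℂ)) μG := by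
  rw [weightMeasure, integrable_withDensity_iff_integrable_smul' (by fun_prop)
    (Filter.Eventually.of_forall fun _ => ENNReal.ofReal_lt_top)]
  simp only [ENNReal.toReal_ofReal (hθ.nonneg _), Complex.real_smul, mul_comm]

theorem inducedNormSq_eq (F : G →ₘ[μG] K) :
    inducedNormSq μG θ F = eLpNorm F 2 (weightMeasure μG θ) ^ 2 := by
  rw [eLpNorm_two_sq, lintegral_weightMeasure]; rfl

theorem inducedNormSq_congr {F : G →ₘ[μG] K} {f : G → K} (h : F =ᵐ[μG] f) :
    inducedNormSq μG θ F = ∫⁻ g, ‖f g‖ₑ ^ 2 * ENNReal.ofReal (θ g) ∂μG := by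
  refine lintegral_congr_ae ?_
  filter_upwards [h] with g hg
  rw [hg]

variable {σ : UnitaryRep H K}

theorem memLp_of_mem_inducedSpace {F : G →ₘ[μG] K} (hF : F ∈ inducedSpace μG θ σ) :
    MemLp F 2 (weightMeasure μG θ) := by
  refine ⟨F.aestronglyMeasurable.mono_ac weightMeasure_absolutelyContinuous, ?_⟩
  have := hF.2
  rw [inducedNormSq_eq] at this
  by_contra h
  rw [not_lt_top_iff.1 h] at this
  simp at this

/-- The squared norm of a function satisfying the covariance condition of the induced
representation is covariant. -/
theorem norm_sq_covariant {F : G → K}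
    (hF : ∀ h : H, ∀ᵐ g ∂μG, F (g * h) = (Real.sqrt (modularRatio h) : ℂ) • σ h⁻¹ (F g)) (h : H) :
    ∀ᵐ g ∂μG, ‖F (g * h)‖ₑ ^ 2 = ENNReal.ofReal (modularRatio h) * ‖F g‖ₑ ^ 2 := by
  filter_upwards [hF h] with g hg
  rw [hg, enorm_smul, mul_pow]
  congr 1
  · rw [← ofReal_norm, Complex.norm_real, Real.norm_of_nonneg (Real.sqrt_nonneg _),
      ← ENNReal.ofReal_pow (Real.sqrt_nonneg _), Real.sq_sqrt (modularRatio_pos h).le]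
  · rw [← ofReal_norm, LinearIsometryEquiv.norm_map, ofReal_norm]

/-- The inclusion of the space of the induced representation in `L²(G, θ(g) dg)`. It is isometric,
by definition of the norm of the induced representation. -/
def inducedToLp (μG : Measure G) [μG.IsHaarMeasure] (θ : C(G, ℝ)) (σ : UnitaryRep H K) :
    inducedSpace μG θ σ →ₗ[ℂ] Lp K 2 (weightMeasure μG θ) where
  toFun F := (memLp_of_mem_inducedSpace F.2).toLp _
  map_add' F₁ F₂ := by
    rw [← MemLp.toLp_add]
    exact MemLp.toLp_congr _ _
      (weightMeasure_absolutelyContinuous.ae_le (AEEqFun.coeFn_add F₁.1 F₂.1))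
  map_smul' c F := by
    rw [RingHom.id_apply, ← MemLp.toLp_const_smul]
    exact MemLp.toLp_congr _ _
      (weightMeasure_absolutelyContinuous.ae_le (AEEqFun.coeFn_smul c F.1))

theorem coeFn_inducedToLp (F : inducedSpace μG θ σ) :
    inducedToLp μG θ σ F =ᵐ[weightMeasure μG θ] (F : G →ₘ[μG] K) :=
  (memLp_of_mem_inducedSpace F.2).coeFn_toLp

theorem enorm_inducedToLp_sq (F : inducedSpace μG θ σ) :
    ‖inducedToLp μG θ σ F‖ₑ ^ 2 = inducedNormSq μG θ (F : G →ₘ[μG] K) := by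
  rw [Lp.enorm_def, inducedNormSq_eq, eLpNorm_congr_ae (coeFn_inducedToLp F)]

theorem IsWeight.inner_inducedToLp (hθ : IsWeight μH θ) (F₁ F₂ : inducedSpace μG θ σ) :
    inner ℂ (inducedToLp μG θ σ F₂) (inducedToLp μG θ σ F₁) =
      inducedInner μG θ (F₁ : G →ₘ[μG] K) F₂ := by
  rw [L2.inner_def, inducedInner]
  have := hθ.setIntegral_weightMeasure (μG := μG)
    (fun g => inner ℂ ((F₂ : G →ₘ[μG] K) g) ((F₁ : G →ₘ[μG] K) g)) MeasurableSet.univ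
  simp only [Measure.restrict_univ] at this
  rw [← this]
  refine integral_congr_ae ?_
  filter_upwards [coeFn_inducedToLp F₁, coeFn_inducedToLp F₂] with g h1 h2
  rw [h1, h2]

/-- Functions in the induced representation are determined by their values where `θ` does not
vanish: the set on which two of them differ is invariant under `H`. -/
theorem IsWeight.ae_eq_of_ae_eq_weightMeasure (hθ : IsWeight μH θ) {F₁ F₂ : G → K}
    (m₁ : AEStronglyMeasurable F₁ μG) (m₂ : AEStronglyMeasurable F₂ μG)
    (h₁ : ∀ h : H, ∀ᵐ g ∂μG, F₁ (g * h) = (Real.sqrt (modularRatio h) : ℂ) • σ h⁻¹ (F₁ g))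
    (h₂ : ∀ h : H, ∀ᵐ g ∂μG, F₂ (g * h) = (Real.sqrt (modularRatio h) : ℂ) • σ h⁻¹ (F₂ g))
    (h : F₁ =ᵐ[weightMeasure μG θ] F₂) : F₁ =ᵐ[μG] F₂ := by
  wlog hm : StronglyMeasurable F₁ ∧ StronglyMeasurable F₂ generalizing F₁ F₂
  · have e1 := m₁.ae_eq_mk
    have e2 := m₂.ae_eq_mk
    have hcov : ∀ {F F' : G → K}, F =ᵐ[μG] F' →
        (∀ h : H, ∀ᵐ g ∂μG, F (g * h) = (Real.sqrt (modularRatio h) : ℂ) • σ h⁻¹ (F g)) →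
        ∀ h : H, ∀ᵐ g ∂μG, F' (g * h) = (Real.sqrt (modularRatio h) : ℂ) • σ h⁻¹ (F' g) := by
      intro F F' he hF h
      filter_upwards [he, (quasiMeasurePreserving_mul_right μG (h : G)).ae he, hF h]
        with g a b c
      rw [← a, ← b, c]
    have := this (F₁ := m₁.mk F₁) (F₂ := m₂.mk F₂) m₁.stronglyMeasurable_mk.aestronglyMeasurable
      m₂.stronglyMeasurable_mk.aestronglyMeasurable (hcov e1 h₁) (hcov e2 h₂)
      ((weightMeasure_absolutelyContinuous.ae_eq e1).symm.trans
        (h.trans (weightMeasure_absolutelyContinuous.ae_eq e2)))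
      ⟨m₁.stronglyMeasurable_mk, m₂.stronglyMeasurable_mk⟩
    exact e1.trans (this.trans e2.symm)
  have hB : MeasurableSet {g | F₁ g ≠ F₂ g} :=
    (hm.1.measurableSet_eq_fun hm.2).compl
  refine hθ.measure_eq_zero μG hB (fun k => ?_) h
  filter_upwards [h₁ k, h₂ k] with g a b
  have hr : (Real.sqrt (modularRatio k) : ℂ) ≠ 0 := by
    exact_mod_cast (Real.sqrt_pos.2 (modularRatio_pos k)).ne'
  change F₁ (g * k) ≠ F₂ (g * k) ↔ F₁ g ≠ F₂ g
  rw [a, b, ne_eq, (smul_right_injective K hr).eq_iff, (σ k⁻¹).injective.eq_iff]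

theorem IsWeight.inducedToLp_injective (hθ : IsWeight μH θ) :
    Function.Injective (inducedToLp μG θ σ) := by
  intro F₁ F₂ h
  apply Subtype.ext
  apply AEEqFun.ext
  refine hθ.ae_eq_of_ae_eq_weightMeasure (AEEqFun.aestronglyMeasurable _)
    (AEEqFun.aestronglyMeasurable _) F₁.2.1 F₂.2.1 ?_
  refine (coeFn_inducedToLp F₁).symm.trans ?_
  rw [h]
  exact coeFn_inducedToLp F₂

/-- The induced representation is complete. A subsequence of an `L²`-convergent sequence converges
almost everywhere where `θ` does not vanish; the set of convergence is invariant under `H`, hence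
conull for Haar measure, and the pointwise limit is covariant. -/
theorem IsWeight.isClosed_range_inducedToLp [CompleteSpace K] (hθ : IsWeight μH θ) :
    IsClosed (LinearMap.range (inducedToLp μG θ σ) : Set (Lp K 2 (weightMeasure μG θ))) := by
  refine isClosed_of_closure_subset fun Φ hΦ => ?_
  obtain ⟨x, hx, hlim⟩ := mem_closure_iff_seq_limit.1 hΦ
  choose F hF using hx
  have hlim' : TendstoInMeasure (weightMeasure μG θ) (fun n => (x n : G → K)) Filter.atTop Φ :=
    tendstoInMeasure_of_tendsto_Lp hlim
  obtain ⟨ns, hns, hae⟩ := hlim'.exists_seq_tendsto_ae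
  have hae' : ∀ᵐ g ∂weightMeasure μG θ,
      Filter.Tendsto (fun n => (F (ns n) : G →ₘ[μG] K) g) Filter.atTop (nhds (Φ g)) := by
    have h2 : ∀ᵐ g ∂weightMeasure μG θ, ∀ n, x n g = (F n : G →ₘ[μG] K) g :=
      ae_all_iff.2 fun n => by rw [← hF n]; exact coeFn_inducedToLp (F n)
    filter_upwards [hae, h2] with g a b
    simpa only [b] using a
  have hcov : ∀ h : H, ∀ᵐ g ∂μG, ∀ n, (F (ns n) : G →ₘ[μG] K) (g * h) =
      (Real.sqrt (modularRatio h) : ℂ) • σ h⁻¹ ((F (ns n) : G →ₘ[μG] K) g) :=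
    fun h => ae_all_iff.2 fun n => (F (ns n)).2.1 h
  -- convergence spreads along cosets by covariance
  have hconv : ∀ᵐ g ∂μG, ∃ l,
      Filter.Tendsto (fun n => (F (ns n) : G →ₘ[μG] K) g) Filter.atTop (nhds l) := by
    have hB : MeasurableSet {g | ∃ l,
        Filter.Tendsto (fun n => (F (ns n) : G →ₘ[μG] K) g) Filter.atTop (nhds l)} :=
      StronglyMeasurable.measurableSet_exists_tendsto
        fun n => (F (ns n) : G →ₘ[μG] K).stronglyMeasurable
    refine hθ.measure_eq_zero μG hB.compl (fun h => ?_) ?_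
    · have hr : (Real.sqrt (modularRatio h) : ℂ) ≠ 0 := by
        exact_mod_cast (Real.sqrt_pos.2 (modularRatio_pos h)).ne'
      filter_upwards [hcov h] with g hg
      refine not_congr ⟨?_, ?_⟩
      · rintro ⟨l, hl⟩
        refine ⟨(σ h⁻¹).symm ((Real.sqrt (modularRatio h) : ℂ)⁻¹ • l), ?_⟩
        have := (((σ h⁻¹).symm.continuous.comp
          (continuous_const_smul (Real.sqrt (modularRatio h) : ℂ)⁻¹)).tendsto l).comp hl
        refine this.congr fun n => ?_
        simp only [Function.comp_apply, hg n, inv_smul_smul₀ hr,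
          LinearIsometryEquiv.symm_apply_apply]
      · rintro ⟨l, hl⟩
        refine ⟨(Real.sqrt (modularRatio h) : ℂ) • σ h⁻¹ l, ?_⟩
        have := (((σ h⁻¹).continuous.const_smul
          (Real.sqrt (modularRatio h) : ℂ)).tendsto l).comp hl
        exact this.congr fun n => (hg n).symm
    · exact mem_ae_iff.1 (hae'.mono fun g hg => ⟨_, hg⟩)
  obtain ⟨f, hfm, hf⟩ := exists_stronglyMeasurable_limit_of_tendsto_ae
    (fun n => (F (ns n) : G →ₘ[μG] K).aestronglyMeasurable) hconv
  have hfcov : ∀ h : H, ∀ᵐ g ∂μG,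
      f (g * h) = (Real.sqrt (modularRatio h) : ℂ) • σ h⁻¹ (f g) := by
    intro h
    filter_upwards [hf, (quasiMeasurePreserving_mul_right μG (h : G)).ae hf, hcov h] with g a b c
    refine tendsto_nhds_unique b ?_
    have := (((σ h⁻¹).continuous.const_smul
      (Real.sqrt (modularRatio h) : ℂ)).tendsto (f g)).comp a
    exact this.congr fun n => (c n).symm
  have hfΦ : f =ᵐ[weightMeasure μG θ] Φ := by
    filter_upwards [hae', weightMeasure_absolutelyContinuous.ae_le hf] with g a b
    exact tendsto_nhds_unique b a
  have hmk := AEEqFun.coeFn_mk f (hfm.aestronglyMeasurable (μ := μG))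
  have hmem : AEEqFun.mk f (hfm.aestronglyMeasurable (μ := μG)) ∈ inducedSpace μG θ σ := by
    refine ⟨fun h => ?_, ?_⟩
    · filter_upwards [hmk, (quasiMeasurePreserving_mul_right μG (h : G)).ae hmk, hfcov h]
        with g a b c
      rw [a, b, c]
    · rw [inducedNormSq_eq, eLpNorm_congr_ae
        ((weightMeasure_absolutelyContinuous.ae_eq hmk).trans hfΦ)]
      exact ENNReal.pow_lt_top (Lp.memLp Φ).2
  refine ⟨⟨_, hmem⟩, ?_⟩
  apply Lp.ext
  exact (coeFn_inducedToLp _).trans ((weightMeasure_absolutelyContinuous.ae_eq hmk).trans hfΦ)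

/-! #### Translations and multiplication operators -/

theorem inducedAct_mem [CompleteSpace K] (hθ : IsWeight μH θ) (x : G) {F : G →ₘ[μG] K}
    (hF : F ∈ inducedSpace μG θ σ) :
    inducedAct μG x F ∈ inducedSpace μG θ σ ∧
      inducedNormSq μG θ (inducedAct μG x F) = inducedNormSq μG θ F := by
  have hmp := measurePreserving_mul_left μG x⁻¹
  have he : inducedAct μG x F =ᵐ[μG] fun g => F (x⁻¹ * g) :=
    AEEqFun.coeFn_compMeasurePreserving F hmp
  have hn : inducedNormSq μG θ (inducedAct μG x F) = inducedNormSq μG θ F := by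
    rw [inducedNormSq_congr he]
    have h1 := lintegral_mul_left_eq_self (μ := μG)
      (fun g => ‖F (x⁻¹ * g)‖ₑ ^ 2 * ENNReal.ofReal (θ g)) x
    simp only [inv_mul_cancel_left] at h1
    rw [← h1]
    exact hθ.lintegral_translate μG (φ := fun g => ‖F g‖ₑ ^ 2)
      (F.aestronglyMeasurable.enorm.pow_const 2) (norm_sq_covariant hF.1) x
  refine ⟨⟨fun h => ?_, by rw [hn]; exact hF.2⟩, hn⟩
  filter_upwards [he, (quasiMeasurePreserving_mul_right μG (h : G)).ae he,
    hmp.quasiMeasurePreserving.ae (hF.1 h)] with g a b c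
  rw [a, b, ← c, mul_assoc]

theorem cosetPreimage_mul_mem {Y : Set (G ⧸ H)} (g : G) (h : H) :
    g * (h : G) ∈ cosetPreimage Y ↔ g ∈ cosetPreimage Y := by
  unfold cosetPreimage
  rw [Set.mem_preimage, Set.mem_preimage, QuotientGroup.mk_mul_of_mem g h.2]

theorem coeFn_inducedLocalisation {Y : Set (G ⧸ H)} (hY : IsBorel Y) (F : G →ₘ[μG] K) :
    inducedLocalisation μG hY F =ᵐ[μG] (cosetPreimage Y).indicator F :=
  AEEqFun.coeFn_mk _ _

theorem inducedLocalisation_mem {Y : Set (G ⧸ H)} (hY : IsBorel Y) {F : G →ₘ[μG] K}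
    (hF : F ∈ inducedSpace μG θ σ) : inducedLocalisation μG hY F ∈ inducedSpace μG θ σ := by
  have he := coeFn_inducedLocalisation hY F
  refine ⟨fun h => ?_, ?_⟩
  · filter_upwards [he, (quasiMeasurePreserving_mul_right μG (h : G)).ae he, hF.1 h] with g a b c
    rw [a, b]
    by_cases hg : g ∈ cosetPreimage Y
    · rw [Set.indicator_of_mem hg, Set.indicator_of_mem ((cosetPreimage_mul_mem g h).2 hg), c]
    · rw [Set.indicator_of_notMem hg,
        Set.indicator_of_notMem (mt (cosetPreimage_mul_mem g h).1 hg), map_zero, smul_zero]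
  · refine lt_of_le_of_lt ?_ hF.2
    rw [inducedNormSq_congr he]
    refine lintegral_mono fun g => ?_
    gcongr
    by_cases hg : g ∈ cosetPreimage Y <;> simp [hg]

theorem inducedToLp_inducedLocalisation {Y : Set (G ⧸ H)} (hY : IsBorel Y)
    (F : inducedSpace μG θ σ) :
    inducedToLp μG θ σ ⟨inducedLocalisation μG hY F, inducedLocalisation_mem hY F.2⟩ =
      Lp.indicatorMap hY.measurableSet_cosetPreimage (inducedToLp μG θ σ F) := by
  apply Lp.ext
  refine (coeFn_inducedToLp _).trans (Filter.EventuallyEq.trans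
    (weightMeasure_absolutelyContinuous.ae_eq (coeFn_inducedLocalisation hY (F : G →ₘ[μG] K)))
    (Filter.EventuallyEq.trans ?_ (Lp.coeFn_indicatorMap _ _).symm))
  filter_upwards [coeFn_inducedToLp F] with g hg
  by_cases h : g ∈ cosetPreimage Y <;> simp [h, hg]

end Induced

/-! ### The Gårding domain -/

namespace UnitaryRep

variable {G : Type*} [Group G] [TopologicalSpace G] [IsTopologicalGroup G]
  [LocallyCompactSpace G] [MeasurableSpace G] [BorelSpace G] [T2Space G]
  {V : Type*} [NormedAddCommGroup V] [InnerProductSpace ℂ V] [CompleteSpace V]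
  (μ : Measure G) [μ.IsHaarMeasure] (π : UnitaryRep G V)

theorem integrable_smul_apply {f : G → ℂ} (hf : Continuous f) (hc : HasCompactSupport f) (u : V) :
    Integrable (fun g => f g • π g u) μ :=
  (hf.smul (π.continuous_apply u)).integrable_of_hasCompactSupport hc.smul_right

/-- The Gårding domain is dense: `π(f) v / ∫ f` is close to `v` if `f ≥ 0` is supported near the
identity. -/
theorem dense_garding : Dense (garding μ π : Set V) := by
  intro v
  refine Metric.mem_closure_iff.2 fun ε hε => ?_
  have hU : IsOpen {g : G | ‖π g v - v‖ < ε / 2} :=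
    isOpen_lt ((π.continuous_apply v).sub continuous_const).norm continuous_const
  obtain ⟨f, hf1, hf0, hfc, hf01⟩ := exists_continuous_one_zero_of_isCompact
    (isCompact_singleton (x := (1 : G))) hU.isClosed_compl (by simp [hε])
  have hfi : Integrable f μ := f.continuous.integrable_of_hasCompactSupport hfc
  have hpos : 0 < ∫ g, f g ∂μ :=
    f.continuous.integral_pos_of_hasCompactSupport_nonneg_nonzero hfc (fun x => (hf01 x).1)
      (x := 1) (by rw [hf1 rfl]; exact one_ne_zero)
  set c := ∫ g, f g ∂μ
  have hfcont : Continuous fun g => (f g : ℂ) := Complex.continuous_ofReal.comp f.continuous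
  have hfcs : HasCompactSupport fun g => (f g : ℂ) := hfc.comp_left Complex.ofReal_zero
  refine ⟨(c : ℂ)⁻¹ • smear μ π (fun g => (f g : ℂ)) v,
    (garding μ π).smul_mem _ (Submodule.subset_span ⟨_, v, hfcont, hfcs, rfl⟩), ?_⟩
  have h1 : smear μ π (fun g => (f g : ℂ)) v - (c : ℂ) • v =
      ∫ g, (f g : ℂ) • (π g v - v) ∂μ := by
    have e : (c : ℂ) • v = ∫ g, (f g : ℂ) • v ∂μ := by
      rw [integral_smul_const]
      exact congrArg (· • v) integral_ofReal.symm
    have e2 := integral_sub (integrable_smul_apply μ π hfcont hfcs v)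
      ((hfi.ofReal (𝕜 := ℂ)).smul_const v)
    rw [e, smear]
    refine e2.symm.trans (integral_congr_ae (Filter.Eventually.of_forall fun g => ?_))
    exact (smul_sub _ _ _).symm
  have h2 : ‖smear μ π (fun g => (f g : ℂ)) v - (c : ℂ) • v‖ ≤ c * (ε / 2) := by
    rw [h1]
    refine (norm_integral_le_of_norm_le (hfi.mul_const (ε / 2))
      (Filter.Eventually.of_forall fun g => ?_)).trans_eq (integral_mul_const _ _)
    rw [norm_smul, Complex.norm_real, Real.norm_of_nonneg (hf01 g).1]
    by_cases hg : ‖π g v - v‖ < ε / 2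
    · exact mul_le_mul_of_nonneg_left hg.le (hf01 g).1
    · rw [hf0 hg]; simp
  have hc0 : (c : ℂ) ≠ 0 := by exact_mod_cast hpos.ne'
  have h3 : (c : ℂ)⁻¹ • smear μ π (fun g => (f g : ℂ)) v - v =
      (c : ℂ)⁻¹ • (smear μ π (fun g => (f g : ℂ)) v - (c : ℂ) • v) := by
    rw [smul_sub, inv_smul_smul₀ hc0]
  rw [dist_comm, dist_eq_norm, h3, norm_smul, norm_inv, Complex.norm_real,
    Real.norm_of_nonneg hpos.le]
  calc c⁻¹ * _ ≤ c⁻¹ * (c * (ε / 2)) := by gcongr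
    _ = ε / 2 := by field_simp
    _ < ε := by linarith

theorem gardingAct_mul (g g' : G) (v : garding μ π) :
    gardingAct μ π (g * g') v = gardingAct μ π g (gardingAct μ π g' v) :=
  Subtype.ext (mul_apply π g g' v)

theorem gardingAct_one (v : garding μ π) : gardingAct μ π 1 v = v :=
  Subtype.ext (by simp [gardingAct])

theorem gardingAct_add (g : G) (u v : garding μ π) :
    gardingAct μ π g (u + v) = gardingAct μ π g u + gardingAct μ π g v :=
  Subtype.ext (by simp [gardingAct])

theorem gardingAct_smul (g : G) (c : ℂ) (v : garding μ π) :
    gardingAct μ π g (c • v) = c • gardingAct μ π g v :=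
  Subtype.ext (by simp [gardingAct])

theorem inner_apply_left (g : G) (u v : V) : inner ℂ (π g u) v = inner ℂ u (π g⁻¹ v) := by
  rw [← (π g⁻¹).inner_map_map, ← mul_apply, inv_mul_cancel, map_one]; rfl

end UnitaryRep

/-! ### Countable additivity of multiplication operators -/

/-- Multiplication operators with indicator functions are strongly countably additive, by dominated
convergence. -/
theorem MeasureTheory.Lp.hasSum_indicatorMap {α : Type*} [MeasurableSpace α] {ν : Measure α}
    {K : Type*} [NormedAddCommGroup K] [InnerProductSpace ℂ K] {s : ℕ → Set α}
    (hs : ∀ n, MeasurableSet (s n)) (hd : Pairwise (Function.onFun Disjoint s)) (f : Lp K 2 ν) :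
    HasSum (fun n => Lp.indicatorMap (hs n) f) (Lp.indicatorMap (MeasurableSet.iUnion hs) f) := by
  have hsum : ∀ t : Finset ℕ, (∑ n ∈ t, Lp.indicatorMap (hs n) f) =
      Lp.indicatorMap (t.measurableSet_biUnion fun n _ => hs n) f := by
    intro t
    induction t using Finset.induction_on with
    | empty =>
      apply Lp.ext
      filter_upwards [Lp.coeFn_indicatorMap
        ((∅ : Finset ℕ).measurableSet_biUnion fun n _ => hs n) f, Lp.coeFn_zero K 2 ν] with x a b
      rw [a, Finset.sum_empty, b]; simp
    | insert n t hn ih =>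
      rw [Finset.sum_insert hn, ih]
      apply Lp.ext
      filter_upwards [Lp.coeFn_indicatorMap
        ((insert n t).measurableSet_biUnion fun n _ => hs n) f,
        Lp.coeFn_indicatorMap (t.measurableSet_biUnion fun n _ => hs n) f,
        Lp.coeFn_indicatorMap (hs n) f, Lp.coeFn_add (Lp.indicatorMap (hs n) f)
          (Lp.indicatorMap (t.measurableSet_biUnion fun n _ => hs n) f)] with x a b c d
      rw [d, Pi.add_apply, b, c, a]
      have hdis : Disjoint (s n) (⋃ i ∈ t, s i) := by
        rw [Set.disjoint_iUnion₂_right]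
        exact fun i hi => hd fun h => hn (h ▸ hi)
      have hu := congrFun (Set.indicator_union_of_disjoint hdis f) x
      rw [Finset.set_biUnion_insert]
      exact hu.symm
  unfold HasSum
  simp only [hsum, SummationFilter.unconditional_filter]
  rw [Lp.tendsto_Lp_iff_tendsto_eLpNorm']
  have hsq : ∀ t : Finset ℕ, eLpNorm
      (Lp.indicatorMap (t.measurableSet_biUnion fun n _ => hs n) f -
        Lp.indicatorMap (MeasurableSet.iUnion hs) f : α → K) 2 ν ^ 2 =
      ∫⁻ x, ‖(⋃ n ∈ t, s n).indicator f x - (⋃ n, s n).indicator f x‖ₑ ^ 2 ∂ν := by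
    intro t
    rw [eLpNorm_two_sq]
    refine lintegral_congr_ae ?_
    filter_upwards [Lp.coeFn_indicatorMap (t.measurableSet_biUnion fun n _ => hs n) f,
      Lp.coeFn_indicatorMap (MeasurableSet.iUnion hs) f] with x a b
    rw [Pi.sub_apply, a, b]
  have hm := Lp.aestronglyMeasurable f
  have hlim : Filter.Tendsto (fun t : Finset ℕ =>
      ∫⁻ x, ‖(⋃ n ∈ t, s n).indicator f x - (⋃ n, s n).indicator f x‖ₑ ^ 2 ∂ν)
      Filter.atTop (nhds (∫⁻ _, 0 ∂ν)) := by
    refine tendsto_lintegral_filter_of_dominated_convergence' (fun x => ‖f x‖ₑ ^ 2)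
      (Filter.Eventually.of_forall fun t => ?_)
      (Filter.Eventually.of_forall fun t => Filter.Eventually.of_forall fun x => ?_) ?_
      (Filter.Eventually.of_forall fun x => ?_)
    · exact ((hm.indicator (t.measurableSet_biUnion fun n _ => hs n)).sub
        (hm.indicator (MeasurableSet.iUnion hs))).enorm.pow_const 2
    · gcongr
      by_cases h1 : x ∈ ⋃ n ∈ t, s n
      · have h2 : x ∈ ⋃ n, s n := Set.iUnion₂_subset_iUnion _ _ h1
        rw [Set.indicator_of_mem h1, Set.indicator_of_mem h2, sub_self, enorm_zero]
        exact bot_le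
      · rw [Set.indicator_of_notMem h1, zero_sub, enorm_neg]
        exact enorm_indicator_le_enorm_self _ _
    · rw [← Lp.enorm_sq]
      exact (ENNReal.pow_lt_top enorm_lt_top).ne
    · refine tendsto_const_nhds.congr' ?_
      have := tendsto_indicator_biUnion_finset s f x
      rw [Filter.tendsto_pure] at this
      filter_upwards [this] with t ht
      rw [ht, sub_self, enorm_zero, zero_pow two_ne_zero]
  rw [lintegral_zero] at hlim
  simp only [← hsq] at hlim
  have := ((ENNReal.continuous_rpow_const (y := 1 / 2)).tendsto 0).comp hlim
  rw [ENNReal.zero_rpow_of_pos (by norm_num)] at this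
  refine this.congr fun t => ?_
  rw [Function.comp_apply, ← ENNReal.rpow_natCast, ← ENNReal.rpow_mul]
  norm_num

/-! ### Tight admissible maps and isometries -/

section Tight

variable {G : Type u} [Group G] [TopologicalSpace G] [IsTopologicalGroup G] [T2Space G]
  [LocallyCompactSpace G] [SecondCountableTopology G] [MeasurableSpace G] [BorelSpace G]
  {H : Subgroup G} [IsClosed (H : Set G)]
  {μH : Measure H} [μH.IsHaarMeasure] {θ : C(G, ℝ)} {μG : Measure G} [μG.IsHaarMeasure]
  {V : Type v} [NormedAddCommGroup V] [InnerProductSpace ℂ V] [CompleteSpace V]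
  {K : Type w} [NormedAddCommGroup K] [InnerProductSpace ℂ K] [CompleteSpace K]
  {π : UnitaryRep G V} {σ : UnitaryRep H K} {A : π.garding μG →ₗ[ℂ] K}

theorem waveletFun_gardingAct (g : G) (v : π.garding μG) (x : G) :
    waveletFun μG A (π.gardingAct μG g v) x = waveletFun μG A v (g⁻¹ * x) := by
  simp only [waveletFun, ← UnitaryRep.gardingAct_mul, mul_inv_rev, inv_inv]

theorem waveletFun_add (u v : π.garding μG) :
    waveletFun μG A (u + v) = waveletFun μG A u + waveletFun μG A v := by
  ext x; simp [waveletFun, UnitaryRep.gardingAct_add]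

theorem waveletFun_smul (c : ℂ) (v : π.garding μG) :
    waveletFun μG A (c • v) = c • waveletFun μG A v := by
  ext x; simp [waveletFun, UnitaryRep.gardingAct_smul]

/-- The functions `A π(·⁻¹) v` satisfy the covariance condition of the induced representation, at
every point. -/
theorem IsAdmissible.waveletFun_mul (hA : IsAdmissible μG θ σ A) (v : π.garding μG) (x : G)
    (h : H) : waveletFun μG A v (x * h) =
      (Real.sqrt (modularRatio h) : ℂ) • σ h⁻¹ (waveletFun μG A v x) := by
  have h1 := hA.semiInvariant h⁻¹ (π.gardingAct μG x⁻¹ v)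
  have hr : (Real.sqrt (modularRatio h) : ℂ) ≠ 0 := by
    exact_mod_cast (Real.sqrt_pos.2 (modularRatio_pos h)).ne'
  simp only [waveletFun, mul_inv_rev]
  rw [h1, modularRatio_inv, Real.sqrt_inv, Complex.ofReal_inv, smul_inv_smul₀ hr,
    UnitaryRep.gardingAct_mul]
  rfl

/-- By tightness `v ↦ A π(·⁻¹) v` is isometric on the dense Gårding domain, and extends. -/
theorem IsTightAdmissible.exists_linearIsometry (hA : IsTightAdmissible μG θ σ A) :
    ∃ T : V →ₗᵢ[ℂ] Lp K 2 (weightMeasure μG θ),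
      ∀ v : π.garding μG, T v =ᵐ[weightMeasure μG θ] waveletFun μG A v := by
  have hsq : ∀ v : π.garding μG,
      eLpNorm (waveletFun μG A v) 2 (weightMeasure μG θ) ^ 2 = ‖(v : V)‖ₑ ^ 2 := by
    intro v
    rw [eLpNorm_two_sq, lintegral_weightMeasure, hA.tight, ENNReal.ofReal_pow (norm_nonneg _),
      ofReal_norm]
  have hn : ∀ v : π.garding μG,
      eLpNorm (waveletFun μG A v) 2 (weightMeasure μG θ) = ‖(v : V)‖ₑ := by
    intro v
    exact (ENNReal.pow_right_strictMono two_ne_zero).injective (hsq v)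
  have hmem : ∀ v : π.garding μG, MemLp (waveletFun μG A v) 2 (weightMeasure μG θ) := fun v =>
    ⟨(hA.measurable v).mono_ac weightMeasure_absolutelyContinuous, by
      rw [hn]; exact enorm_lt_top⟩
  let T₀ : π.garding μG →ₗᵢ[ℂ] Lp K 2 (weightMeasure μG θ) :=
    { toFun := fun v => (hmem v).toLp _
      map_add' := fun u v => by
        rw [← MemLp.toLp_add]
        exact MemLp.toLp_congr _ _ (by rw [waveletFun_add])
      map_smul' := fun c v => by
        rw [RingHom.id_apply, ← MemLp.toLp_const_smul]
        exact MemLp.toLp_congr _ _ (by rw [waveletFun_smul])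
      norm_map' := fun v => by
        change ‖(hmem v).toLp _‖ = ‖(v : V)‖
        rw [Lp.norm_toLp, hn, toReal_enorm] }
  have hd : DenseRange (π.garding μG).subtypeL := by
    simpa [DenseRange] using UnitaryRep.dense_garding μG π
  have hui : IsUniformInducing (π.garding μG).subtypeL :=
    (π.garding μG).subtypeₗᵢ.isometry.isUniformInducing
  let T : V →L[ℂ] Lp K 2 (weightMeasure μG θ) :=
    T₀.toContinuousLinearMap.extend (π.garding μG).subtypeL
  have hT : ∀ v : π.garding μG, T v = T₀ v := fun v =>
    ContinuousLinearMap.extend_eq _ hd hui v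
  refine ⟨⟨T.toLinearMap, fun v => ?_⟩, fun v => ?_⟩
  · refine congrFun (DenseRange.equalizer hd (T.continuous.norm) continuous_norm ?_) v
    ext v
    change ‖T v‖ = ‖(v : V)‖
    rw [hT, T₀.norm_map]; rfl
  · change T v =ᵐ[_] _
    rw [hT]
    exact (hmem v).coeFn_toLp

end Tight

/-! ### The observable of a tight admissible map -/

section Borel

variable {G : Type u} [Group G] [TopologicalSpace G] [IsTopologicalGroup G] {H : Subgroup G}

theorem mem_cosetPreimage_smul_image {Y : Set (G ⧸ H)} (g x : G) :
    x ∈ cosetPreimage ((fun y => g • y) '' Y) ↔ g⁻¹ * x ∈ cosetPreimage Y := by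
  unfold cosetPreimage
  rw [Set.image_smul, Set.mem_preimage, Set.mem_smul_set_iff_inv_smul_mem]
  rfl

theorem IsBorel.smul_image {Y : Set (G ⧸ H)} (hY : IsBorel Y) (g : G) :
    IsBorel ((fun y => g • y) '' Y) := by
  borelize (G ⧸ H)
  have h1 : MeasurableSet Y := by
    unfold IsBorel at hY; exact hY
  have h2 : (fun y => g • y) '' Y = (fun y => g⁻¹ • y) ⁻¹' Y := by
    ext y; rw [Set.image_smul, Set.mem_smul_set_iff_inv_smul_mem]; rfl
  have h3 : MeasurableSet ((fun y : G ⧸ H => g⁻¹ • y) ⁻¹' Y) :=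
    (continuous_const_smul g⁻¹).measurable h1
  rw [h2]
  exact h3

theorem IsBorel.univ : IsBorel (Set.univ : Set (G ⧸ H)) := by
  unfold IsBorel; exact @MeasurableSet.univ _ (borel _)

theorem IsBorel.empty : IsBorel (∅ : Set (G ⧸ H)) := by
  unfold IsBorel; exact @MeasurableSet.empty _ (borel _)

theorem IsBorel.iUnion {Y : ℕ → Set (G ⧸ H)} (hY : ∀ n, IsBorel (Y n)) : IsBorel (⋃ n, Y n) := by
  unfold IsBorel at hY ⊢; exact @MeasurableSet.iUnion _ _ (borel _) _ _ hY

theorem cosetPreimage_univ : cosetPreimage (Set.univ : Set (G ⧸ H)) = Set.univ := rfl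

end Borel

section Tight

variable {G : Type u} [Group G] [TopologicalSpace G] [IsTopologicalGroup G] [T2Space G]
  [LocallyCompactSpace G] [SecondCountableTopology G] [MeasurableSpace G] [BorelSpace G]
  {H : Subgroup G} [IsClosed (H : Set G)]
  {μH : Measure H} [μH.IsHaarMeasure] {θ : C(G, ℝ)} {μG : Measure G} [μG.IsHaarMeasure]
  {V : Type v} [NormedAddCommGroup V] [InnerProductSpace ℂ V] [CompleteSpace V]
  {K : Type w} [NormedAddCommGroup K] [InnerProductSpace ℂ K] [CompleteSpace K]
  {π : UnitaryRep G V} {σ : UnitaryRep H K} {A : π.garding μG →ₗ[ℂ] K}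

/-- Bounded operators are determined by their quadratic form on the Gårding domain. -/
theorem ext_inner_garding {S T : V →L[ℂ] V}
    (h : ∀ v ∈ π.garding μG, inner ℂ v (S v) = inner ℂ v (T v)) : S = T := by
  have h1 : ∀ v, inner ℂ v (S v) = inner ℂ v (T v) := fun v =>
    congrFun (Continuous.ext_on (UnitaryRep.dense_garding μG π)
      (continuous_id.inner S.continuous) (continuous_id.inner T.continuous) h) v
  have h2 : (S : V →ₗ[ℂ] V) = T := (ext_inner_map _ _).1 fun v => by
    rw [← inner_conj_symm, ← inner_conj_symm ((T : V →ₗ[ℂ] V) v)]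
    exact congrArg _ (h1 v)
  exact ContinuousLinearMap.coe_injective h2

/-- The integral by which `A` gives an observable converges and equals `⟨χ_Y T u, T v⟩`. -/
theorem inner_waveletFun_eq (T : V →ₗᵢ[ℂ] Lp K 2 (weightMeasure μG θ)) (hθ : IsWeight μH θ)
    (hT : ∀ v : π.garding μG, T v =ᵐ[weightMeasure μG θ] waveletFun μG A v)
    {Y : Set (G ⧸ H)} (hY : IsBorel Y) (u v : π.garding μG) :
    IntegrableOn (fun g => inner ℂ (waveletFun μG A v g) (waveletFun μG A u g) * (θ g : ℂ))
      (cosetPreimage Y) μG ∧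
    inner ℂ (T v) (Lp.indicatorMap hY.measurableSet_cosetPreimage (T u)) =
      ∫ g in cosetPreimage Y,
        inner ℂ (waveletFun μG A v g) (waveletFun μG A u g) * (θ g : ℂ) ∂μG := by
  have he : (fun g => inner ℂ (T v g) (T u g)) =ᵐ[weightMeasure μG θ]
      fun g => inner ℂ (waveletFun μG A v g) (waveletFun μG A u g) := by
    filter_upwards [hT u, hT v] with g a b
    rw [a, b]
  refine ⟨(hθ.integrable_weightMeasure_iff.1
    ((L2.integrable_inner (𝕜 := ℂ) (T v) (T u)).congr he)).integrableOn, ?_⟩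
  rw [Lp.inner_indicatorMap, integral_congr_ae (ae_restrict_of_ae he)]
  exact hθ.setIntegral_weightMeasure _ hY.measurableSet_cosetPreimage

/-- Covariance of the quadratic form of `T* χ_Y T`: translating both the vector and the set
translates the weight, which does not change the integral. -/
theorem enorm_indicatorMap_smul_image (hθ : IsWeight μH θ)
    (hA : IsAdmissible μG θ σ A)
    (T : V →ₗᵢ[ℂ] Lp K 2 (weightMeasure μG θ))
    (hT : ∀ v : π.garding μG, T v =ᵐ[weightMeasure μG θ] waveletFun μG A v)
    {Y : Set (G ⧸ H)} (hY : IsBorel Y) (g : G) (v : π.garding μG) :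
    ‖Lp.indicatorMap hY.measurableSet_cosetPreimage (T (π.gardingAct μG g⁻¹ v))‖ₑ ^ 2 =
      ‖Lp.indicatorMap (hY.smul_image g).measurableSet_cosetPreimage (T v)‖ₑ ^ 2 := by
  have key : ∀ {Z : Set (G ⧸ H)} (hZ : IsBorel Z) (w : π.garding μG),
      ‖Lp.indicatorMap hZ.measurableSet_cosetPreimage (T w)‖ₑ ^ 2 =
      ∫⁻ x, (cosetPreimage Z).indicator (fun x => ‖waveletFun μG A w x‖ₑ ^ 2) x *
        ENNReal.ofReal (θ x) ∂μG := by
    intro Z hZ w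
    rw [Lp.enorm_sq, ← lintegral_weightMeasure]
    refine lintegral_congr_ae ?_
    filter_upwards [Lp.coeFn_indicatorMap hZ.measurableSet_cosetPreimage (T w), hT w] with x a b
    rw [a]
    by_cases hx : x ∈ cosetPreimage Z <;> simp [hx, b]
  rw [key hY, key (hY.smul_image g)]
  set φ : G → ℝ≥0∞ := (cosetPreimage ((fun y => g • y) '' Y)).indicator
    (fun x => ‖waveletFun μG A v x‖ₑ ^ 2)
  have h1 : ∀ x, (cosetPreimage Y).indicator
      (fun x => ‖waveletFun μG A (π.gardingAct μG g⁻¹ v) x‖ₑ ^ 2) x = φ (g * x) := by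
    intro x
    simp only [φ, waveletFun_gardingAct, inv_inv]
    have : g * x ∈ cosetPreimage ((fun y => g • y) '' Y) ↔ x ∈ cosetPreimage Y := by
      rw [mem_cosetPreimage_smul_image, inv_mul_cancel_left]
    by_cases hx : x ∈ cosetPreimage Y
    · rw [Set.indicator_of_mem hx, Set.indicator_of_mem (this.2 hx)]
    · rw [Set.indicator_of_notMem hx, Set.indicator_of_notMem (mt this.1 hx)]
  simp only [h1]
  have h2 := lintegral_mul_left_eq_self (μ := μG)
    (fun x => φ x * ENNReal.ofReal (θ (g⁻¹ * x))) g
  simp only [inv_mul_cancel_left] at h2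
  rw [h2]
  refine hθ.lintegral_translate μG ?_ (fun h => ?_) g⁻¹
  · exact ((hA.measurable v).enorm.pow_const 2).indicator
      (hY.smul_image g).measurableSet_cosetPreimage
  · filter_upwards [norm_sq_covariant (σ := σ) (F := waveletFun μG A v)
      (fun h => Filter.Eventually.of_forall fun x => hA.waveletFun_mul v x h) h] with x hx
    simp only [φ]
    by_cases hxY : x ∈ cosetPreimage ((fun y => g • y) '' Y)
    · rw [Set.indicator_of_mem hxY, Set.indicator_of_mem ((cosetPreimage_mul_mem x h).2 hxY), hx]
    · rw [Set.indicator_of_notMem hxY,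
        Set.indicator_of_notMem (mt (cosetPreimage_mul_mem x h).1 hxY), mul_zero]

theorem Lp.inner_indicatorMap_self (T : V →ₗᵢ[ℂ] Lp K 2 (weightMeasure μG θ)) {s : Set G}
    (hs : MeasurableSet s) (v : V) :
    inner ℂ (T v) (Lp.indicatorMap hs (T v)) = ((‖Lp.indicatorMap hs (T v)‖ₑ ^ 2).toReal : ℂ) := by
  have h1 : inner ℂ (T v) (Lp.indicatorMap hs (T v)) =
      inner ℂ (Lp.indicatorMap hs (T v)) (Lp.indicatorMap hs (T v)) := by
    rw [L2.inner_def, L2.inner_def]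
    refine integral_congr_ae ?_
    filter_upwards [Lp.coeFn_indicatorMap hs (T v)] with x hx
    rw [hx]
    by_cases h : x ∈ s <;> simp [h]
  rw [h1, inner_self_eq_norm_sq_to_K, ENNReal.toReal_pow, toReal_enorm]
  push_cast
  rfl

open Classical in
/-- The localisation observable `E(Y) = T* χ_Y T` obtained by compressing the multiplication
operators with indicator functions along an isometry `T`. Only its values on Borel sets matter; on
other sets it is set to zero. -/
def compressedObservable (T : V →ₗᵢ[ℂ] Lp K 2 (weightMeasure μG θ)) (Y : Set (G ⧸ H)) : V →L[ℂ] V :=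
  if hY : IsBorel Y then
    (ContinuousLinearMap.adjoint T.toContinuousLinearMap).comp
      ((Lp.indicatorMap hY.measurableSet_cosetPreimage).comp T.toContinuousLinearMap)
  else 0

theorem inner_compressedObservable (T : V →ₗᵢ[ℂ] Lp K 2 (weightMeasure μG θ)) {Y : Set (G ⧸ H)}
    (hY : IsBorel Y) (u v : V) : inner ℂ v (compressedObservable T Y u) =
      inner ℂ (T v) (Lp.indicatorMap hY.measurableSet_cosetPreimage (T u)) := by
  rw [compressedObservable, dif_pos hY]
  simp [ContinuousLinearMap.adjoint_inner_right]

/-- Covariance only has to be verified for the quadratic form on the Gårding domain; all other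
properties hold for the compression of the multiplication operators along any isometry. -/
theorem compressedObservable_isNormalised (hθ : IsWeight μH θ) (hA : IsAdmissible μG θ σ A)
    (T : V →ₗᵢ[ℂ] Lp K 2 (weightMeasure μG θ))
    (hT : ∀ v : π.garding μG, T v =ᵐ[weightMeasure μG θ] waveletFun μG A v) :
    IsNormalisedLocalisationObservable π (compressedObservable (H := H) T) := by
  have huniv : compressedObservable (H := H) T Set.univ = 1 := by
    refine ext_inner_garding (μG := μG) (π := π) fun v _ => ?_
    rw [inner_compressedObservable T IsBorel.univ, Lp.inner_indicatorMap, cosetPreimage_univ,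
      Measure.restrict_univ, ← L2.inner_def, T.inner_map_map]
    rfl
  refine ⟨⟨fun Y hY => ?_, ?_, ?_, fun Y hY hd v => ?_, fun g Y hY v => ?_⟩, huniv⟩
  · refine (ContinuousLinearMap.isPositive_iff_complex _).2 fun v => ?_
    have h1 : inner ℂ (compressedObservable T Y v) v =
        ((‖Lp.indicatorMap hY.measurableSet_cosetPreimage (T v)‖ₑ ^ 2).toReal : ℂ) := by
      rw [← inner_conj_symm, inner_compressedObservable T hY, Lp.inner_indicatorMap_self,
        Complex.conj_ofReal]
    rw [h1]
    refine ⟨congrArg _ (Complex.ofReal_re _), ?_⟩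
    exact ENNReal.toReal_nonneg.trans_eq (Complex.ofReal_re _).symm
  · refine ext_inner_garding (μG := μG) (π := π) fun v _ => ?_
    rw [inner_compressedObservable T IsBorel.empty, Lp.inner_indicatorMap]
    simp [cosetPreimage]
  · rw [huniv]; exact Function.injective_id
  · have hU := IsBorel.iUnion hY
    have hd' : Pairwise (Function.onFun Disjoint fun n => cosetPreimage (Y n)) := fun m n hmn =>
      (hd hmn).preimage _
    have h1 := (Lp.hasSum_indicatorMap
      (fun n => (hY n).measurableSet_cosetPreimage) hd' (T v)).mapL
      (ContinuousLinearMap.adjoint T.toContinuousLinearMap)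
    have h2 : cosetPreimage (⋃ n, Y n) = ⋃ n, cosetPreimage (Y n) := Set.preimage_iUnion
    convert h1 using 1
    · ext n; rw [compressedObservable, dif_pos (hY n)]; rfl
    · rw [compressedObservable, dif_pos hU]
      simp only [h2]; rfl
  · have h1 : (((π g).toContinuousLinearEquiv : V →L[ℂ] V).comp
        ((compressedObservable T Y).comp ((π g⁻¹).toContinuousLinearEquiv : V →L[ℂ] V))) =
        compressedObservable T ((fun x => g • x) '' Y) := by
      refine ext_inner_garding (μG := μG) (π := π) fun v hv => ?_
      rw [inner_compressedObservable T (hY.smul_image g), Lp.inner_indicatorMap_self,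
        ← enorm_indicatorMap_smul_image hθ hA T hT hY g ⟨v, hv⟩]
      rw [← Lp.inner_indicatorMap_self, ← inner_compressedObservable T hY]
      change inner ℂ v (π g (compressedObservable T Y (π g⁻¹ v))) =
        inner ℂ (π g⁻¹ v) (compressedObservable T Y (π g⁻¹ v))
      rw [UnitaryRep.inner_apply_left, inv_inv]
    exact congrArg (fun S : V →L[ℂ] V => S v) h1

theorem IsTightAdmissible.exists_observable (hθ : IsWeight μH θ)
    (hA : IsTightAdmissible μG θ σ A) : ∃ E : Set (G ⧸ H) → V →L[ℂ] V,
      IsNormalisedLocalisationObservable π E ∧ IsGivenBy μG θ E A ∧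
        ∀ E' : Set (G ⧸ H) → V →L[ℂ] V, IsGivenBy μG θ E' A → ∀ Y, IsBorel Y → E' Y = E Y := by
  obtain ⟨T, hT⟩ := hA.exists_linearIsometry
  have hgiven : IsGivenBy μG θ (compressedObservable (H := H) T) A := by
    intro Y hY u v
    rw [inner_compressedObservable T hY]
    exact inner_waveletFun_eq T hθ hT hY u v
  refine ⟨compressedObservable T, compressedObservable_isNormalised hθ hA.toIsAdmissible T hT,
    hgiven, fun E' hE' Y hY => ?_⟩
  refine ext_inner_garding (μG := μG) (π := π) fun v hv => ?_
  exact (hE' Y hY ⟨v, hv⟩ ⟨v, hv⟩).2.trans (hgiven Y hY ⟨v, hv⟩ ⟨v, hv⟩).2.symm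

theorem coeFn_inducedAct (g : G) (F : G →ₘ[μG] K) :
    inducedAct μG g F =ᵐ[μG] fun x => F (g⁻¹ * x) :=
  AEEqFun.coeFn_compMeasurePreserving F (measurePreserving_mul_left μG g⁻¹)

/-- The action `L^σ_g` of the induced representation as a linear map. -/
def inducedActMap (hθ : IsWeight μH θ) (g : G) :
    inducedSpace μG θ σ →ₗ[ℂ] inducedSpace μG θ σ where
  toFun F := ⟨inducedAct μG g F, (inducedAct_mem hθ g F.2).1⟩
  map_add' F₁ F₂ := by
    apply Subtype.ext
    apply AEEqFun.ext
    have hq := (measurePreserving_mul_left μG g⁻¹).quasiMeasurePreserving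
    change inducedAct μG g (F₁.1 + F₂.1) =ᵐ[μG]
      ((inducedAct μG g F₁.1 + inducedAct μG g F₂.1 : G →ₘ[μG] K) : G → K)
    filter_upwards [coeFn_inducedAct g (F₁.1 + F₂.1), coeFn_inducedAct g F₁.1,
      coeFn_inducedAct g F₂.1, AEEqFun.coeFn_add (inducedAct μG g F₁.1) (inducedAct μG g F₂.1),
      hq.ae (AEEqFun.coeFn_add F₁.1 F₂.1)] with x a b c d e
    rw [a, d, e, Pi.add_apply, Pi.add_apply, b, c]
  map_smul' c F := by
    apply Subtype.ext
    apply AEEqFun.ext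
    have hq := (measurePreserving_mul_left μG g⁻¹).quasiMeasurePreserving
    change inducedAct μG g (c • F.1) =ᵐ[μG] ((c • inducedAct μG g F.1 : G →ₘ[μG] K) : G → K)
    filter_upwards [coeFn_inducedAct g (c • F.1), coeFn_inducedAct g F.1,
      AEEqFun.coeFn_smul c (inducedAct μG g F.1),
      hq.ae (AEEqFun.coeFn_smul c F.1)] with x a b d e
    rw [a, d, e, Pi.smul_apply, Pi.smul_apply, b]

/-- A tight admissible map gives an isometric intertwiner, which on the Gårding domain is the
wavelet transform `v ↦ A π(g⁻¹) v`. -/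
theorem IsTightAdmissible.exists_intertwiner (hθ : IsWeight μH θ)
    (hA : IsTightAdmissible μG θ σ A) : ∃ W : V →ₗ[ℂ] inducedSpace μG θ σ,
      IsIsometricIntertwiner μG θ π σ W ∧
        ∀ v : π.garding μG, (W v : G →ₘ[μG] K) =ᵐ[μG] waveletFun μG A v := by
  obtain ⟨T, hT⟩ := hA.exists_linearIsometry
  have hmk : ∀ v : π.garding μG, AEEqFun.mk _ (hA.measurable v) =ᵐ[μG] waveletFun μG A v :=
    fun v => AEEqFun.coeFn_mk _ _
  have hmem : ∀ v : π.garding μG, AEEqFun.mk _ (hA.measurable v) ∈ inducedSpace μG θ σ := by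
    intro v
    refine ⟨fun h => ?_, ?_⟩
    · filter_upwards [hmk v, (quasiMeasurePreserving_mul_right μG (h : G)).ae (hmk v)] with g a b
      rw [a, b, hA.waveletFun_mul]
    · rw [inducedNormSq_congr (hmk v), hA.tight]
      exact ENNReal.ofReal_lt_top
  have hTJ : ∀ v : π.garding μG, inducedToLp μG θ σ ⟨_, hmem v⟩ = T v := fun v =>
    Lp.ext ((coeFn_inducedToLp _).trans
      ((weightMeasure_absolutelyContinuous.ae_eq (hmk v)).trans (hT v).symm))
  have hrange : ∀ v, T v ∈ LinearMap.range (inducedToLp μG θ σ) := by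
    intro v
    have : v ∈ closure (π.garding μG : Set V) := UnitaryRep.dense_garding μG π v
    refine closure_minimal (t := T ⁻¹' (LinearMap.range (inducedToLp μG θ σ))) ?_
      (hθ.isClosed_range_inducedToLp.preimage T.continuous) this
    exact fun v hv => ⟨_, hTJ ⟨v, hv⟩⟩
  let J := LinearEquiv.ofInjective _ (hθ.inducedToLp_injective (σ := σ) (μG := μG))
  let W : V →ₗ[ℂ] inducedSpace μG θ σ :=
    J.symm.toLinearMap.comp (T.toLinearMap.codRestrict _ hrange)
  have hW : ∀ v, inducedToLp μG θ σ (W v) = T v := fun v =>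
    congrArg Subtype.val (J.apply_symm_apply ⟨T v, hrange v⟩)
  have hWv : ∀ v : π.garding μG, (W v : G →ₘ[μG] K) =ᵐ[μG] waveletFun μG A v := by
    intro v
    have : W v = ⟨_, hmem v⟩ := hθ.inducedToLp_injective (by rw [hW, hTJ])
    rw [this]
    exact hmk v
  refine ⟨W, ⟨fun v => ?_, fun g v => ?_⟩, hWv⟩
  · rw [← enorm_inducedToLp_sq, hW, ← ofReal_norm, T.norm_map, ofReal_norm]
  · let S : V →ₗᵢ[ℂ] Lp K 2 (weightMeasure μG θ) :=
      ⟨(inducedToLp μG θ σ).comp ((inducedActMap hθ g).comp W), fun v => by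
        have : ‖inducedToLp μG θ σ (inducedActMap hθ g (W v))‖ₑ ^ 2 = ‖v‖ₑ ^ 2 := by
          rw [enorm_inducedToLp_sq]
          refine ((inducedAct_mem hθ g (W v).2).2).trans ?_
          rw [← enorm_inducedToLp_sq, hW, ← ofReal_norm, T.norm_map, ofReal_norm]
        have h2 := (ENNReal.pow_right_strictMono two_ne_zero).injective this
        rw [← ofReal_norm, ← ofReal_norm v] at h2
        exact (ENNReal.ofReal_eq_ofReal_iff (norm_nonneg _) (norm_nonneg _)).1 h2⟩
    have hS : ∀ v, T (π g v) = S v := by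
      refine fun v => congrFun (Continuous.ext_on (UnitaryRep.dense_garding μG π)
        (T.continuous.comp (π g).continuous) S.continuous fun v hv => ?_) v
      change T (π g v) = inducedToLp μG θ σ (inducedActMap hθ g (W v))
      rw [← hW]
      congr 1
      apply Subtype.ext
      apply AEEqFun.ext
      have hq := (measurePreserving_mul_left μG g⁻¹).quasiMeasurePreserving
      filter_upwards [hWv (π.gardingAct μG g ⟨v, hv⟩), hq.ae (hWv ⟨v, hv⟩),
        coeFn_inducedAct g (W v : G →ₘ[μG] K)] with x a b c
      refine a.trans ((waveletFun_gardingAct g ⟨v, hv⟩ x).trans ?_)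
      exact b.symm.trans c.symm
    have h1 : W (π g v) = inducedActMap hθ g (W v) := hθ.inducedToLp_injective (by
      rw [hW, hS]; rfl)
    exact congrArg Subtype.val h1

end Tight

/-! ### Convolutions -/

section Convolution

variable {G : Type u} [Group G] [TopologicalSpace G] [IsTopologicalGroup G] [T2Space G]
  [LocallyCompactSpace G] [SecondCountableTopology G] [MeasurableSpace G] [BorelSpace G]
  {μG : Measure G} [μG.IsHaarMeasure]
  {K : Type w} [NormedAddCommGroup K] [InnerProductSpace ℂ K] [CompleteSpace K]

/-- The convolution `(f ⋆ F)(x) = ∫ f(g) F(g⁻¹ x) dg`. -/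
def leftConv (μG : Measure G) (f : G → ℂ) (F : G → K) (x : G) : K :=
  ∫ g, f g • F (g⁻¹ * x) ∂μG

theorem leftConv_eq (f : G → ℂ) (F : G → K) (x : G) :
    leftConv μG f F x = ∫ y, f (x * y) • F y⁻¹ ∂μG := by
  rw [leftConv, ← integral_mul_left_eq_self _ x]
  simp

theorem lintegral_comp_inv {k : G → ℝ≥0∞} (hk : Measurable k) :
    ∫⁻ y, k y⁻¹ ∂μG = ∫⁻ y, k y * Measure.modularCharacter y ∂μG := by
  have := Measure.lintegral_inv_mul_modularCharacter μG (f := fun y => k y⁻¹) (by fun_prop)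
  simp only [inv_inv] at this
  exact this.symm

theorem integrableOn_comp_inv {F : G → K} (hF : StronglyMeasurable F)
    (hi : ∀ C, IsCompact C → IntegrableOn F C μG) {C : Set G} (hC : IsCompact C) :
    IntegrableOn (fun y => F y⁻¹) C μG := by
  have hCm := hC.inv.isClosed.measurableSet
  refine ⟨(hF.comp_measurable measurable_inv).aestronglyMeasurable, ?_⟩
  obtain ⟨c, hc⟩ := hC.inv.bddAbove_image
    (Measure.continuous_modularCharacter (G := G)).continuousOn
  have h1 : ∫⁻ y in C, ‖F y⁻¹‖ₑ ∂μG = ∫⁻ y, C⁻¹.indicator (fun y => ‖F y‖ₑ) y⁻¹ ∂μG := by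
    rw [← lintegral_indicator hC.isClosed.measurableSet]
    refine lintegral_congr fun y => ?_
    by_cases hy : y ∈ C <;> simp [hy]
  unfold HasFiniteIntegral
  rw [h1, lintegral_comp_inv (hF.enorm.indicator hCm)]
  calc ∫⁻ y, C⁻¹.indicator (fun y => ‖F y‖ₑ) y * Measure.modularCharacter y ∂μG
      ≤ ∫⁻ y, c * C⁻¹.indicator (fun y => ‖F y‖ₑ) y ∂μG := by
        refine lintegral_mono fun y => ?_
        by_cases hy : y ∈ C⁻¹
        · rw [mul_comm]
          have := hc (Set.mem_image_of_mem _ hy)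
          gcongr
        · simp only [Set.indicator_of_notMem hy, zero_mul, mul_zero, le_refl]
    _ = c * ∫⁻ y in C⁻¹, ‖F y‖ₑ ∂μG := by
        rw [lintegral_const_mul' _ _ ENNReal.coe_ne_top, lintegral_indicator hCm]
    _ < ∞ := ENNReal.mul_lt_top ENNReal.coe_lt_top (hi _ hC.inv).2

theorem continuous_leftConv {f : G → ℂ} (hf : Continuous f) (hc : HasCompactSupport f)
    {F : G → K} (hF : StronglyMeasurable F) (hi : ∀ C, IsCompact C → IntegrableOn F C μG) :
    Continuous (leftConv μG f F) := by
  refine continuous_iff_continuousAt.2 fun x₀ => ?_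
  obtain ⟨C, hC, hCx⟩ := exists_compact_mem_nhds x₀
  refine ContinuousOn.continuousAt (s := C) ?_ hCx
  have hk : IsCompact (C⁻¹ * tsupport f) := hC.inv.mul hc.isCompact
  simp only [funext (leftConv_eq (μG := μG) f F)]
  refine continuousOn_integral_bilinear_of_locally_integrable_of_compact_support
    (ContinuousLinearMap.lsmul ℝ ℂ).flip hk (f := fun x y => f (x * y)) (g := fun y => F y⁻¹) ?_ ?_
    (integrableOn_comp_inv hF hi hk)
  · unfold Function.uncurry; fun_prop
  · intro x y hx hy
    by_contra hne
    exact hy ⟨x⁻¹, Set.inv_mem_inv.2 hx, x * y, subset_tsupport _ hne, by simp⟩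

/-- A locally integrable function is determined by its convolutions at the identity. -/
theorem ae_eq_zero_of_leftConv_eq_zero {F : G → K} (hF : StronglyMeasurable F)
    (hi : ∀ C, IsCompact C → IntegrableOn F C μG)
    (h0 : ∀ f : G → ℂ, Continuous f → HasCompactSupport f → leftConv μG f F 1 = 0) :
    F =ᵐ[μG] 0 := by
  have hloc : LocallyIntegrable (fun y => F y⁻¹) μG :=
    locallyIntegrable_iff.2 fun C hC => integrableOn_comp_inv hF hi hC
  have h1 : (fun y => F y⁻¹) =ᵐ[μG] 0 := by
    refine ae_eq_zero_of_forall_setIntegral_isCompact_eq_zero' hloc fun C hC => ?_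
    let _ : UniformSpace G := IsTopologicalGroup.rightUniformSpace G
    let _ := TopologicalSpace.metrizableSpaceMetric G
    obtain ⟨f, hf1, -, hfc, hf01⟩ := exists_continuous_one_zero_of_isCompact_of_isGδ hC
      hC.isClosed.isGδ isClosed_empty (Set.disjoint_empty _)
    -- since `C = {f = 1}` and `0 ≤ f ≤ 1`, the powers of `f` decrease to the indicator function of `C`
    have hlim : Filter.Tendsto (fun n : ℕ => ∫ y, ((f y : ℂ) ^ (n + 1)) • F y⁻¹ ∂μG) Filter.atTop
        (nhds (∫ y, C.indicator (fun y => F y⁻¹) y ∂μG)) := by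
      refine tendsto_integral_of_dominated_convergence
        ((tsupport f).indicator fun y => ‖F y⁻¹‖) (fun n => ?_) ?_ (fun n => ?_) ?_
      · exact (((Complex.continuous_ofReal.comp f.continuous).pow (n + 1)).aestronglyMeasurable).smul
          (hF.comp_measurable measurable_inv).aestronglyMeasurable
      · exact (integrable_indicator_iff (isClosed_tsupport _).measurableSet).2
          (integrableOn_comp_inv hF hi hfc.isCompact).norm
      · refine Filter.Eventually.of_forall fun y => ?_
        by_cases hy : y ∈ tsupport f
        · rw [Set.indicator_of_mem hy, norm_smul, norm_pow, Complex.norm_real,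
            Real.norm_of_nonneg (hf01 y).1]
          exact mul_le_of_le_one_left (norm_nonneg _) (pow_le_one₀ (hf01 y).1 (hf01 y).2)
        · rw [image_eq_zero_of_notMem_tsupport hy]; simp [hy]
      · refine Filter.Eventually.of_forall fun y => ?_
        by_cases hy : y ∈ C
        · have : f y = 1 := by
            have : y ∈ f ⁻¹' {1} := hf1 ▸ hy
            exact this
          simp [this, hy]
        · have hne : f y ≠ 1 := fun h => hy (by rw [hf1]; exact h)
          have hlt : f y < 1 := lt_of_le_of_ne (hf01 y).2 hne
          rw [Set.indicator_of_notMem hy]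
          have h2 : Filter.Tendsto (fun n : ℕ => (f y : ℂ) ^ (n + 1)) Filter.atTop (nhds 0) := by
            refine (Filter.tendsto_add_atTop_iff_nat 1).2 (tendsto_pow_atTop_nhds_zero_of_norm_lt_one ?_)
            rwa [Complex.norm_real, Real.norm_of_nonneg (hf01 y).1]
          simpa using h2.smul_const (F y⁻¹)
    have hz : ∀ n : ℕ, ∫ y, ((f y : ℂ) ^ (n + 1)) • F y⁻¹ ∂μG = 0 := by
      intro n
      have := h0 (fun y => (f y : ℂ) ^ (n + 1)) (by fun_prop)
        (hfc.comp_left (g := fun t : ℝ => (t : ℂ) ^ (n + 1)) (by simp))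
      rw [leftConv_eq] at this
      simpa using this
    simp only [hz] at hlim
    rw [integral_indicator hC.isClosed.measurableSet] at hlim
    exact tendsto_nhds_unique hlim tendsto_const_nhds
  have h2 := (quasiMeasurePreserving_inv μG).ae h1
  filter_upwards [h2] with x hx
  simpa using hx

end Convolution

/-! ### Smoothing elements of the induced representation -/

section Smoothing

variable {G : Type u} [Group G] [TopologicalSpace G] [IsTopologicalGroup G] [T2Space G]
  [LocallyCompactSpace G] [SecondCountableTopology G] [MeasurableSpace G] [BorelSpace G]
  {H : Subgroup G} [IsClosed (H : Set G)]
  {μH : Measure H} [μH.IsHaarMeasure] {θ : C(G, ℝ)} {μG : Measure G} [μG.IsHaarMeasure]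
  {V : Type v} [NormedAddCommGroup V] [InnerProductSpace ℂ V] [CompleteSpace V]
  {K : Type w} [NormedAddCommGroup K] [InnerProductSpace ℂ K] [CompleteSpace K]
  {π : UnitaryRep G V} {σ : UnitaryRep H K}

/-- Elements of the induced representation are locally integrable, with a bound by their norm. -/
theorem IsWeight.exists_setLIntegral_enorm_le (hθ : IsWeight μH θ) (σ : UnitaryRep H K)
    {C : Set G} (hC : IsCompact C) :
    ∃ c : ℝ≥0, ∀ F : inducedSpace μG θ σ,
      ∫⁻ x in C, ‖(F : G →ₘ[μG] K) x‖ₑ ∂μG ≤ c * ‖inducedToLp μG θ σ F‖ₑ := by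
  obtain ⟨c, hc⟩ := hθ.exists_setLIntegral_le μG hC
  have hCt : μG C ≠ ∞ := hC.measure_lt_top.ne
  have hfin : (c : ℝ≥0∞) ^ (1 / 2 : ℝ) * μG C ^ (1 / 2 : ℝ) ≠ ∞ :=
    ENNReal.mul_ne_top (ENNReal.rpow_ne_top_of_nonneg (by norm_num) ENNReal.coe_ne_top)
      (ENNReal.rpow_ne_top_of_nonneg (by norm_num) hCt)
  refine ⟨((c : ℝ≥0∞) ^ (1 / 2 : ℝ) * μG C ^ (1 / 2 : ℝ)).toNNReal, fun F => ?_⟩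
  have h1 := hc (fun x => ‖(F : G →ₘ[μG] K) x‖ₑ ^ 2)
    (F.1.aestronglyMeasurable.enorm.pow_const 2) (norm_sq_covariant F.2.1)
  have h2 : ∫⁻ g, ‖(F : G →ₘ[μG] K) g‖ₑ ^ 2 * ENNReal.ofReal (θ g) ∂μG =
      ‖inducedToLp μG θ σ F‖ₑ ^ 2 := (enorm_inducedToLp_sq F).symm
  rw [h2, ← eLpNorm_two_sq] at h1
  have h3 := eLpNorm_le_eLpNorm_mul_rpow_measure_univ (p := 1) (q := 2) (by norm_num)
    (F.1.aestronglyMeasurable.restrict (s := C))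
  rw [eLpNorm_one_eq_lintegral_enorm, Measure.restrict_apply_univ] at h3
  have h4 : eLpNorm (F : G →ₘ[μG] K) 2 (μG.restrict C) ≤
      (c : ℝ≥0∞) ^ (1 / 2 : ℝ) * ‖inducedToLp μG θ σ F‖ₑ := by
    have := ENNReal.rpow_le_rpow h1 (z := 1 / 2) (by norm_num)
    rw [ENNReal.mul_rpow_of_nonneg _ _ (by norm_num), ← ENNReal.rpow_natCast,
      ← ENNReal.rpow_natCast, ← ENNReal.rpow_mul, ← ENNReal.rpow_mul] at this
    simpa using this
  refine h3.trans ((mul_le_mul' h4 le_rfl).trans_eq ?_)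
  have e : (1 / (1 : ℝ≥0∞).toReal - 1 / (2 : ℝ≥0∞).toReal) = (1 / 2 : ℝ) := by norm_num
  rw [e, ENNReal.coe_toNNReal hfin]
  ring

theorem IsWeight.integrableOn_of_mem (hθ : IsWeight μH θ) (F : inducedSpace μG θ σ) {C : Set G}
    (hC : IsCompact C) : IntegrableOn (F : G →ₘ[μG] K) C μG := by
  obtain ⟨c, hc⟩ := hθ.exists_setLIntegral_enorm_le (μG := μG) σ hC
  exact ⟨F.1.aestronglyMeasurable.restrict,
    (hc F).trans_lt (ENNReal.mul_lt_top ENNReal.coe_lt_top enorm_lt_top)⟩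

theorem enorm_inducedActMap (hθ : IsWeight μH θ) (g : G) (F : inducedSpace μG θ σ) :
    ‖inducedToLp μG θ σ (inducedActMap hθ g F)‖ₑ = ‖inducedToLp μG θ σ F‖ₑ := by
  refine (ENNReal.pow_right_strictMono two_ne_zero).injective ?_
  simp only [enorm_inducedToLp_sq]
  exact (inducedAct_mem hθ g F.2).2

/-- Convolution from the left preserves the covariance condition, at every point rather than almost
everywhere. -/
theorem leftConv_mul (f : G → ℂ) {F : G →ₘ[μG] K} (hF : F ∈ inducedSpace μG θ σ) (x : G) (h : H) :
    leftConv μG f F (x * h) = (Real.sqrt (modularRatio h) : ℂ) • σ h⁻¹ (leftConv μG f F x) := by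
  unfold leftConv
  have h1 := (σ h⁻¹).toContinuousLinearEquiv.integral_comp_comm (μ := μG)
    (fun g => f g • F (g⁻¹ * x))
  simp only [LinearIsometryEquiv.coe_toContinuousLinearEquiv] at h1
  rw [← h1, ← integral_smul]
  refine integral_congr_ae ?_
  have hq : Measure.QuasiMeasurePreserving (fun g : G => g⁻¹ * x) μG μG :=
    (quasiMeasurePreserving_mul_right μG x).comp (quasiMeasurePreserving_inv μG)
  filter_upwards [hq.ae (hF.1 h)] with g hg
  rw [← mul_assoc, hg, map_smul, smul_comm]

/-- Integrability on `G × C`, for compact `C`, of the integrand of the convolution `f ⋆ F`, because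
the integral over `C` of a translate of `F` is bounded by the norm of `F`. -/
theorem integrable_prod_leftConv (hθ : IsWeight μH θ) {f : G → ℂ} (hf : Continuous f)
    (hc : HasCompactSupport f) (F : inducedSpace μG θ σ) {C : Set G} (hC : IsCompact C) :
    Integrable (fun p : G × G => f p.1 • (F : G →ₘ[μG] K) (p.1⁻¹ * p.2))
      (μG.prod (μG.restrict C)) := by
  obtain ⟨c, hcC⟩ := hθ.exists_setLIntegral_enorm_le (μG := μG) σ hC
  have hm : StronglyMeasurable fun p : G × G => f p.1 • (F : G →ₘ[μG] K) (p.1⁻¹ * p.2) :=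
    (hf.stronglyMeasurable.comp_measurable measurable_fst).smul
      (F.1.stronglyMeasurable.comp_measurable (measurable_fst.inv.mul measurable_snd))
  refine ⟨hm.aestronglyMeasurable, ?_⟩
  unfold HasFiniteIntegral
  rw [lintegral_prod _ hm.enorm.aemeasurable]
  have hfi : Integrable f μG := hf.integrable_of_hasCompactSupport hc
  calc ∫⁻ g, ∫⁻ x in C, ‖f g • (F : G →ₘ[μG] K) (g⁻¹ * x)‖ₑ ∂μG ∂μG
      ≤ ∫⁻ g, ‖f g‖ₑ * (c * ‖inducedToLp μG θ σ F‖ₑ) ∂μG := by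
        refine lintegral_mono fun g => ?_
        simp only [enorm_smul]
        rw [lintegral_const_mul' _ _ enorm_ne_top]
        gcongr
        rw [← enorm_inducedActMap hθ g F]
        refine le_trans (le_of_eq ?_) (hcC (inducedActMap hθ g F))
        refine lintegral_congr_ae (ae_restrict_of_ae ?_)
        filter_upwards [coeFn_inducedAct g (F : G →ₘ[μG] K)] with x hx
        exact congrArg _ hx.symm
    _ = (∫⁻ g, ‖f g‖ₑ ∂μG) * (c * ‖inducedToLp μG θ σ F‖ₑ) :=
        lintegral_mul_const' _ _ (ENNReal.mul_lt_top ENNReal.coe_lt_top enorm_lt_top).ne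
    _ < ∞ := ENNReal.mul_lt_top hfi.2 (ENNReal.mul_lt_top ENNReal.coe_lt_top enorm_lt_top)

theorem IsWeight.continuous_leftConv (hθ : IsWeight μH θ) {f : G → ℂ} (hf : Continuous f)
    (hc : HasCompactSupport f) (F : inducedSpace μG θ σ) :
    Continuous (leftConv μG f (F : G →ₘ[μG] K)) :=
  _root_.continuous_leftConv hf hc F.1.stronglyMeasurable fun _ hC => hθ.integrableOn_of_mem F hC

variable {W : V →ₗ[ℂ] inducedSpace μG θ σ}

/-- An intertwiner maps `π(f) u` to the convolution of `f` and `W u`. Both are locally integrable, so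
it suffices to compare integrals over compact sets, and these are continuous linear functionals of
the elements of the induced representation. -/
theorem IsIsometricIntertwiner.apply_smear (hθ : IsWeight μH θ)
    (hW : IsIsometricIntertwiner μG θ π σ W) {f : G → ℂ} (hf : Continuous f)
    (hc : HasCompactSupport f) (u : V) :
    (W (π.smear μG f u) : G →ₘ[μG] K) =ᵐ[μG] leftConv μG f (W u : G →ₘ[μG] K) := by
  have hn : ∀ v, ‖inducedToLp μG θ σ (W v)‖ₑ = ‖v‖ₑ := fun v => by
    refine (ENNReal.pow_right_strictMono two_ne_zero).injective ?_
    simp only [enorm_inducedToLp_sq, hW.isometry]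
  have hcont := hθ.continuous_leftConv hf hc (W u)
  have hloc : LocallyIntegrable (fun x => (W (π.smear μG f u) : G →ₘ[μG] K) x -
      leftConv μG f (W u : G →ₘ[μG] K) x) μG :=
    (locallyIntegrable_iff.2 fun C hC => hθ.integrableOn_of_mem _ hC).sub
      hcont.locallyIntegrable
  have := ae_eq_zero_of_forall_setIntegral_isCompact_eq_zero' hloc fun C hC => ?_
  · filter_upwards [this] with x hx
    exact sub_eq_zero.1 hx
  rw [integral_sub (hθ.integrableOn_of_mem _ hC) (hcont.continuousOn.integrableOn_compact hC),
    sub_eq_zero]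
  obtain ⟨c, hcC⟩ := hθ.exists_setLIntegral_enorm_le (μG := μG) σ hC
  -- integration over `C` as a bounded operator on `V`, to be interchanged with the integral
  -- defining `π(f) u`
  let S : V →L[ℂ] K := LinearMap.mkContinuous
    { toFun := fun v => ∫ x in C, (W v : G →ₘ[μG] K) x ∂μG
      map_add' := fun v w => by
        rw [← integral_add (hθ.integrableOn_of_mem _ hC) (hθ.integrableOn_of_mem _ hC)]
        refine integral_congr_ae (ae_restrict_of_ae ?_)
        rw [map_add]
        exact AEEqFun.coeFn_add _ _
      map_smul' := fun a v => by
        rw [RingHom.id_apply, ← integral_smul]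
        refine integral_congr_ae (ae_restrict_of_ae ?_)
        rw [map_smul]
        exact AEEqFun.coeFn_smul _ _ }
    c (fun v => by
      have h1 := (enorm_integral_le_lintegral_enorm (μ := μG.restrict C)
        (W v : G →ₘ[μG] K)).trans (hcC (W v))
      rw [hn] at h1
      have h2 := ENNReal.toReal_mono (ENNReal.mul_lt_top ENNReal.coe_lt_top enorm_lt_top).ne h1
      rw [ENNReal.toReal_mul, toReal_enorm, toReal_enorm] at h2
      exact h2)
  have hS : ∀ v, S v = ∫ x in C, (W v : G →ₘ[μG] K) x ∂μG := fun v => rfl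
  rw [← hS, UnitaryRep.smear, ← S.integral_comp_comm (π.integrable_smul_apply μG hf hc u)]
  have h1 : ∀ g, S (f g • π g u) = ∫ x in C, f g • (W u : G →ₘ[μG] K) (g⁻¹ * x) ∂μG := by
    intro g
    rw [map_smul, hS, ← integral_smul]
    refine integral_congr_ae (ae_restrict_of_ae ?_)
    rw [hW.intertwines]
    filter_upwards [coeFn_inducedAct g (W u : G →ₘ[μG] K)] with x hx
    rw [hx]
  simp only [h1]
  exact integral_integral_swap (integrable_prod_leftConv hθ hf hc (W u) hC)

/-- An isometric intertwiner maps the Gårding domain to continuous functions. -/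
theorem IsIsometricIntertwiner.exists_continuous (hθ : IsWeight μH θ)
    (hW : IsIsometricIntertwiner μG θ π σ W) {v : V} (hv : v ∈ π.garding μG) :
    ∃ k : G → K, Continuous k ∧ (W v : G →ₘ[μG] K) =ᵐ[μG] k := by
  induction hv using Submodule.span_induction with
  | mem v hv =>
    obtain ⟨f, u, hf, hc, rfl⟩ := hv
    exact ⟨_, hθ.continuous_leftConv hf hc (W u), hW.apply_smear hθ hf hc u⟩
  | zero =>
    refine ⟨0, continuous_const, ?_⟩
    rw [map_zero]
    exact AEEqFun.coeFn_zero
  | add u v _ _ hu hv =>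
    obtain ⟨k, hk, hku⟩ := hu
    obtain ⟨l, hl, hlv⟩ := hv
    refine ⟨k + l, hk.add hl, ?_⟩
    rw [map_add]
    exact (AEEqFun.coeFn_add _ _).trans (hku.add hlv)
  | smul c v _ hv =>
    obtain ⟨k, hk, hkv⟩ := hv
    refine ⟨c • k, hk.const_smul c, ?_⟩
    rw [map_smul]
    exact (AEEqFun.coeFn_smul _ _).trans (hkv.const_smul c)

/-- The tight admissible map of an isometric intertwiner `W`: the value at the identity of the
continuous representative of `W v`. -/
theorem IsIsometricIntertwiner.exists_tightAdmissible (hθ : IsWeight μH θ)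
    (hW : IsIsometricIntertwiner μG θ π σ W) :
    ∃ A : π.garding μG →ₗ[ℂ] K, IsTightAdmissible μG θ σ A ∧
      ∀ v : π.garding μG, (W v : G →ₘ[μG] K) =ᵐ[μG] waveletFun μG A v := by
  choose k hk hWk using fun v : π.garding μG => hW.exists_continuous hθ v.2
  have huniq : ∀ {a b : G → K}, Continuous a → Continuous b → a =ᵐ[μG] b → a = b :=
    fun ha hb h => (Continuous.ae_eq_iff_eq μG ha hb).1 h
  have hadd : ∀ u v, k (u + v) = k u + k v := fun u v =>
    huniq (hk _) ((hk u).add (hk v)) (by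
      refine (hWk (u + v)).symm.trans ?_
      rw [Submodule.coe_add, map_add]
      exact (AEEqFun.coeFn_add _ _).trans ((hWk u).add (hWk v)))
  have hsmul : ∀ (c : ℂ) v, k (c • v) = c • k v := fun c v =>
    huniq (hk _) ((hk v).const_smul c) (by
      refine (hWk (c • v)).symm.trans ?_
      rw [Submodule.coe_smul, map_smul]
      exact (AEEqFun.coeFn_smul _ _).trans ((hWk v).const_smul c))
  have hact : ∀ g v, k (π.gardingAct μG g v) = fun x => k v (g⁻¹ * x) := fun g v =>
    huniq (hk _) ((hk v).comp (continuous_const_mul g⁻¹)) (by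
      refine (hWk _).symm.trans ?_
      have h1 : (W (π.gardingAct μG g v : V) : G →ₘ[μG] K) = inducedAct μG g (W v) :=
        hW.intertwines g v
      rw [h1]
      exact (coeFn_inducedAct g _).trans
        ((measurePreserving_mul_left μG g⁻¹).quasiMeasurePreserving.ae (hWk v)))
  let A : π.garding μG →ₗ[ℂ] K :=
    { toFun := fun v => k v 1
      map_add' := fun u v => by rw [hadd]; rfl
      map_smul' := fun c v => by rw [hsmul]; rfl }
  have hA : ∀ v, waveletFun μG A v = k v := fun v => by
    funext x
    change k (π.gardingAct μG x⁻¹ v) 1 = k v x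
    rw [hact]; simp
  have htight : ∀ v : π.garding μG,
      ∫⁻ g, ‖waveletFun μG A v g‖ₑ ^ 2 * ENNReal.ofReal (θ g) ∂μG =
        ENNReal.ofReal (‖(v : V)‖ ^ 2) := by
    intro v
    rw [hA, ← inducedNormSq_congr (hWk v), hW.isometry, ENNReal.ofReal_pow (norm_nonneg _),
      ofReal_norm]
  refine ⟨A, ⟨⟨fun h v => ?_, fun v => ?_, 1, one_pos, fun v => ?_⟩, htight⟩, fun v => ?_⟩
  -- semi-invariance of `A` is the covariance of the continuous function `k v` at the identity
  · have hcov : (fun x => k v (x * (h⁻¹ : H))) =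
        fun x => (Real.sqrt (modularRatio h⁻¹) : ℂ) • σ h⁻¹⁻¹ (k v x) := by
      refine huniq ((hk v).comp (continuous_mul_const _))
        (((σ h⁻¹⁻¹).continuous.comp (hk v)).const_smul _) ?_
      filter_upwards [hWk v, (quasiMeasurePreserving_mul_right μG ((h⁻¹ : H) : G)).ae (hWk v),
        (W v).2.1 h⁻¹] with x a b c
      rw [← a, ← b, c]
    have h1 := congrFun hcov 1
    change σ h (k v 1) = (Real.sqrt (modularRatio h) : ℂ) • k (π.gardingAct μG (h : G) v) 1
    have hr : (Real.sqrt (modularRatio h) : ℂ) ≠ 0 := by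
      exact_mod_cast (Real.sqrt_pos.2 (modularRatio_pos h)).ne'
    simp only [one_mul, inv_inv, modularRatio_inv, Real.sqrt_inv, Complex.ofReal_inv,
      InvMemClass.coe_inv] at h1
    rw [hact]
    simp only [mul_one]
    rw [h1, smul_inv_smul₀ hr]
  · rw [hA]; exact (hk v).aestronglyMeasurable
  · rw [htight, one_mul]
  · rw [hA]; exact hWk v

/-- For a normalised observable, the square root of `E(G/H)` is `1`, and `E` is the compression of `E^σ` along `W`. -/
theorem IsAssociatedRep.exists_tightAdmissible (hθ : IsWeight μH θ)
    {E : Set (G ⧸ H) → V →L[ℂ] V} (hE : E Set.univ = 1) (h : IsAssociatedRep μG θ π σ E) :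
    (∃ A : π.garding μG →ₗ[ℂ] K, IsTightAdmissible μG θ σ A ∧ IsGivenBy μG θ E A) ∧
      IsSquareIntegrableModulo μG θ π σ := by
  obtain ⟨W, hW, hEW, -⟩ := h
  obtain ⟨A, hA, hWA⟩ := hW.exists_tightAdmissible hθ
  refine ⟨⟨A, hA, fun Y hY u v => ?_⟩, W, hW⟩
  obtain ⟨T, hT⟩ := hA.exists_linearIsometry
  have hTW : ∀ v : π.garding μG, inducedToLp μG θ σ (W v) = T v := fun v =>
    Lp.ext ((coeFn_inducedToLp _).trans
      ((weightMeasure_absolutelyContinuous.ae_eq (hWA v)).trans (hT v).symm))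
  have h1 := inner_waveletFun_eq T hθ hT hY u v
  refine ⟨h1.1, ?_⟩
  rw [← h1.2, hEW Y hY, hE, CFC.sqrt_one, ← hTW, ← hTW, ← inducedToLp_inducedLocalisation hY,
    hθ.inner_inducedToLp]
  rfl

end Smoothing

/-! ### Integration along the cosets -/

section Fibre

variable {G : Type u} [Group G] [TopologicalSpace G] [IsTopologicalGroup G] [T2Space G]
  [LocallyCompactSpace G] [SecondCountableTopology G] [MeasurableSpace G] [BorelSpace G]
  {H : Subgroup G} [IsClosed (H : Set G)]
  (μH : Measure H) [μH.IsHaarMeasure] {θ : C(G, ℝ)} (μG : Measure G) [μG.IsHaarMeasure]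

/-- The integral `∫_H Δ_G(g h)⁻¹ F(y (g h)⁻¹) dh`, as a function of `y` and of the representative
`g` of a coset. For a fixed coset, it is the density of the image of `F(y) dy` under the orbit map
`y ↦ y g H`. -/
def fibreIntegral (F : G → ℂ) (y g : G) : ℂ :=
  ∫ h : H, (Measure.modularCharacter (g * h) : ℝ) • F (y * (g * h)⁻¹) ∂μH

/-- The fibre integral depends on the coset only. -/
theorem fibreIntegral_mul_right (F : G → ℂ) (y g : G) (k : H) :
    fibreIntegral μH F y (g * k) = fibreIntegral μH F y g := by
  unfold fibreIntegral
  have := integral_mul_left_eq_self (μ := μH)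
    (fun h : H => (Measure.modularCharacter (g * h) : ℝ) • F (y * (g * h)⁻¹)) k
  rw [← this]
  simp only [Subgroup.coe_mul, mul_assoc]

/-- In its first argument, the fibre integral is covariant. -/
theorem fibreIntegral_mul_left (F : G → ℂ) (y g : G) (k : H) :
    fibreIntegral μH F (y * k) g = modularRatio k * fibreIntegral μH F y g := by
  unfold fibreIntegral
  have h1 := Measure.integral_comp_mul_right_eq_smul μH
    (fun h : H => (Measure.modularCharacter (g * h * k) : ℝ) • F (y * (g * h)⁻¹)) k⁻¹
  have e1 : ∀ h : H, (Measure.modularCharacter (g * ((h * k⁻¹ : H) : G) * k) : ℝ) •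
      F (y * (g * ((h * k⁻¹ : H) : G))⁻¹) =
      (Measure.modularCharacter (g * h) : ℝ) • F (y * k * (g * h)⁻¹) := by
    intro h
    congr 2
    · simp [mul_assoc]
    · simp [mul_assoc]
  simp only [e1] at h1
  rw [h1, modularRatio]
  have e2 : ∀ h : H, (Measure.modularCharacter (g * h * k) : ℝ) • F (y * (g * h)⁻¹) =
      (Measure.modularCharacter (k : G) : ℝ) • (Measure.modularCharacter (g * h) : ℝ) •
        F (y * (g * h)⁻¹) := by
    intro h
    rw [map_mul _ (g * (h : G)), NNReal.coe_mul, smul_smul, mul_comm]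
  simp only [e2]
  rw [integral_smul, map_inv, smul_smul, Complex.real_smul]
  congr 2
  push_cast
  rw [div_eq_inv_mul]

/-- The absolute integral over `G` and over the coset, against the weight, is the integral of `|F|`:
substitute `y g h` for `y` and use that the weight has integral one over cosets. -/
theorem lintegral_fibre (hθ : IsWeight μH θ) {F : G → ℂ} (hF : Continuous F) (g : G) :
    ∫⁻ y, ∫⁻ h : H, ‖(Measure.modularCharacter (g * h) : ℝ) • F (y * (g * h)⁻¹) *
      (θ y : ℂ)‖ₑ ∂μH ∂μG = ∫⁻ y, ‖F y‖ₑ ∂μG := by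
  have hmc := Measure.continuous_modularCharacter (G := G)
  have hFm : Measurable F := hF.measurable
  have hmeas : Measurable fun p : G × H =>
      ‖(Measure.modularCharacter (g * p.2) : ℝ) • F (p.1 * (g * p.2)⁻¹) * (θ p.1 : ℂ)‖ₑ := by
    refine Continuous.measurable ?_
    fun_prop
  rw [lintegral_lintegral_swap hmeas.aemeasurable]
  calc ∫⁻ h : H, ∫⁻ y, ‖(Measure.modularCharacter (g * h) : ℝ) • F (y * (g * h)⁻¹) *
        (θ y : ℂ)‖ₑ ∂μG ∂μH
      = ∫⁻ h : H, ∫⁻ y, ‖F y‖ₑ * ENNReal.ofReal (θ (y * g * h)) ∂μG ∂μH := by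
        refine lintegral_congr fun h => ?_
        have h1 := Measure.lintegral_comp_mul_right μG (fun y =>
          ‖F (y * (g * h)⁻¹)‖ₑ * ENNReal.ofReal (θ y)) (g * h)
        simp only [mul_inv_cancel_right] at h1
        simp only [← mul_assoc] at h1
        rw [h1, ← lintegral_const_mul _ (by fun_prop)]
        refine lintegral_congr fun y => ?_
        rw [enorm_mul, enorm_smul, mul_assoc]
        congr 1
        · rw [Real.enorm_of_nonneg (by positivity), ENNReal.ofReal_coe_nnreal]
        · congr 1
          rw [← ofReal_norm, Complex.norm_real, Real.norm_of_nonneg (hθ.nonneg y)]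
    _ = ∫⁻ y, ∫⁻ h : H, ‖F y‖ₑ * ENNReal.ofReal (θ (y * g * h)) ∂μH ∂μG := by
        refine lintegral_lintegral_swap (Measurable.aemeasurable ?_)
        unfold Function.uncurry
        fun_prop
    _ = ∫⁻ y, ‖F y‖ₑ ∂μG := by
        refine lintegral_congr fun y => ?_
        rw [lintegral_const_mul _ (by fun_prop), hθ.lintegral_eq_one, mul_one]

theorem lintegral_enorm_fibreIntegral_le (hθ : IsWeight μH θ) {F : G → ℂ} (hF : Continuous F)
    (g : G) : ∫⁻ y, ‖fibreIntegral μH F y g * (θ y : ℂ)‖ₑ ∂μG ≤ ∫⁻ y, ‖F y‖ₑ ∂μG := by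
  rw [← lintegral_fibre μH μG hθ hF g]
  refine lintegral_mono fun y => ?_
  rw [fibreIntegral, ← integral_mul_const]
  exact enorm_integral_le_lintegral_enorm _

/-- The fibre integral is the density of the image of `F(y) dy` under the orbit map `y ↦ y g H`. -/
theorem setIntegral_fibreIntegral (hθ : IsWeight μH θ) {F : G → ℂ} (hF : Continuous F)
    (hc : HasCompactSupport F) (g : G) {Y : Set (G ⧸ H)} (hY : IsBorel Y) :
    ∫ y in cosetPreimage Y, fibreIntegral μH F y g * (θ y : ℂ) ∂μG =
      ∫ y, (cosetPreimage Y).indicator 1 (y * g) * F y ∂μG := by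
  have hmc := Measure.continuous_modularCharacter (G := G)
  have hYm := hY.measurableSet_cosetPreimage
  have hFi : Integrable F μG := hF.integrable_of_hasCompactSupport hc
  have hcont : Continuous fun p : G × H =>
      (Measure.modularCharacter (g * p.2) : ℝ) • F (p.1 * (g * p.2)⁻¹) * (θ p.1 : ℂ) := by
    fun_prop
  have hint : Integrable (fun p : G × H =>
      (Measure.modularCharacter (g * p.2) : ℝ) • F (p.1 * (g * p.2)⁻¹) * (θ p.1 : ℂ))
      (μG.prod μH) := by
    refine ⟨hcont.aestronglyMeasurable, ?_⟩
    unfold HasFiniteIntegral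
    rw [lintegral_prod _ hcont.measurable.enorm.aemeasurable, lintegral_fibre μH μG hθ hF]
    exact hFi.2
  have hint2 : Integrable (Function.uncurry fun (y : G) (h : H) => (cosetPreimage Y).indicator
      (1 : G → ℂ) y * ((Measure.modularCharacter (g * h) : ℝ) • F (y * (g * h)⁻¹) * (θ y : ℂ)))
      (μG.prod μH) := by
    refine (hint.indicator (measurable_fst hYm)).congr (Filter.Eventually.of_forall fun p => ?_)
    by_cases hp : p.1 ∈ cosetPreimage Y
    · rw [Set.indicator_of_mem (show p ∈ Prod.fst ⁻¹' cosetPreimage Y from hp)]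
      simp [Function.uncurry, hp]
    · rw [Set.indicator_of_notMem (show p ∉ Prod.fst ⁻¹' cosetPreimage Y from hp)]
      simp [Function.uncurry, hp]
  have hint3 : Integrable (Function.uncurry fun (y : G) (h : H) =>
      (cosetPreimage Y).indicator (1 : G → ℂ) (y * g) * F y * (θ (y * g * h) : ℂ))
      (μG.prod μH) := by
    have hm : Measurable fun p : G × H => (cosetPreimage Y).indicator (1 : G → ℂ) (p.1 * g) *
        F p.1 * (θ (p.1 * g * p.2) : ℂ) := by
      have h1 : Measurable ((cosetPreimage Y).indicator (1 : G → ℂ)) :=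
        measurable_one.indicator hYm
      have h2 : Measurable F := hF.measurable
      have h3 : Measurable fun p : G × H => (θ (p.1 * g * p.2) : ℂ) :=
        Continuous.measurable (by fun_prop)
      fun_prop
    refine ⟨hm.aestronglyMeasurable, ?_⟩
    unfold HasFiniteIntegral
    change ∫⁻ p : G × H, ‖(cosetPreimage Y).indicator (1 : G → ℂ) (p.1 * g) *
        F p.1 * (θ (p.1 * g * p.2) : ℂ)‖ₑ ∂μG.prod μH < ∞
    rw [lintegral_prod _ hm.enorm.aemeasurable]
    refine lt_of_le_of_lt (lintegral_mono fun y => ?_) hFi.2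
    calc ∫⁻ h : H, ‖(cosetPreimage Y).indicator (1 : G → ℂ) (y * g) * F y *
          (θ (y * g * h) : ℂ)‖ₑ ∂μH
        ≤ ∫⁻ h : H, ‖F y‖ₑ * ENNReal.ofReal (θ (y * g * h)) ∂μH := by
          refine lintegral_mono fun h => ?_
          rw [enorm_mul]
          gcongr
          · by_cases hy : y * g ∈ cosetPreimage Y <;> simp [hy]
          · rw [← ofReal_norm, Complex.norm_real, Real.norm_of_nonneg (hθ.nonneg _)]
      _ = ‖F y‖ₑ := by
          rw [lintegral_const_mul _ (by fun_prop), hθ.lintegral_eq_one, mul_one]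
  calc ∫ y in cosetPreimage Y, fibreIntegral μH F y g * (θ y : ℂ) ∂μG
      = ∫ y, ∫ h : H, (cosetPreimage Y).indicator (1 : G → ℂ) y *
          ((Measure.modularCharacter (g * h) : ℝ) • F (y * (g * h)⁻¹) * (θ y : ℂ)) ∂μH ∂μG := by
        rw [← integral_indicator hYm]
        refine integral_congr_ae (Filter.Eventually.of_forall fun y => ?_)
        simp only [integral_const_mul, integral_mul_const]
        by_cases hy : y ∈ cosetPreimage Y <;> simp [hy, fibreIntegral]
    _ = ∫ h : H, ∫ y, (cosetPreimage Y).indicator (1 : G → ℂ) y *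
          ((Measure.modularCharacter (g * h) : ℝ) • F (y * (g * h)⁻¹) * (θ y : ℂ)) ∂μG ∂μH :=
        integral_integral_swap hint2
    _ = ∫ h : H, ∫ y, (cosetPreimage Y).indicator (1 : G → ℂ) (y * g) * F y *
          (θ (y * g * h) : ℂ) ∂μG ∂μH := by
        refine integral_congr_ae (Filter.Eventually.of_forall fun h => ?_)
        have h1 := Measure.integral_comp_mul_right_eq_smul μG (fun y =>
          (cosetPreimage Y).indicator (1 : G → ℂ) y * (F (y * (g * h)⁻¹) * (θ y : ℂ))) (g * h)
        simp only [mul_inv_cancel_right] at h1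
        -- the preimage of `Y` is saturated, so that its indicator function ignores `h`
        have e : ∀ y : G, (cosetPreimage Y).indicator (1 : G → ℂ) (y * (g * h)) =
            (cosetPreimage Y).indicator (1 : G → ℂ) (y * g) := by
          intro y
          have hiff := cosetPreimage_mul_mem (Y := Y) (y * g) h
          rw [← mul_assoc]
          by_cases hy : y * g ∈ cosetPreimage Y
          · rw [Set.indicator_of_mem hy, Set.indicator_of_mem (hiff.2 hy)]; rfl
          · rw [Set.indicator_of_notMem hy, Set.indicator_of_notMem (mt hiff.1 hy)]
        simp only [e] at h1
        simp only [← mul_assoc] at h1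
        change ∫ y, _ ∂μG = _
        simp only []
        rw [h1, ← integral_smul]
        refine integral_congr_ae (Filter.Eventually.of_forall fun y => ?_)
        simp only [Complex.real_smul]
        ring
    _ = ∫ y, ∫ h : H, (cosetPreimage Y).indicator (1 : G → ℂ) (y * g) * F y *
          (θ (y * g * h) : ℂ) ∂μH ∂μG := (integral_integral_swap hint3).symm
    _ = ∫ y, (cosetPreimage Y).indicator 1 (y * g) * F y ∂μG := by
        refine integral_congr_ae (Filter.Eventually.of_forall fun y => ?_)
        have h1 : ∫ h : H, (θ (y * g * h) : ℂ) ∂μH = 1 := by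
          have := integral_ofReal (𝕜 := ℂ) (μ := μH) (f := fun h : H => θ (y * g * h))
          rw [hθ.integral_eq_one] at this
          simpa using this
        simp only [integral_const_mul, h1, mul_one]

/-- Fibre integrals depend continuously on the base points and on parameters. -/
theorem continuous_fibreIntegral {Q : Type*} [TopologicalSpace Q] {Φ : Q → G → ℂ}
    (hΦ : Continuous fun p : Q × G => Φ p.1 p.2) {S : Set G} (hS : IsCompact S)
    (hΦS : ∀ q y, Φ q y ≠ 0 → y ∈ S) :
    Continuous fun p : (Q × G) × G => fibreIntegral μH (Φ p.1.1) p.1.2 p.2 := by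
  have hmc := Measure.continuous_modularCharacter (G := G)
  refine continuous_iff_continuousAt.2 fun ⟨⟨q₀, y₀⟩, g₀⟩ => ?_
  obtain ⟨C, hC, hCy⟩ := exists_compact_mem_nhds y₀
  obtain ⟨D, hD, hDg⟩ := exists_compact_mem_nhds g₀
  refine ContinuousOn.continuousAt (s := (Set.univ ×ˢ C) ×ˢ D) ?_
    (prod_mem_nhds (prod_mem_nhds Filter.univ_mem hCy) hDg)
  have hk : IsCompact ((Subtype.val : H → G) ⁻¹' (D⁻¹ * (S⁻¹ * C))) :=
    (inferInstance : IsClosed (H : Set G)).isClosedEmbedding_subtypeVal.isCompact_preimage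
      (hD.inv.mul (hS.inv.mul hC))
  refine continuousOn_integral_of_compact_support hk (Continuous.continuousOn ?_) ?_
  · have h1 : Continuous fun p : ((Q × G) × G) × H =>
        Φ p.1.1.1 (p.1.1.2 * (p.1.2 * p.2)⁻¹) :=
      hΦ.comp (g := fun p : Q × G => Φ p.1 p.2)
        (f := fun p : ((Q × G) × G) × H => (p.1.1.1, p.1.1.2 * (p.1.2 * p.2)⁻¹)) (by fun_prop)
    unfold Function.uncurry
    fun_prop
  · rintro ⟨⟨q, y⟩, g⟩ h ⟨⟨-, hy⟩, hg⟩ hh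
    by_contra hne
    refine hh ⟨g⁻¹, Set.inv_mem_inv.2 hg, _, ⟨(y * (g * h)⁻¹)⁻¹, Set.inv_mem_inv.2 (hΦS q _ ?_), y,
      hy, rfl⟩, ?_⟩
    · exact fun h0 => hne (by simp only [h0, smul_zero])
    · simp

/-- The fibre integral as a function of the coset. -/
def fibreIntegralMk (F : G → ℂ) (y : G) (s : G ⧸ H) : ℂ :=
  Quotient.liftOn' s (fibreIntegral μH F y) fun a b hab => by
    have h1 := QuotientGroup.leftRel_apply.1 hab
    have := fibreIntegral_mul_right μH F y a ⟨a⁻¹ * b, h1⟩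
    simpa using this.symm

theorem fibreIntegralMk_mk (F : G → ℂ) (y g : G) :
    fibreIntegralMk μH F y (g : G ⧸ H) = fibreIntegral μH F y g := rfl

theorem continuous_fibreIntegralMk {Q : Type*} [TopologicalSpace Q] {Φ : Q → G → ℂ}
    (hΦ : Continuous fun p : Q × G => Φ p.1 p.2) {S : Set G} (hS : IsCompact S)
    (hΦS : ∀ q y, Φ q y ≠ 0 → y ∈ S) :
    Continuous fun p : (Q × G) × (G ⧸ H) => fibreIntegralMk μH (Φ p.1.1) p.1.2 p.2 := by
  have hq : IsOpenQuotientMap (Prod.map (id : Q × G → Q × G) (QuotientGroup.mk : G → G ⧸ H)) :=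
    IsOpenQuotientMap.id.prodMap QuotientGroup.isOpenQuotientMap_mk
  rw [hq.isQuotientMap.continuous_iff]
  exact continuous_fibreIntegral μH hΦ hS hΦS

theorem fibreIntegralMk_eq_zero {F : G → ℂ} {S : Set G} (hFS : ∀ y, F y ≠ 0 → y ∈ S)
    {y : G} {s : G ⧸ H} (hs : s ∉ (QuotientGroup.mk : G → G ⧸ H) '' (S⁻¹ * {y})) :
    fibreIntegralMk μH F y s = 0 := by
  obtain ⟨g, rfl⟩ := QuotientGroup.mk_surjective s
  rw [fibreIntegralMk_mk, fibreIntegral]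
  refine integral_eq_zero_of_ae (Filter.Eventually.of_forall fun h => ?_)
  by_contra hne
  refine hs ⟨g * h, ⟨(y * (g * h)⁻¹)⁻¹, Set.inv_mem_inv.2 (hFS _ ?_), y, rfl, by simp⟩, ?_⟩
  · exact fun h0 => hne (by simp only [h0, smul_zero]; rfl)
  · exact QuotientGroup.mk_mul_of_mem g h.2

end Fibre

/-! ### The measures of a localisation observable -/

section ObservableMeasure

variable {G : Type u} [Group G] [TopologicalSpace G] [IsTopologicalGroup G] [T2Space G]
  [LocallyCompactSpace G] [SecondCountableTopology G] [MeasurableSpace G] [BorelSpace G]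
  {H : Subgroup G} [IsClosed (H : Set G)]
  {V : Type v} [NormedAddCommGroup V] [InnerProductSpace ℂ V] [CompleteSpace V]
  {π : UnitaryRep G V} {E : Set (G ⧸ H) → V →L[ℂ] V}

theorem isBorel_iff_measurableSet [MeasurableSpace (G ⧸ H)] [BorelSpace (G ⧸ H)]
    {Y : Set (G ⧸ H)} : IsBorel Y ↔ MeasurableSet Y := by
  unfold IsBorel
  rw [BorelSpace.measurable_eq (α := G ⧸ H)]

theorem IsLocalisationObservable.inner_nonneg (hE : IsLocalisationObservable π E)
    {Y : Set (G ⧸ H)} (hY : IsBorel Y) (v : V) :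
    inner ℂ v (E Y v) = ((inner ℂ v (E Y v)).re : ℂ) ∧ 0 ≤ (inner ℂ v (E Y v)).re := by
  obtain ⟨h1, h2⟩ := (ContinuousLinearMap.isPositive_iff_complex _).1 (hE.isPositive Y hY) v
  change (((inner ℂ (E Y v) v).re : ℝ) : ℂ) = _ at h1
  change 0 ≤ (inner ℂ (E Y v) v).re at h2
  have h3 : inner ℂ v (E Y v) = inner ℂ (E Y v) v := by
    rw [← inner_conj_symm, ← h1, Complex.conj_ofReal]
  rw [h3]
  exact ⟨h1.symm, h2⟩

variable [MeasurableSpace (G ⧸ H)] [BorelSpace (G ⧸ H)]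

/-- The finite measure `Y ↦ ⟨E(Y) v, v⟩` on `G/H`. -/
def observableMeasure (hE : IsLocalisationObservable π E) (v : V) : Measure (G ⧸ H) :=
  Measure.ofMeasurable (fun Y _ => ENNReal.ofReal (inner ℂ v (E Y v)).re) (by simp [hE.empty])
    (fun Y hY hd => by
      have hb : ∀ n, IsBorel (Y n) := fun n => isBorel_iff_measurableSet.2 (hY n)
      have h1 := ((hE.hasSum Y hb hd v).mapL (innerSL ℂ v)).mapL Complex.reCLM
      simp only [innerSL_apply_apply, Complex.reCLM_apply] at h1
      rw [← h1.tsum_eq, ENNReal.ofReal_tsum_of_nonneg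
        (fun n => (hE.inner_nonneg (hb n) v).2) h1.summable])

theorem observableMeasure_apply (hE : IsLocalisationObservable π E) (v : V) {Y : Set (G ⧸ H)}
    (hY : MeasurableSet Y) :
    observableMeasure hE v Y = ENNReal.ofReal (inner ℂ v (E Y v)).re :=
  Measure.ofMeasurable_apply _ hY

theorem observableMeasure_toReal (hE : IsLocalisationObservable π E) (v : V) {Y : Set (G ⧸ H)}
    (hY : MeasurableSet Y) :
    ((observableMeasure hE v Y).toReal : ℂ) = inner ℂ v (E Y v) := by
  have := hE.inner_nonneg (isBorel_iff_measurableSet.2 hY) v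
  rw [observableMeasure_apply hE v hY, ENNReal.toReal_ofReal this.2, ← this.1]

/-- The kernel `z ↦ ⟨E(·) w(z), w(z)⟩` of a continuous function `w` with values in the Hilbert
space of the observable. -/
def observableKernel (hE : IsLocalisationObservable π E) {w : G → V} (hw : Continuous w) :
    ProbabilityTheory.Kernel G (G ⧸ H) where
  toFun z := observableMeasure hE (w z)
  measurable' := by
    refine Measure.measurable_of_measurable_coe _ fun Y hY => ?_
    simp only [observableMeasure_apply hE _ hY]
    refine ENNReal.measurable_ofReal.comp (Continuous.measurable ?_)
    exact Complex.continuous_re.comp (hw.inner ((E Y).continuous.comp hw))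

theorem observableKernel_isFinite (hE : IsLocalisationObservable π E) {w : G → V}
    (hw : Continuous w) {M : ℝ} (hM : ∀ z, ‖w z‖ ≤ M) :
    ProbabilityTheory.IsFiniteKernel (observableKernel hE hw) := by
  refine ⟨ENNReal.ofReal (M * (‖E Set.univ‖ * M)), ENNReal.ofReal_lt_top, fun z => ?_⟩
  change observableMeasure hE (w z) Set.univ ≤ _
  rw [observableMeasure_apply hE _ MeasurableSet.univ]
  refine ENNReal.ofReal_le_ofReal ((Complex.re_le_norm _).trans ((norm_inner_le_norm _ _).trans ?_))
  have hM0 : 0 ≤ M := (norm_nonneg _).trans (hM z)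
  refine mul_le_mul (hM z) (((E Set.univ).le_opNorm _).trans ?_) (norm_nonneg _) hM0
  exact mul_le_mul_of_nonneg_left (hM z) (norm_nonneg _)

end ObservableMeasure

section Density

open ProbabilityTheory

variable {G : Type u} [Group G] [TopologicalSpace G] [IsTopologicalGroup G] [T2Space G]
  [LocallyCompactSpace G] [SecondCountableTopology G] [MeasurableSpace G] [BorelSpace G]
  {H : Subgroup G} [IsClosed (H : Set G)]
  {μH : Measure H} [μH.IsHaarMeasure] {θ : C(G, ℝ)} {μG : Measure G} [μG.IsHaarMeasure]
  {V : Type v} [NormedAddCommGroup V] [InnerProductSpace ℂ V] [CompleteSpace V]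
  {π : UnitaryRep G V} {E : Set (G ⧸ H) → V →L[ℂ] V}

/-- The family of complex measures `Y ↦ ∫∫ Φ(x, z, y) κ(z)(y⁻¹ Y) dz dy` on `G/H` has a density,
jointly continuous in `x` and the point: fibre integrals of `Φ(x, z, ·)`, averaged over `κ`. -/
theorem exists_continuous_density [MeasurableSpace (G ⧸ H)] [BorelSpace (G ⧸ H)]
    (hθ : IsWeight μH θ) (κ : Kernel G (G ⧸ H)) [IsFiniteKernel κ] {Φ : G → G → G → ℂ}
    (hΦ : Continuous fun p : (G × G) × G => Φ p.1.1 p.1.2 p.2) {S : Set G} (hS : IsCompact S)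
    (hΦS : ∀ x z y, Φ x z y ≠ 0 → y ∈ S)
    (hΦZ : ∀ C : Set G, IsCompact C → ∃ Z : Set G, IsCompact Z ∧
      ∀ x ∈ C, ∀ z y, Φ x z y ≠ 0 → z ∈ Z) :
    ∃ b : G → G → ℂ, (Continuous fun p : G × G => b p.1 p.2) ∧
      ∀ x, (∀ (y : G) (h : H), b x (y * h) = modularRatio h * b x y) ∧
        Integrable (fun y => b x y * (θ y : ℂ)) μG ∧
        ∀ Y : Set (G ⧸ H), IsBorel Y →
          Integrable (fun p : G × G => Φ x p.2 p.1 * ((κ p.2 {s | p.1 • s ∈ Y}).toReal : ℂ))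
            (μG.prod μG) ∧
          ∫ y in cosetPreimage Y, b x y * (θ y : ℂ) ∂μG =
            ∫ p : G × G, Φ x p.2 p.1 * ((κ p.2 {s | p.1 • s ∈ Y}).toReal : ℂ) ∂μG.prod μG := by
  -- the joint distribution of the parameter `z` and of the base point of the orbit map
  set P : Measure (G × (G ⧸ H)) := μG ⊗ₘ κ with hP
  have hPK : ∀ Z : Set G, IsCompact Z → P (Z ×ˢ Set.univ) < ∞ := by
    intro Z hZ
    rw [hP, Measure.compProd_apply_prod hZ.isClosed.measurableSet MeasurableSet.univ]
    calc ∫⁻ z in Z, κ z Set.univ ∂μG ≤ ∫⁻ _ in Z, κ.bound ∂μG :=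
          lintegral_mono fun z => Kernel.measure_le_bound κ z _
      _ = κ.bound * μG Z := setLIntegral_const _ _
      _ < ∞ := ENNReal.mul_lt_top (Kernel.bound_lt_top κ) hZ.measure_lt_top
  have hPc : IsFiniteMeasureOnCompacts P := by
    refine ⟨fun C hC => lt_of_le_of_lt (measure_mono ?_) (hPK _ (hC.image continuous_fst))⟩
    exact fun p hp => ⟨⟨p, hp, rfl⟩, trivial⟩
  have hfib : Continuous fun p : ((G × G) × G) × (G ⧸ H) =>
      fibreIntegralMk μH (Φ p.1.1.1 p.1.1.2) p.1.2 p.2 :=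
    continuous_fibreIntegralMk μH (Φ := fun q : G × G => Φ q.1 q.2) hΦ hS
      fun q y => hΦS q.1 q.2 y
  -- for `x` and `y` in compact sets, the integrand is supported in a fixed compact set
  refine ⟨fun x y => ∫ q, fibreIntegralMk μH (Φ x q.1) y q.2 ∂P, ?_, fun x => ?_⟩
  · refine continuous_iff_continuousAt.2 fun ⟨x₀, y₀⟩ => ?_
    obtain ⟨C, hC, hCx⟩ := exists_compact_mem_nhds x₀
    obtain ⟨D, hD, hDy⟩ := exists_compact_mem_nhds y₀
    obtain ⟨Z, hZ, hZC⟩ := hΦZ C hC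
    refine ContinuousOn.continuousAt (s := C ×ˢ D) ?_ (prod_mem_nhds hCx hDy)
    refine continuousOn_integral_of_compact_support
      (k := Z ×ˢ ((QuotientGroup.mk : G → G ⧸ H) '' (S⁻¹ * D)))
      (hZ.prod ((hS.inv.mul hD).image QuotientGroup.continuous_mk)) (Continuous.continuousOn ?_) ?_
    · exact hfib.comp (f := fun p : (G × G) × (G × (G ⧸ H)) =>
        (((p.1.1, p.2.1), p.1.2), p.2.2)) (by fun_prop)
    · rintro ⟨x, y⟩ ⟨z, s⟩ ⟨hx, hy⟩ hzs
      by_cases hz : z ∈ Z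
      · refine fibreIntegralMk_eq_zero μH (hΦS x z) fun hs => hzs ⟨hz, ?_⟩
        exact Set.image_mono (Set.mul_subset_mul_left (Set.singleton_subset_iff.2 hy)) hs
      · have h0 : Φ x z = fun _ => 0 := by
          funext t
          by_contra hne
          exact hz (hZC x hx z t hne)
        obtain ⟨g, rfl⟩ := QuotientGroup.mk_surjective s
        change fibreIntegralMk μH (Φ x z) y g = 0
        rw [fibreIntegralMk_mk, h0]
        simp [fibreIntegral]
  obtain ⟨Z, hZ, hZx⟩ := hΦZ {x} isCompact_singleton
  have hΨ : Continuous fun p : G × G => Φ x p.1 p.2 :=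
    hΦ.comp (f := fun p : G × G => ((x, p.1), p.2)) (by fun_prop)
  have hΨc : HasCompactSupport fun p : G × G => Φ x p.1 p.2 :=
    HasCompactSupport.intro (hZ.prod hS) fun p hp => by
      by_contra hne
      exact hp ⟨hZx x rfl _ _ hne, hΦS _ _ _ hne⟩
  have hΨi : Integrable (fun p : G × G => Φ x p.1 p.2) (μG.prod μG) :=
    hΨ.integrable_of_hasCompactSupport hΨc
  have hΨz : ∀ z, Continuous (Φ x z) := fun z =>
    hΨ.comp (f := fun y : G => (z, y)) (by fun_prop)
  have hΨzc : ∀ z, HasCompactSupport (Φ x z) := fun z =>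
    HasCompactSupport.intro hS fun y hy => by
      by_contra hne
      exact hy (hΦS _ _ _ hne)
  have hcontx : Continuous fun p : G × (G × (G ⧸ H)) =>
      fibreIntegralMk μH (Φ x p.2.1) p.1 p.2.2 * (θ p.1 : ℂ) := by
    refine Continuous.mul (hfib.comp (f := fun p : G × (G × (G ⧸ H)) =>
        (((x, p.2.1), p.1), p.2.2)) (by fun_prop)) (by fun_prop)
  have hint : Integrable (fun p : G × (G × (G ⧸ H)) =>
      fibreIntegralMk μH (Φ x p.2.1) p.1 p.2.2 * (θ p.1 : ℂ)) (μG.prod P) := by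
    refine ⟨hcontx.aestronglyMeasurable, ?_⟩
    unfold HasFiniteIntegral
    rw [lintegral_prod_symm _ hcontx.measurable.enorm.aemeasurable]
    have hm : Measurable fun p : G × G => ‖Φ x p.1 p.2‖ₑ := hΨ.measurable.enorm
    calc ∫⁻ q, ∫⁻ y, ‖fibreIntegralMk μH (Φ x q.1) y q.2 * (θ y : ℂ)‖ₑ ∂μG ∂P
        ≤ ∫⁻ q, ∫⁻ y, ‖Φ x q.1 y‖ₑ ∂μG ∂P := by
          refine lintegral_mono fun q => ?_
          obtain ⟨z, s⟩ := q
          obtain ⟨g, rfl⟩ := QuotientGroup.mk_surjective s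
          exact lintegral_enorm_fibreIntegral_le μH μG hθ (hΨz z) g
      _ = ∫⁻ z, ∫⁻ _, ∫⁻ y, ‖Φ x z y‖ₑ ∂μG ∂κ z ∂μG :=
          Measure.lintegral_compProd (hm.lintegral_prod_right'.comp measurable_fst)
      _ ≤ ∫⁻ z, (∫⁻ y, ‖Φ x z y‖ₑ ∂μG) * κ.bound ∂μG := by
          refine lintegral_mono fun z => ?_
          rw [lintegral_const]
          gcongr
          exact Kernel.measure_le_bound κ z _
      _ = (∫⁻ z, ∫⁻ y, ‖Φ x z y‖ₑ ∂μG ∂μG) * κ.bound :=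
          lintegral_mul_const' _ _ (Kernel.bound_lt_top κ).ne
      _ < ∞ := by
          refine ENNReal.mul_lt_top ?_ (Kernel.bound_lt_top κ)
          rw [← lintegral_prod _ hm.aemeasurable]
          exact hΨi.2
  refine ⟨fun y h => ?_, ?_, fun Y hY => ?_⟩
  · rw [← integral_const_mul]
    refine integral_congr_ae (Filter.Eventually.of_forall fun q => ?_)
    obtain ⟨z, s⟩ := q
    obtain ⟨g, rfl⟩ := QuotientGroup.mk_surjective s
    exact fibreIntegral_mul_left μH (Φ x z) y g h
  · have := hint.integral_prod_left
    simpa only [integral_mul_const] using this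
  have hYm : MeasurableSet Y := isBorel_iff_measurableSet.1 hY
  have hsm : Measurable fun p : G × (G ⧸ H) => p.1 • p.2 := continuous_smul.measurable
  have hκm : Measurable fun p : G × G => κ p.2 {s | p.1 • s ∈ Y} := by
    have ht : MeasurableSet {t : (G × G) × (G ⧸ H) | t.1.1 • t.2 ∈ Y} :=
      hsm.comp (measurable_fst.fst.prodMk measurable_snd) hYm
    exact Kernel.measurable_kernel_prodMk_left (κ := κ.comap Prod.snd measurable_snd) ht
  have hprod : Integrable (fun p : G × G => Φ x p.2 p.1 *
      ((κ p.2 {s | p.1 • s ∈ Y}).toReal : ℂ)) (μG.prod μG) := by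
    refine hΨi.swap.mul_bdd (c := κ.bound.toReal) ?_ (Filter.Eventually.of_forall fun p => ?_)
    · exact (Complex.measurable_ofReal.comp hκm.ennreal_toReal).aestronglyMeasurable
    · rw [Complex.norm_real, Real.norm_of_nonneg ENNReal.toReal_nonneg]
      exact ENNReal.toReal_mono (Kernel.bound_lt_top κ).ne (Kernel.measure_le_bound κ _ _)
  refine ⟨hprod, ?_⟩
  have hYc := hY.measurableSet_cosetPreimage
  have hintY : Integrable (Function.uncurry fun (y : G) (q : G × (G ⧸ H)) =>
      fibreIntegralMk μH (Φ x q.1) y q.2 * (θ y : ℂ)) ((μG.restrict (cosetPreimage Y)).prod P) := by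
    have := hint.restrict (s := cosetPreimage Y ×ˢ Set.univ)
    rwa [← Measure.prod_restrict, Measure.restrict_univ] at this
  calc ∫ y in cosetPreimage Y, (∫ q, fibreIntegralMk μH (Φ x q.1) y q.2 ∂P) * (θ y : ℂ) ∂μG
      = ∫ y in cosetPreimage Y, ∫ q, fibreIntegralMk μH (Φ x q.1) y q.2 * (θ y : ℂ) ∂P ∂μG := by
        simp only [integral_mul_const]
    _ = ∫ q, ∫ y in cosetPreimage Y, fibreIntegralMk μH (Φ x q.1) y q.2 * (θ y : ℂ) ∂μG ∂P :=
        integral_integral_swap hintY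
    _ = ∫ z, ∫ s, ∫ y in cosetPreimage Y,
          fibreIntegralMk μH (Φ x z) y s * (θ y : ℂ) ∂μG ∂κ z ∂μG :=
        Measure.integral_compProd hintY.integral_prod_right
    _ = ∫ z, ∫ y, Φ x z y * ((κ z {s | y • s ∈ Y}).toReal : ℂ) ∂μG ∂μG := by
        refine integral_congr_ae (Filter.Eventually.of_forall fun z => ?_)
        have e1 : ∀ s : G ⧸ H, ∫ y in cosetPreimage Y,
            fibreIntegralMk μH (Φ x z) y s * (θ y : ℂ) ∂μG =
            ∫ y, Y.indicator (1 : G ⧸ H → ℂ) (y • s) * Φ x z y ∂μG := by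
          intro s
          obtain ⟨g, rfl⟩ := QuotientGroup.mk_surjective s
          exact setIntegral_fibreIntegral μH μG hθ (hΨz z) (hΨzc z) g hY
        simp only [e1]
        rw [integral_integral_swap]
        · refine integral_congr_ae (Filter.Eventually.of_forall fun y => ?_)
          have hym : MeasurableSet {s : G ⧸ H | y • s ∈ Y} :=
            (continuous_const_smul y).measurable hYm
          have e2 : ∀ s : G ⧸ H, Y.indicator (1 : G ⧸ H → ℂ) (y • s) =
              Set.indicator {s : G ⧸ H | y • s ∈ Y} (fun _ => (1 : ℂ)) s := fun s => rfl
          simp only [integral_mul_const, e2]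
          rw [integral_indicator_const _ hym, mul_comm]
          simp [Measure.real]
        · have hb : Measurable fun p : (G ⧸ H) × G =>
              Y.indicator (1 : G ⧸ H → ℂ) (p.2 • p.1) :=
            (measurable_one.indicator hYm).comp (hsm.comp measurable_swap)
          have h1 : Integrable (fun p : (G ⧸ H) × G => Φ x z p.2) ((κ z).prod μG) :=
            ((hΨz z).integrable_of_hasCompactSupport (hΨzc z)).comp_snd _
          refine h1.bdd_mul (c := 1) hb.aestronglyMeasurable
            (Filter.Eventually.of_forall fun p => ?_)
          refine (norm_indicator_le_norm_self _ _).trans ?_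
          simp
    _ = ∫ p : G × G, Φ x p.2 p.1 * ((κ p.2 {s | p.1 • s ∈ Y}).toReal : ℂ) ∂μG.prod μG :=
        (integral_prod_symm _ hprod).symm

end Density

/-! ### Continuous densities of a localisation observable -/

section Positivity

variable {G : Type u} [Group G] [TopologicalSpace G] [IsTopologicalGroup G] [T2Space G]
  [LocallyCompactSpace G] [SecondCountableTopology G] [MeasurableSpace G] [BorelSpace G]
  {H : Subgroup G} [IsClosed (H : Set G)]
  {μH : Measure H} [μH.IsHaarMeasure] {θ : C(G, ℝ)} {μG : Measure G} [μG.IsHaarMeasure]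

/-- A covariant continuous density whose integrals over all Borel subsets of `G/H` are nonnegative
is nonnegative: the open set where it is negative is invariant under `H`, hence the preimage of an
open subset of `G/H`. -/
theorem IsWeight.nonneg_of_setIntegral_nonneg (hθ : IsWeight μH θ) {b : G → ℝ} (hb : Continuous b)
    (hbm : ∀ (g : G) (h : H), b (g * h) = modularRatio h * b g)
    (hi : Integrable (fun g => b g * θ g) μG)
    (hn : ∀ Y : Set (G ⧸ H), IsBorel Y → 0 ≤ ∫ g in cosetPreimage Y, b g * θ g ∂μG) (g : G) :
    0 ≤ b g := by
  by_contra! hg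
  set O : Set G := {x | b x < 0} with hO
  have hOo : IsOpen O := isOpen_lt hb continuous_const
  have hpre : cosetPreimage ((QuotientGroup.mk : G → G ⧸ H) '' O) = O := by
    refine Set.Subset.antisymm ?_ fun x hx => ⟨x, hx, rfl⟩
    rintro x ⟨y, hy, hxy⟩
    have h1 := hbm y ⟨y⁻¹ * x, QuotientGroup.eq.1 hxy⟩
    simp only [mul_inv_cancel_left] at h1
    change b x < 0
    rw [h1]
    exact mul_neg_of_pos_of_neg (modularRatio_pos _) hy
  have hYB : IsBorel ((QuotientGroup.mk : G → G ⧸ H) '' O) := by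
    borelize (G ⧸ H)
    exact isBorel_iff_measurableSet.2 (QuotientGroup.isOpenMap_coe O hOo).measurableSet
  have h0 := hn _ hYB
  rw [hpre] at h0
  -- the integral of `b θ` over `O` is both nonnegative and nonpositive, so `b θ = 0` on `O`
  have hle : 0 ≤ᵐ[μG.restrict O] fun x => -(b x * θ x) := by
    refine (ae_restrict_iff' hOo.measurableSet).2 (Filter.Eventually.of_forall fun x hx => ?_)
    exact neg_nonneg.2 (mul_nonpos_of_nonpos_of_nonneg (le_of_lt hx) (hθ.nonneg x))
  have hz : ∫ x in O, -(b x * θ x) ∂μG = 0 := by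
    refine le_antisymm ?_ (integral_nonneg_of_ae hle)
    rw [integral_neg]
    exact neg_nonpos.2 h0
  have hae := (ae_restrict_iff' hOo.measurableSet).1
    ((setIntegral_eq_zero_iff_of_nonneg_ae hle hi.neg.integrableOn).1 hz)
  -- this contradicts the existence of a nonempty open subset of `O` on which `θ` is positive
  obtain ⟨h, hh⟩ := hθ.exists_pos g
  have hU : IsOpen (O ∩ {x | 0 < θ x}) := hOo.inter (isOpen_lt continuous_const θ.continuous)
  have hne : (O ∩ {x | 0 < θ x}).Nonempty := by
    refine ⟨g * h, ?_, hh⟩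
    change b (g * h) < 0
    rw [hbm]
    exact mul_neg_of_pos_of_neg (modularRatio_pos _) hg
  refine (hU.measure_pos μG hne).ne' (measure_mono_null ?_ (ae_iff.1 hae))
  rintro x ⟨hx1, hx2⟩ hx3
  have := hx3 hx1
  exact (mul_neg_of_neg_of_pos hx1 hx2).ne (neg_eq_zero.1 this)

/-- A covariant continuous density is determined by its integrals over the Borel subsets of
`G/H`. -/
theorem IsWeight.eq_zero_of_setIntegral_eq_zero (hθ : IsWeight μH θ) {b : G → ℂ} (hb : Continuous b)
    (hbm : ∀ (g : G) (h : H), b (g * h) = modularRatio h * b g)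
    (hi : Integrable (fun g => b g * (θ g : ℂ)) μG)
    (hn : ∀ Y : Set (G ⧸ H), IsBorel Y → ∫ g in cosetPreimage Y, b g * (θ g : ℂ) ∂μG = 0) (g : G) :
    b g = 0 := by
  -- a real linear form on `ℂ` turns `b` into a nonnegative density
  have key : ∀ L : ℂ →L[ℝ] ℝ, 0 ≤ L (b g) := by
    intro L
    have e : ∀ x, L (b x * (θ x : ℂ)) = L (b x) * θ x := fun x => by
      rw [mul_comm, ← Complex.real_smul, map_smul, smul_eq_mul, mul_comm]
    refine hθ.nonneg_of_setIntegral_nonneg (μG := μG) (b := fun x => L (b x))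
      (L.continuous.comp hb) (fun x h => ?_) ?_ (fun Y hY => ?_) g
    · rw [hbm, ← Complex.real_smul, map_smul, smul_eq_mul]
    · simpa only [e] using L.integrable_comp hi
    · have := L.integral_comp_comm (hi.restrict (s := cosetPreimage Y))
      simp only [e, hn Y hY, map_zero] at this
      exact this.ge
  apply Complex.ext
  · refine le_antisymm ?_ (key Complex.reCLM)
    simpa using key (-Complex.reCLM)
  · refine le_antisymm ?_ (key Complex.imCLM)
    simpa using key (-Complex.imCLM)

end Positivity

section DensityForm

variable {G : Type u} [Group G] [TopologicalSpace G] [IsTopologicalGroup G] [T2Space G]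
  [LocallyCompactSpace G] [SecondCountableTopology G] [MeasurableSpace G] [BorelSpace G]
  {H : Subgroup G} [IsClosed (H : Set G)]
  {μH : Measure H} [μH.IsHaarMeasure] {θ : C(G, ℝ)} {μG : Measure G} [μG.IsHaarMeasure]
  {V : Type v} [NormedAddCommGroup V] [InnerProductSpace ℂ V] [CompleteSpace V]
  {π : UnitaryRep G V} {E : Set (G ⧸ H) → V →L[ℂ] V}

/-- `b` is a continuous density of the complex measure `Y ↦ ⟨E(Y) u, v⟩` on `G/H`: a function on
`G`, covariant under `H`, which is integrated against the weight `θ`. -/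
structure IsObservableDensity (μG : Measure G) (θ : C(G, ℝ)) (E : Set (G ⧸ H) → V →L[ℂ] V)
    (u v : V) (b : G → ℂ) : Prop where
  continuous : Continuous b
  mul : ∀ (g : G) (h : H), b (g * h) = modularRatio h * b g
  integrable : Integrable (fun g => b g * (θ g : ℂ)) μG
  setIntegral : ∀ Y : Set (G ⧸ H), IsBorel Y →
    ∫ g in cosetPreimage Y, b g * (θ g : ℂ) ∂μG = inner ℂ v (E Y u)

namespace IsObservableDensity

variable {u u' v v' : V} {b b' : G → ℂ}

theorem zero_left : IsObservableDensity μG θ E 0 v 0 :=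
  ⟨continuous_zero, by simp, by simp, by simp⟩

theorem zero_right : IsObservableDensity μG θ E u 0 0 :=
  ⟨continuous_zero, by simp, by simp, by simp⟩

theorem add_left (h : IsObservableDensity μG θ E u v b) (h' : IsObservableDensity μG θ E u' v b') :
    IsObservableDensity μG θ E (u + u') v (b + b') where
  continuous := h.continuous.add h'.continuous
  mul g k := by simp only [Pi.add_apply, h.mul, h'.mul]; ring
  integrable := by
    refine (h.integrable.add h'.integrable).congr (Filter.Eventually.of_forall fun g => ?_)
    simp only [Pi.add_apply, add_mul]
  setIntegral Y hY := by
    simp only [Pi.add_apply, add_mul]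
    rw [integral_add h.integrable.restrict h'.integrable.restrict, h.setIntegral Y hY,
      h'.setIntegral Y hY, map_add, inner_add_right]

theorem add_right (h : IsObservableDensity μG θ E u v b) (h' : IsObservableDensity μG θ E u v' b') :
    IsObservableDensity μG θ E u (v + v') (b + b') where
  continuous := h.continuous.add h'.continuous
  mul g k := by simp only [Pi.add_apply, h.mul, h'.mul]; ring
  integrable := by
    refine (h.integrable.add h'.integrable).congr (Filter.Eventually.of_forall fun g => ?_)
    simp only [Pi.add_apply, add_mul]
  setIntegral Y hY := by
    simp only [Pi.add_apply, add_mul]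
    rw [integral_add h.integrable.restrict h'.integrable.restrict, h.setIntegral Y hY,
      h'.setIntegral Y hY, inner_add_left]

theorem smul_left (h : IsObservableDensity μG θ E u v b) (c : ℂ) :
    IsObservableDensity μG θ E (c • u) v (c • b) where
  continuous := h.continuous.const_smul c
  mul g k := by simp only [Pi.smul_apply, smul_eq_mul, h.mul]; ring
  integrable := by simpa only [Pi.smul_apply, smul_eq_mul, mul_assoc] using h.integrable.const_mul c
  setIntegral Y hY := by
    simp only [Pi.smul_apply, smul_eq_mul, mul_assoc]
    rw [integral_const_mul, h.setIntegral Y hY, map_smul, inner_smul_right]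

theorem smul_right (h : IsObservableDensity μG θ E u v b) (c : ℂ) :
    IsObservableDensity μG θ E u (c • v) (starRingEnd ℂ c • b) where
  continuous := h.continuous.const_smul _
  mul g k := by simp only [Pi.smul_apply, smul_eq_mul, h.mul]; ring
  integrable := by simpa only [Pi.smul_apply, smul_eq_mul, mul_assoc] using h.integrable.const_mul _
  setIntegral Y hY := by
    simp only [Pi.smul_apply, smul_eq_mul, mul_assoc]
    rw [integral_const_mul, h.setIntegral Y hY, inner_smul_left]

theorem unique (hθ : IsWeight μH θ) (h : IsObservableDensity μG θ E u v b)
    (h' : IsObservableDensity μG θ E u v b') : b = b' := by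
  have hs := h'.add_left (h.smul_left (-1))
  funext g
  have := hθ.eq_zero_of_setIntegral_eq_zero (μG := μG) hs.continuous hs.mul hs.integrable
    (fun Y hY => by rw [hs.setIntegral Y hY]; simp) g
  simp only [Pi.add_apply, Pi.smul_apply, smul_eq_mul] at this
  linear_combination -this

theorem re_nonneg (hθ : IsWeight μH θ) (hE : IsLocalisationObservable π E)
    (h : IsObservableDensity μG θ E u u b) (g : G) : 0 ≤ (b g).re := by
  have e : ∀ x, (b x * (θ x : ℂ)).re = (b x).re * θ x := fun x => by simp
  refine hθ.nonneg_of_setIntegral_nonneg (μG := μG) (b := fun x => (b x).re)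
      (Complex.continuous_re.comp h.continuous) (fun x k => by simp [h.mul]) ?_ (fun Y hY => ?_) g
  · have := Complex.reCLM.integrable_comp h.integrable
    simpa only [Complex.reCLM_apply, e] using this
  · have h1 := Complex.reCLM.integral_comp_comm (h.integrable.restrict (s := cosetPreimage Y))
    simp only [Complex.reCLM_apply, e, h.setIntegral Y hY] at h1
    rw [h1]
    exact (hE.inner_nonneg hY u).2

theorem conj_symm (hE : IsLocalisationObservable π E) (h : IsObservableDensity μG θ E u v b) :
    IsObservableDensity μG θ E v u (fun g => starRingEnd ℂ (b g)) where
  continuous := Complex.continuous_conj.comp h.continuous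
  mul g k := by simp [h.mul]
  integrable := by
    have := Complex.conjCLE.toContinuousLinearMap.integrable_comp h.integrable
    simpa using this
  setIntegral Y hY := by
    have h1 := integral_conj (f := fun g => b g * (θ g : ℂ)) (μ := μG.restrict (cosetPreimage Y))
    simp only [map_mul, Complex.conj_ofReal] at h1
    rw [h1, h.setIntegral Y hY, inner_conj_symm]
    exact (hE.isPositive Y hY).isSymmetric u v

/-- Covariance of `E` turns the action of `G` on vectors into left translation of densities. -/
theorem translate (hθ : IsWeight μH θ) (hE : IsLocalisationObservable π E)
    (h : IsObservableDensity μG θ E u v b) (x : G) :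
    IsObservableDensity μG θ E (π x u) (π x v) (fun g => b (x⁻¹ * g)) := by
  have key : ∀ Y : Set (G ⧸ H), IsBorel Y →
      Integrable ((cosetPreimage Y).indicator fun g => b (x⁻¹ * g) * (θ g : ℂ)) μG ∧
      ∫ g, (cosetPreimage Y).indicator (fun g => b (x⁻¹ * g) * (θ g : ℂ)) g ∂μG =
        inner ℂ v (E ((fun y => x⁻¹ • y) '' Y) u) := by
    intro Y hY
    have hY' := (hY.smul_image x⁻¹)
    have hYm := hY'.measurableSet_cosetPreimage
    have e1 : ∀ g, (cosetPreimage ((fun y => x⁻¹ • y) '' Y)).indicator b g * (θ g : ℂ) =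
        (cosetPreimage ((fun y => x⁻¹ • y) '' Y)).indicator (fun g => b g * (θ g : ℂ)) g :=
      fun g => (Set.indicator_mul_left _ b (fun g => (θ g : ℂ))).symm
    obtain ⟨h1, h2⟩ := hθ.integral_translate μG
      (φ := (cosetPreimage ((fun y => x⁻¹ • y) '' Y)).indicator b)
      (h.continuous.measurable.indicator hYm).aemeasurable
      (fun k => Filter.Eventually.of_forall fun g => by
        have hiff := cosetPreimage_mul_mem (Y := (fun y => x⁻¹ • y) '' Y) g k
        by_cases hg : g ∈ cosetPreimage ((fun y => x⁻¹ • y) '' Y)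
        · rw [Set.indicator_of_mem hg, Set.indicator_of_mem (hiff.2 hg), h.mul]
        · rw [Set.indicator_of_notMem hg, Set.indicator_of_notMem (mt hiff.1 hg), mul_zero])
      (by simpa only [e1] using h.integrable.indicator hYm) x
    have e2 : ∀ g, (cosetPreimage ((fun y => x⁻¹ • y) '' Y)).indicator b g * (θ (x * g) : ℂ) =
        (cosetPreimage Y).indicator (fun g => b (x⁻¹ * g) * (θ g : ℂ)) (x * g) := by
      intro g
      have hiff := mem_cosetPreimage_smul_image (Y := Y) x⁻¹ g
      rw [inv_inv] at hiff
      by_cases hg : x * g ∈ cosetPreimage Y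
      · rw [Set.indicator_of_mem hg, Set.indicator_of_mem (hiff.2 hg), inv_mul_cancel_left]
      · rw [Set.indicator_of_notMem hg, Set.indicator_of_notMem (mt hiff.1 hg), zero_mul]
    simp only [e2] at h1 h2
    constructor
    · have := h1.comp_mul_left x⁻¹
      simpa using this
    · rw [← integral_mul_left_eq_self _ x, h2]
      simp only [e1]
      rw [integral_indicator hYm, h.setIntegral _ hY']
  refine ⟨h.continuous.comp (continuous_const_mul _), fun g k => ?_, ?_, fun Y hY => ?_⟩
  · rw [← mul_assoc, h.mul]
  · have := (key Set.univ IsBorel.univ).1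
    simpa [cosetPreimage_univ] using this
  · rw [← integral_indicator hY.measurableSet_cosetPreimage, (key Y hY).2,
      ← hE.covariant x⁻¹ Y hY, inv_inv, ← UnitaryRep.inner_apply_left]

end IsObservableDensity

end DensityForm

/-- Linearity of the integral for the combination of the polarisation identity. -/
theorem integral_polarization {α : Type*} [MeasurableSpace α] {μ : Measure α} {f₁ f₂ f₃ f₄ : α → ℂ}
    (h₁ : Integrable f₁ μ) (h₂ : Integrable f₂ μ) (h₃ : Integrable f₃ μ) (h₄ : Integrable f₄ μ) :
    Integrable (fun a => (f₁ a - f₂ a + Complex.I * f₃ a - Complex.I * f₄ a) / 4) μ ∧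
      ∫ a, (f₁ a - f₂ a + Complex.I * f₃ a - Complex.I * f₄ a) / 4 ∂μ =
        (∫ a, f₁ a ∂μ - ∫ a, f₂ a ∂μ + Complex.I * ∫ a, f₃ a ∂μ - Complex.I * ∫ a, f₄ a ∂μ) / 4 := by
  have h12 : Integrable (fun a => f₁ a - f₂ a) μ := h₁.sub h₂
  have h123 : Integrable (fun a => f₁ a - f₂ a + Complex.I * f₃ a) μ :=
    h12.add (h₃.const_mul _)
  refine ⟨(h123.sub (h₄.const_mul _)).div_const 4, ?_⟩
  rw [integral_div, integral_sub h123 (h₄.const_mul _), integral_add h12 (h₃.const_mul _),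
    integral_sub h₁ h₂, integral_const_mul, integral_const_mul]

section DensityExistence

variable {G : Type u} [Group G] [TopologicalSpace G] [IsTopologicalGroup G] [T2Space G]
  [LocallyCompactSpace G] [SecondCountableTopology G] [MeasurableSpace G] [BorelSpace G]
  {H : Subgroup G} [IsClosed (H : Set G)]
  {μH : Measure H} [μH.IsHaarMeasure] {θ : C(G, ℝ)} {μG : Measure G} [μG.IsHaarMeasure]
  {V : Type v} [NormedAddCommGroup V] [InnerProductSpace ℂ V] [CompleteSpace V]
  {π : UnitaryRep G V} {E : Set (G ⧸ H) → V →L[ℂ] V}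

theorem IsLocalisationObservable.inner_polarization [MeasurableSpace (G ⧸ H)] [BorelSpace (G ⧸ H)]
    (hE : IsLocalisationObservable π E) {Y : Set (G ⧸ H)} (hY : MeasurableSet Y) (u v : V) :
    inner ℂ v (E Y u) = (((observableMeasure hE (u + v) Y).toReal : ℂ) -
      (observableMeasure hE (u - v) Y).toReal +
      Complex.I * (observableMeasure hE (u + Complex.I • v) Y).toReal -
      Complex.I * (observableMeasure hE (u - Complex.I • v) Y).toReal) / 4 := by
  have hs := (hE.isPositive Y (isBorel_iff_measurableSet.2 hY)).isSymmetric
  have h1 := inner_map_polarization (E Y : V →ₗ[ℂ] V) u v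
  simp only [hs _ _] at h1
  simp only [observableMeasure_toReal hE _ hY]
  exact h1

/-- `⟨E(Y) π(x) π(f₁) u, π(f₂) v⟩` as a double integral. -/
theorem IsLocalisationObservable.inner_smear (hE : IsLocalisationObservable π E) {f₁ f₂ : G → ℂ}
    (h₁ : Continuous f₁) (c₁ : HasCompactSupport f₁) (h₂ : Continuous f₂)
    (c₂ : HasCompactSupport f₂) (u v : V) (x : G) {Y : Set (G ⧸ H)} (hY : IsBorel Y) :
    inner ℂ (π.smear μG f₂ v) (E Y (π x (π.smear μG f₁ u))) =
      ∫ y, ∫ z, f₁ (x⁻¹ * y * z) * starRingEnd ℂ (f₂ y) *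
        inner ℂ v (E {s | y • s ∈ Y} (π z u)) ∂μG ∂μG := by
  rw [UnitaryRep.smear, ← inner_conj_symm, ← integral_inner
    (UnitaryRep.integrable_smul_apply μG π h₂ c₂ v), ← integral_conj]
  refine integral_congr_ae (Filter.Eventually.of_forall fun y => ?_)
  have e1 : (fun s => y⁻¹ • s) '' Y = {s | y • s ∈ Y} := by
    ext s
    rw [Set.image_smul, Set.mem_smul_set_iff_inv_smul_mem, inv_inv]
    rfl
  have hfi := UnitaryRep.integrable_smul_apply μG π (f := fun z => f₁ ((y⁻¹ * x)⁻¹ * z))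
    (by fun_prop) (c₁.comp_homeomorph (Homeomorph.mulLeft (y⁻¹ * x)⁻¹)) u
  have e2 := hE.covariant y⁻¹ Y hY (π (y⁻¹ * x) (π.smear μG f₁ u))
  rw [inv_inv, ← UnitaryRep.mul_apply, mul_inv_cancel_left, e1,
    UnitaryRep.apply_smear μG π (y⁻¹ * x)] at e2
  simp only [inner_smul_right, map_mul, inner_conj_symm]
  rw [UnitaryRep.inner_apply_left, e2, UnitaryRep.smear,
    ← ContinuousLinearMap.integral_comp_comm _ hfi]
  have h3 := ((innerSL ℂ v).integral_comp_comm
    ((E {s | y • s ∈ Y}).integrable_comp hfi))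
  simp only [innerSL_apply_apply] at h3
  rw [← h3, ← integral_const_mul]
  refine integral_congr_ae (Filter.Eventually.of_forall fun z => ?_)
  simp only [map_smul, inner_smul_right, mul_inv_rev, inv_inv]
  ring

/-- The case `u = π(f₁) u`, `v = π(f₂) v` of `exists_density`: by polarisation, the double integral
of `IsLocalisationObservable.inner_smear` is a combination of four integrals against the positive
measures of the vectors `π(z) u + i ^ k v`. -/
theorem exists_density_smear (hθ : IsWeight μH θ) (hE : IsLocalisationObservable π E)
    {f₁ f₂ : G → ℂ}
    (h₁ : Continuous f₁) (c₁ : HasCompactSupport f₁) (h₂ : Continuous f₂)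
    (c₂ : HasCompactSupport f₂) (u v : V) :
    ∃ b : G → G → ℂ, (Continuous fun p : G × G => b p.1 p.2) ∧
      ∀ x, IsObservableDensity μG θ E (π x (π.smear μG f₁ u)) (π.smear μG f₂ v) (b x) := by
  borelize (G ⧸ H)
  have hΦ : Continuous fun p : (G × G) × G =>
      f₁ (p.1.1⁻¹ * p.2 * p.1.2) * starRingEnd ℂ (f₂ p.2) :=
    (h₁.comp (by fun_prop)).mul (Complex.continuous_conj.comp (h₂.comp (by fun_prop)))
  have hΦS : ∀ x z y : G, f₁ (x⁻¹ * y * z) * starRingEnd ℂ (f₂ y) ≠ 0 → y ∈ tsupport f₂ := by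
    intro x z y hne
    refine subset_tsupport _ fun h0 => hne ?_
    simp [h0]
  have hΦZ : ∀ C : Set G, IsCompact C → ∃ Z : Set G, IsCompact Z ∧
      ∀ x ∈ C, ∀ z y, f₁ (x⁻¹ * y * z) * starRingEnd ℂ (f₂ y) ≠ 0 → z ∈ Z := by
    intro C hC
    refine ⟨(tsupport f₂)⁻¹ * C * tsupport f₁, (c₂.inv.mul hC).mul c₁, fun x hx z y hne => ?_⟩
    refine ⟨y⁻¹ * x, ⟨y⁻¹, Set.inv_mem_inv.2 (hΦS x z y hne), x, hx, rfl⟩, x⁻¹ * y * z,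
      subset_tsupport _ fun h0 => hne (by simp [h0]), by group⟩
  have key : ∀ v' : V, ‖v'‖ ≤ ‖v‖ → ∃ b : G → G → ℂ, (Continuous fun p : G × G => b p.1 p.2) ∧
      ∀ x, (∀ (y : G) (h : H), b x (y * h) = modularRatio h * b x y) ∧
        Integrable (fun y => b x y * (θ y : ℂ)) μG ∧
        ∀ Y : Set (G ⧸ H), IsBorel Y →
          Integrable (fun p : G × G => f₁ (x⁻¹ * p.1 * p.2) * starRingEnd ℂ (f₂ p.1) *
            ((observableMeasure hE (π p.2 u + v') {s | p.1 • s ∈ Y}).toReal : ℂ)) (μG.prod μG) ∧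
          ∫ y in cosetPreimage Y, b x y * (θ y : ℂ) ∂μG =
            ∫ p : G × G, f₁ (x⁻¹ * p.1 * p.2) * starRingEnd ℂ (f₂ p.1) *
              ((observableMeasure hE (π p.2 u + v') {s | p.1 • s ∈ Y}).toReal : ℂ)
                ∂μG.prod μG := by
    intro v' hv'
    have hw : Continuous fun z => π z u + v' := (π.continuous_apply u).add continuous_const
    have hM : ∀ z, ‖π z u + v'‖ ≤ ‖u‖ + ‖v‖ := fun z =>
      (norm_add_le _ _).trans (by rw [LinearIsometryEquiv.norm_map]; gcongr)
    have := observableKernel_isFinite hE hw hM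
    exact exists_continuous_density (μG := μG) hθ (observableKernel hE hw) hΦ c₂ hΦS hΦZ
  obtain ⟨b₁, hb₁, H₁⟩ := key v le_rfl
  obtain ⟨b₂, hb₂, H₂⟩ := key (-v) (by simp)
  obtain ⟨b₃, hb₃, H₃⟩ := key (Complex.I • v) (by simp [norm_smul])
  obtain ⟨b₄, hb₄, H₄⟩ := key (-(Complex.I • v)) (by simp [norm_smul])
  refine ⟨fun x y => (b₁ x y - b₂ x y + Complex.I * b₃ x y - Complex.I * b₄ x y) / 4, ?_,
    fun x => ⟨?_, ?_, ?_, fun Y hY => ?_⟩⟩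
  · fun_prop
  · have e : Continuous fun y : G => (x, y) := by fun_prop
    have c1 := hb₁.comp e
    have c2 := hb₂.comp e
    have c3 := hb₃.comp e
    have c4 := hb₄.comp e
    simp only [Function.comp_def] at c1 c2 c3 c4
    fun_prop
  · intro g h
    simp only [(H₁ x).1, (H₂ x).1, (H₃ x).1, (H₄ x).1]
    ring
  · refine (integral_polarization (H₁ x).2.1 (H₂ x).2.1 (H₃ x).2.1 (H₄ x).2.1).1.congr
      (Filter.Eventually.of_forall fun y => ?_)
    ring
  · obtain ⟨j1, s1⟩ := (H₁ x).2.2 Y hY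
    obtain ⟨j2, s2⟩ := (H₂ x).2.2 Y hY
    obtain ⟨j3, s3⟩ := (H₃ x).2.2 Y hY
    obtain ⟨j4, s4⟩ := (H₄ x).2.2 Y hY
    have hl := (integral_polarization ((H₁ x).2.1.restrict (s := cosetPreimage Y))
      (H₂ x).2.1.restrict (H₃ x).2.1.restrict (H₄ x).2.1.restrict).2
    obtain ⟨hi, hr⟩ := integral_polarization j1 j2 j3 j4
    rw [s1, s2, s3, s4, ← hr, integral_prod _ hi] at hl
    rw [hE.inner_smear h₁ c₁ h₂ c₂ u v x hY]
    refine Eq.trans (integral_congr_ae (Filter.Eventually.of_forall fun y => ?_)) (hl.trans ?_)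
    · ring
    refine integral_congr_ae (Filter.Eventually.of_forall fun y =>
      integral_congr_ae (Filter.Eventually.of_forall fun z => ?_))
    have hm : MeasurableSet {s : G ⧸ H | y • s ∈ Y} :=
      (continuous_const_smul y).measurable (isBorel_iff_measurableSet.1 hY)
    simp only [hE.inner_polarization hm]
    simp only [← sub_eq_add_neg]
    ring

/-- On the Gårding domain the measures `Y ↦ ⟨E(Y) π(x) u, v⟩` have densities which are jointly
continuous in `x` and the point. -/
theorem exists_density (hθ : IsWeight μH θ) (hE : IsLocalisationObservable π E)
    {u v : V} (hu : u ∈ π.garding μG) (hv : v ∈ π.garding μG) :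
    ∃ b : G → G → ℂ, (Continuous fun p : G × G => b p.1 p.2) ∧
      ∀ x, IsObservableDensity μG θ E (π x u) v (b x) := by
  induction hu using Submodule.span_induction with
  | mem u hu =>
    obtain ⟨f₁, u, h₁, c₁, rfl⟩ := hu
    induction hv using Submodule.span_induction with
    | mem v hv =>
      obtain ⟨f₂, v, h₂, c₂, rfl⟩ := hv
      exact exists_density_smear hθ hE h₁ c₁ h₂ c₂ u v
    | zero => exact ⟨0, continuous_const, fun x => .zero_right⟩
    | add v v' _ _ h h' =>
      obtain ⟨b, hb, hd⟩ := h
      obtain ⟨b', hb', hd'⟩ := h'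
      exact ⟨b + b', hb.add hb', fun x => (hd x).add_right (hd' x)⟩
    | smul c v _ h =>
      obtain ⟨b, hb, hd⟩ := h
      exact ⟨starRingEnd ℂ c • b, continuous_const.mul hb, fun x => (hd x).smul_right c⟩
  | zero => exact ⟨0, continuous_const, fun x => by rw [map_zero]; exact .zero_left⟩
  | add u u' _ _ h h' =>
    obtain ⟨b, hb, hd⟩ := h
    obtain ⟨b', hb', hd'⟩ := h'
    exact ⟨b + b', hb.add hb', fun x => by rw [map_add]; exact (hd x).add_left (hd' x)⟩
  | smul c u _ h =>
    obtain ⟨b, hb, hd⟩ := h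
    exact ⟨c • b, continuous_const.mul hb, fun x => by rw [map_smul]; exact (hd x).smul_left c⟩

end DensityExistence

/-! ### The Hilbert space of the densities at the identity -/

/-- The Hausdorff completion of a space with a positive semidefinite sesquilinear form. -/
theorem PreInnerProductSpace.Core.exists_completion {D : Type v} [AddCommGroup D] [Module ℂ D]
    (c : PreInnerProductSpace.Core ℂ D) :
    ∃ (K : Type v) (_ : NormedAddCommGroup K) (_ : InnerProductSpace ℂ K) (_ : CompleteSpace K)
      (A : D →ₗ[ℂ] K), DenseRange A ∧ ∀ u v, inner ℂ (A u) (A v) = c.inner u v := by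
  let _ : SeminormedAddCommGroup D := InnerProductSpace.Core.toSeminormedAddCommGroup (c := c)
  let _ : InnerProductSpace ℂ D := InnerProductSpace.ofCore c
  refine ⟨UniformSpace.Completion D, inferInstance, inferInstance, inferInstance,
    (UniformSpace.Completion.toComplₗᵢ (𝕜 := ℂ) (E := D)).toLinearMap,
    UniformSpace.Completion.denseRange_coe, fun u v => ?_⟩
  exact UniformSpace.Completion.inner_coe u v

section DensityForm

variable {G : Type u} [Group G] [TopologicalSpace G] [IsTopologicalGroup G] [T2Space G]
  [LocallyCompactSpace G] [SecondCountableTopology G] [MeasurableSpace G] [BorelSpace G]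
  {H : Subgroup G} [IsClosed (H : Set G)]
  {μH : Measure H} [μH.IsHaarMeasure] {θ : C(G, ℝ)} {μG : Measure G} [μG.IsHaarMeasure]
  {V : Type v} [NormedAddCommGroup V] [InnerProductSpace ℂ V] [CompleteSpace V]
  {π : UnitaryRep G V} {E : Set (G ⧸ H) → V →L[ℂ] V}

/-- The continuous density of `Y ↦ ⟨E(Y) u, v⟩`, for `u` and `v` in the Gårding domain. -/
def observableDensity (hθ : IsWeight μH θ) (hE : IsLocalisationObservable π E)
    (u v : π.garding μG) : G → ℂ :=
  (exists_density hθ hE u.2 v.2).choose 1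

theorem observableDensity_spec (hθ : IsWeight μH θ) (hE : IsLocalisationObservable π E)
    (u v : π.garding μG) :
    IsObservableDensity μG θ E (u : V) v (observableDensity hθ hE u v) := by
  have := (exists_density hθ hE u.2 v.2).choose_spec.2 1
  rwa [map_one] at this

/-- The densities chosen for the vectors `π(x) u` one by one agree, by uniqueness, with the jointly
continuous family. -/
theorem continuous_observableDensity (hθ : IsWeight μH θ) (hE : IsLocalisationObservable π E)
    (u v : π.garding μG) :
    Continuous fun p : G × G => observableDensity hθ hE (π.gardingAct μG p.1 u) v p.2 := by
  obtain ⟨hb, hd⟩ := (exists_density hθ hE u.2 v.2).choose_spec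
  have : (fun p : G × G => observableDensity hθ hE (π.gardingAct μG p.1 u) v p.2) =
      fun p => (exists_density hθ hE u.2 v.2).choose p.1 p.2 := by
    funext p
    exact congrFun ((observableDensity_spec hθ hE _ v).unique hθ (hd p.1)) p.2
  rw [this]
  exact hb

/-- Covariance of the observable, for densities. -/
theorem observableDensity_gardingAct (hθ : IsWeight μH θ) (hE : IsLocalisationObservable π E)
    (u v : π.garding μG) (x g : G) :
    observableDensity hθ hE (π.gardingAct μG x u) (π.gardingAct μG x v) g =
      observableDensity hθ hE u v (x⁻¹ * g) := by
  have h := (observableDensity_spec hθ hE (π.gardingAct μG x u) (π.gardingAct μG x v)).unique hθ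
    ((observableDensity_spec hθ hE u v).translate hθ hE x)
  exact congrFun h g

/-- The values of the densities at the identity form a positive semidefinite sesquilinear form; its
completion is the space on which `H` is going to act. -/
theorem exists_factorisation (hθ : IsWeight μH θ) (hE : IsLocalisationObservable π E) :
    ∃ (K : Type v) (_ : NormedAddCommGroup K) (_ : InnerProductSpace ℂ K) (_ : CompleteSpace K)
      (A : π.garding μG →ₗ[ℂ] K), DenseRange A ∧
        ∀ u v, inner ℂ (A v) (A u) = observableDensity hθ hE u v 1 := by
  obtain ⟨K, i1, i2, i3, A, hA, h⟩ := PreInnerProductSpace.Core.exists_completion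
    (D := π.garding μG)
    { inner := fun v u => observableDensity hθ hE u v 1
      conj_inner_symm := fun v u => (congrFun ((observableDensity_spec hθ hE u v).unique hθ
        ((observableDensity_spec hθ hE v u).conj_symm hE)) 1).symm
      re_inner_nonneg := fun v => (observableDensity_spec hθ hE v v).re_nonneg hθ hE 1
      add_left := fun v v' u => congrFun ((observableDensity_spec hθ hE u (v + v')).unique hθ
        ((observableDensity_spec hθ hE u v).add_right (observableDensity_spec hθ hE u v'))) 1
      smul_left := fun v u c => congrFun ((observableDensity_spec hθ hE u (c • v)).unique hθ
        ((observableDensity_spec hθ hE u v).smul_right c)) 1 }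
  exact ⟨K, i1, i2, i3, A, hA, fun u v => h v u⟩

end DensityForm

/-! ### The representation associated with an observable -/

section Factorisation

variable {G : Type u} [Group G] [TopologicalSpace G] [IsTopologicalGroup G] [T2Space G]
  [LocallyCompactSpace G] [SecondCountableTopology G] [MeasurableSpace G] [BorelSpace G]
  {H : Subgroup G} [IsClosed (H : Set G)]
  {μH : Measure H} [μH.IsHaarMeasure] {θ : C(G, ℝ)} {μG : Measure G} [μG.IsHaarMeasure]
  {V : Type v} [NormedAddCommGroup V] [InnerProductSpace ℂ V] [CompleteSpace V]
  {π : UnitaryRep G V} {E : Set (G ⧸ H) → V →L[ℂ] V}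
  {K : Type w} [NormedAddCommGroup K] [InnerProductSpace ℂ K] [CompleteSpace K]
  {A : π.garding μG →ₗ[ℂ] K}

/-- By covariance, a form which gives the densities at the identity gives them everywhere. -/
theorem inner_waveletFun_of_factorisation (hθ : IsWeight μH θ) (hE : IsLocalisationObservable π E)
    (hA : ∀ u v, inner ℂ (A v) (A u) = observableDensity hθ hE u v 1) (u v : π.garding μG) (g : G) :
    inner ℂ (waveletFun μG A v g) (waveletFun μG A u g) = observableDensity hθ hE u v g := by
  rw [waveletFun, waveletFun, hA, observableDensity_gardingAct, inv_inv, mul_one]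

/-- Strong continuity, by expanding `‖A π(g) v - A π(g₀) v‖²` in terms of continuous densities. -/
theorem continuous_gardingAct_of_factorisation (hθ : IsWeight μH θ)
    (hE : IsLocalisationObservable π E)
    (hA : ∀ u v, inner ℂ (A v) (A u) = observableDensity hθ hE u v 1) (v : π.garding μG) :
    Continuous fun g => A (π.gardingAct μG g v) := by
  refine continuous_iff_continuousAt.2 fun g₀ => ?_
  have h1 : Continuous fun g => inner ℂ (A (π.gardingAct μG g₀ v)) (A (π.gardingAct μG g v)) := by
    simp only [hA]
    exact (continuous_observableDensity hθ hE v (π.gardingAct μG g₀ v)).comp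
      (f := fun g : G => (g, (1 : G))) (by fun_prop)
  have h2 : Continuous fun g => inner ℂ (A (π.gardingAct μG g v)) (A (π.gardingAct μG g v)) := by
    simp only [hA, observableDensity_gardingAct, mul_one]
    exact (observableDensity_spec hθ hE v v).continuous.comp continuous_inv
  have h3 : Continuous fun g => ‖A (π.gardingAct μG g v) - A (π.gardingAct μG g₀ v)‖ ^ 2 := by
    have e : ∀ g, ‖A (π.gardingAct μG g v) - A (π.gardingAct μG g₀ v)‖ ^ 2 =
        (inner ℂ (A (π.gardingAct μG g v)) (A (π.gardingAct μG g v))).re -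
        2 * (inner ℂ (A (π.gardingAct μG g₀ v)) (A (π.gardingAct μG g v))).re +
        ‖A (π.gardingAct μG g₀ v)‖ ^ 2 := by
      intro g
      rw [norm_sub_sq (𝕜 := ℂ), inner_self_eq_norm_sq_to_K, inner_re_symm]
      simp [← Complex.ofReal_pow]
    simp only [e]
    fun_prop
  rw [ContinuousAt, tendsto_iff_norm_sub_tendsto_zero]
  have h4 := (Real.continuous_sqrt.comp h3).tendsto g₀
  simpa only [Function.comp_def, Real.sqrt_sq_eq_abs, abs_norm, sub_self, norm_zero, zero_pow,
    ne_eq, OfNat.ofNat_ne_zero, not_false_eq_true, Real.sqrt_zero, abs_zero] using h4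

/-- Tightness of `A` is the normalisation `E(G/H) = 1`, tested on the vector `v`. -/
theorem isTightAdmissible_of_factorisation (hθ : IsWeight μH θ)
    (hE : IsNormalisedLocalisationObservable π E)
    (hA : ∀ u v, inner ℂ (A v) (A u) = observableDensity hθ hE.1 u v 1) {σ : UnitaryRep H K}
    (hσ : ∀ (h : H) (v : π.garding μG),
      σ h (A v) = (Real.sqrt (modularRatio h) : ℂ) • A (π.gardingAct μG (h : G) v)) :
    IsTightAdmissible μG θ σ A := by
  have hc : ∀ v, Continuous (waveletFun μG A v) := fun v =>
    (continuous_gardingAct_of_factorisation hθ hE.1 hA v).comp continuous_inv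
  have ht : ∀ v : π.garding μG, ∫⁻ g, ‖waveletFun μG A v g‖ₑ ^ 2 * ENNReal.ofReal (θ g) ∂μG =
      ENNReal.ofReal (‖(v : V)‖ ^ 2) := by
    intro v
    have hs := observableDensity_spec hθ hE.1 v v
    have e : ∀ g, observableDensity hθ hE.1 v v g * (θ g : ℂ) =
        ((‖waveletFun μG A v g‖ ^ 2 * θ g : ℝ) : ℂ) := by
      intro g
      rw [← inner_waveletFun_of_factorisation hθ hE.1 hA, inner_self_eq_norm_sq_to_K]
      push_cast
      rfl
    have h1 := hs.setIntegral Set.univ IsBorel.univ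
    have hi := hs.integrable
    simp only [e] at h1 hi
    rw [cosetPreimage_univ, Measure.restrict_univ, integral_complex_ofReal, hE.normalised] at h1
    have h2 : ∫ g, ‖waveletFun μG A v g‖ ^ 2 * θ g ∂μG = ‖(v : V)‖ ^ 2 := by
      have h3 : ((∫ g, ‖waveletFun μG A v g‖ ^ 2 * θ g ∂μG : ℝ) : ℂ) =
          ((‖(v : V)‖ ^ 2 : ℝ) : ℂ) := by
        rw [h1, one_apply_eq_self, inner_self_eq_norm_sq_to_K]
        push_cast
        rfl
      exact_mod_cast h3
    have hi' : Integrable (fun g => ‖waveletFun μG A v g‖ ^ 2 * θ g) μG := by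
      simpa only [RCLike.re_to_complex, Complex.ofReal_re] using hi.re
    rw [← h2, ofReal_integral_eq_lintegral_ofReal hi'
      (Filter.Eventually.of_forall fun g => mul_nonneg (sq_nonneg _) (hθ.nonneg g))]
    refine lintegral_congr fun g => ?_
    rw [ENNReal.ofReal_mul (sq_nonneg _), ENNReal.ofReal_pow (norm_nonneg _), ofReal_norm]
  exact ⟨⟨hσ, fun v => (hc v).aestronglyMeasurable, 1, one_pos, fun v => by rw [ht, one_mul]⟩, ht⟩

theorem isGivenBy_of_factorisation (hθ : IsWeight μH θ) (hE : IsLocalisationObservable π E)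
    (hA : ∀ u v, inner ℂ (A v) (A u) = observableDensity hθ hE u v 1) :
    IsGivenBy μG θ E A := by
  intro Y hY u v
  have hs := observableDensity_spec hθ hE u v
  simp only [inner_waveletFun_of_factorisation hθ hE hA]
  exact ⟨hs.integrable.integrableOn, (hs.setIntegral Y hY).symm⟩

/-- The operators `√r(h) A π(h) A⁻¹`, where `r` is the modular ratio, define a representation. -/
theorem exists_unitaryRep_of_factorisation (hθ : IsWeight μH θ)
    (hE : IsLocalisationObservable π E) (hd : DenseRange A)
    (hA : ∀ u v, inner ℂ (A v) (A u) = observableDensity hθ hE u v 1) :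
    ∃ σ : UnitaryRep H K, ∀ (h : H) (v : π.garding μG),
      σ h (A v) = (Real.sqrt (modularRatio h) : ℂ) • A (π.gardingAct μG (h : G) v) := by
  have hnsq : ∀ v, ‖A v‖ ^ 2 = (observableDensity hθ hE v v 1).re := by
    intro v
    rw [← hA, inner_self_eq_norm_sq_to_K]
    simp [← Complex.ofReal_pow]
  let f : H → π.garding μG →ₗ[ℂ] K := fun h =>
    { toFun := fun v => (Real.sqrt (modularRatio h) : ℂ) • A (π.gardingAct μG (h : G) v)
      map_add' := fun u v => by rw [UnitaryRep.gardingAct_add, map_add, smul_add]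
      map_smul' := fun c v => by
        rw [UnitaryRep.gardingAct_smul, map_smul, smul_comm, RingHom.id_apply] }
  -- the factor `√r(h)` compensates the covariance `b(h⁻¹) = r(h)⁻¹ b(1)` of the density of `v`
  have hfn : ∀ h v, ‖f h v‖ = ‖A v‖ := by
    intro h v
    change ‖(Real.sqrt (modularRatio h) : ℂ) • A (π.gardingAct μG (h : G) v)‖ = _
    refine (sq_eq_sq₀ (norm_nonneg _) (norm_nonneg _)).1 ?_
    have h1 := (observableDensity_spec hθ hE v v).mul 1 h⁻¹
    rw [one_mul] at h1
    rw [norm_smul, mul_pow, hnsq, hnsq, observableDensity_gardingAct, mul_one, Complex.norm_real,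
      Real.norm_of_nonneg (Real.sqrt_nonneg _), Real.sq_sqrt (modularRatio_pos h).le]
    have h2 : ((h⁻¹ : H) : G) = (h : G)⁻¹ := rfl
    rw [← h2, h1, modularRatio_inv]
    simp [(modularRatio_pos h).ne']
  let T : H → K →L[ℂ] K := fun h => (f h).extendOfNorm A
  have hT : ∀ h v, T h (A v) = f h v := fun h v =>
    LinearMap.extendOfNorm_eq hd ⟨1, fun x => by rw [hfn, one_mul]⟩ v
  have hTn : ∀ h x, ‖T h x‖ = ‖x‖ := by
    intro h x
    refine congrFun (hd.equalizer (T h).continuous.norm continuous_norm ?_) x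
    ext v
    simp only [Function.comp_apply]
    rw [hT, hfn]
  have hTone : ∀ x, T 1 x = x := by
    intro x
    refine congrFun (hd.equalizer (T 1).continuous continuous_id ?_) x
    ext v
    simp only [Function.comp_apply, id]
    rw [hT]
    change (Real.sqrt (modularRatio (1 : H)) : ℂ) • A (π.gardingAct μG ((1 : H) : G) v) = _
    rw [modularRatio_one, Subgroup.coe_one, UnitaryRep.gardingAct_one]
    simp
  have hTmul : ∀ h k x, T (h * k) x = T h (T k x) := by
    intro h k x
    refine congrFun (hd.equalizer (T (h * k)).continuous
      ((T h).continuous.comp (T k).continuous) ?_) x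
    ext v
    simp only [Function.comp_apply]
    rw [hT, hT]
    change (Real.sqrt (modularRatio (h * k)) : ℂ) • A (π.gardingAct μG ((h * k : H) : G) v) =
      T h ((Real.sqrt (modularRatio k) : ℂ) • A (π.gardingAct μG (k : G) v))
    rw [map_smul, hT]
    change _ = (Real.sqrt (modularRatio k) : ℂ) • (Real.sqrt (modularRatio h) : ℂ) •
      A (π.gardingAct μG (h : G) (π.gardingAct μG (k : G) v))
    rw [smul_smul, modularRatio_mul, Real.sqrt_mul (modularRatio_pos h).le, Subgroup.coe_mul,
      UnitaryRep.gardingAct_mul, Complex.ofReal_mul, mul_comm]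
  let S : H → K ≃ₗᵢ[ℂ] K := fun h =>
    { toFun := T h
      map_add' := map_add _
      map_smul' := map_smul _
      invFun := T h⁻¹
      left_inv := fun x => by rw [← hTmul, inv_mul_cancel, hTone]
      right_inv := fun x => by rw [← hTmul, mul_inv_cancel, hTone]
      norm_map' := hTn h }
  let σ : UnitaryRep H K :=
    { toHom :=
        { toFun := S
          map_one' := by ext x; exact hTone x
          map_mul' := fun h k => by ext x; exact hTmul h k x }
      continuous_apply := fun x => by
        change Continuous fun h => T h x
        refine continuous_of_uniform_approx_of_continuous fun U hU => ?_
        obtain ⟨ε, hε, hεU⟩ := Metric.mem_uniformity_dist.1 hU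
        obtain ⟨v, hv⟩ := hd.exists_dist_lt x hε
        refine ⟨fun h => T h (A v), ?_, fun h => ?_⟩
        · simp only [hT]
          change Continuous fun h : H =>
            (Real.sqrt (modularRatio h) : ℂ) • A (π.gardingAct μG (h : G) v)
          refine Continuous.smul ?_ ?_
          · exact Complex.continuous_ofReal.comp
              (Real.continuous_sqrt.comp continuous_modularRatio)
          · exact (continuous_gardingAct_of_factorisation hθ hE hA v).comp continuous_subtype_val
        · refine hεU ?_
          rw [dist_eq_norm, ← map_sub, hTn, ← dist_eq_norm]
          exact hv }
  exact ⟨σ, hT⟩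

/-- If the functions `g ↦ A π(g⁻¹) v` are continuous and the range of `A` is dense then separability
passes from the space of `π` to the target of `A`: a vector orthogonal to all `A π(g) v` with `v` in
a countable dense set is, by tightness, orthogonal to the range of `A`. -/
theorem IsTightAdmissible.separableSpace [SeparableSpace V] (hθ : IsWeight μH θ)
    {σ : UnitaryRep H K} (hA : IsTightAdmissible μG θ σ A) (hd : DenseRange A)
    (hc : ∀ v, Continuous (waveletFun μG A v)) : SeparableSpace K := by
  have : SecondCountableTopology V := UniformSpace.secondCountable_of_separable V
  obtain ⟨D, hDc, hDd⟩ := exists_countable_dense (π.garding μG)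
  set K₀ : Submodule ℂ K := (Submodule.span ℂ (⋃ v ∈ D, Set.range (waveletFun μG A v))).topologicalClosure
    with hK₀
  have hK₀c : IsClosed (K₀ : Set K) := Submodule.isClosed_topologicalClosure _
  have hmem : ∀ v ∈ D, ∀ g, waveletFun μG A v g ∈ K₀ := fun v hv g =>
    Submodule.le_topologicalClosure _ (Submodule.subset_span (Set.mem_biUnion hv ⟨g, rfl⟩))
  have : CompleteSpace K₀ := hK₀c.completeSpace_coe
  have hK₀s : IsSeparable (K₀ : Set K) := by
    refine IsSeparable.closure (IsSeparable.span ?_)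
    have := hDc.to_subtype
    rw [Set.biUnion_eq_iUnion]
    exact IsSeparable.iUnion fun v : D => isSeparable_range (hc v)
  set P : K →L[ℂ] K := K₀ᗮ.starProjection with hP
  have hP0 : ∀ x ∈ K₀, P x = 0 := fun x hx =>
    (Submodule.starProjection_apply_eq_zero_iff _).2 (Submodule.le_orthogonal_orthogonal _ hx)
  have hPn : ∀ x, ‖P x‖ₑ ≤ ‖x‖ₑ := fun x => by
    have h := Submodule.norm_starProjection_apply_le K₀ᗮ x
    simpa only [← ofReal_norm] using ENNReal.ofReal_le_ofReal h
  -- evaluation is possible only where `θ` is positive; such a point is found in `H`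
  obtain ⟨h, hh⟩ := hθ.exists_pos 1
  rw [one_mul] at hh
  have hzero : ∀ v : π.garding μG, P (waveletFun μG A v h) = 0 := by
    intro v
    have hint : ∫⁻ g, ‖P (waveletFun μG A v g)‖ₑ ^ 2 * ENNReal.ofReal (θ g) ∂μG = 0 := by
      refine le_antisymm (ENNReal.le_of_forall_pos_le_add fun ε hε _ => ?_) (by simp)
      rw [zero_add]
      obtain ⟨d, hdD, hdv⟩ := hDd.exists_dist_lt v (ε := Real.sqrt ε) (Real.sqrt_pos.2 hε)
      calc ∫⁻ g, ‖P (waveletFun μG A v g)‖ₑ ^ 2 * ENNReal.ofReal (θ g) ∂μG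
          ≤ ∫⁻ g, ‖waveletFun μG A (v - d) g‖ₑ ^ 2 * ENNReal.ofReal (θ g) ∂μG := by
            refine lintegral_mono fun g => ?_
            have e : P (waveletFun μG A v g) = P (waveletFun μG A (v - d) g) := by
              have e1 : v = (v - d) + d := by abel
              conv_lhs => rw [e1, waveletFun_add, Pi.add_apply, map_add, hP0 _ (hmem d hdD g),
                add_zero]
            rw [e]
            gcongr
            exact hPn _
        _ = ENNReal.ofReal (‖((v - d : π.garding μG) : V)‖ ^ 2) := hA.tight _
        _ ≤ ENNReal.ofReal ε := by
            refine ENNReal.ofReal_le_ofReal ?_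
            rw [← Real.sq_sqrt (NNReal.coe_nonneg ε)]
            gcongr
            rw [dist_eq_norm] at hdv
            exact hdv.le
        _ = ε := ENNReal.ofReal_coe_nnreal
    have hcont : Continuous fun g => ‖P (waveletFun μG A v g)‖ ^ 2 * θ g :=
      ((P.continuous.comp (hc v)).norm.pow 2).mul θ.continuous
    have h0 : (fun g => ‖P (waveletFun μG A v g)‖ ^ 2 * θ g) =ᵐ[μG] fun _ => 0 := by
      have hm : Measurable fun g => ‖P (waveletFun μG A v g)‖ₑ ^ 2 * ENNReal.ofReal (θ g) :=
        ((P.continuous.comp (hc v)).enorm.measurable.pow_const 2).mul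
          θ.continuous.measurable.ennreal_ofReal
      filter_upwards [(lintegral_eq_zero_iff hm).1 hint] with g hg
      simp only [Pi.zero_apply, mul_eq_zero, ENNReal.ofReal_eq_zero] at hg
      rcases hg with hg | hg
      · have : ‖P (waveletFun μG A v g)‖ₑ = 0 := by simpa using hg
        rw [enorm_eq_zero] at this
        simp [this]
      · simp [le_antisymm hg (hθ.nonneg g)]
    have h1 := congrFun ((Continuous.ae_eq_iff_eq μG hcont continuous_const).1 h0) h
    simpa [hh.ne'] using h1
  have htop : K₀ = ⊤ := by
    refine Submodule.eq_top_iff'.2 fun x => ?_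
    refine hK₀c.closure_subset_iff.2 ?_ (hd x)
    rintro _ ⟨v, rfl⟩
    -- `A v` is the value at `h` of the function belonging to `π(h) v`
    have h1 := hzero (π.gardingAct μG h v)
    rw [waveletFun, ← UnitaryRep.gardingAct_mul, inv_mul_cancel, UnitaryRep.gardingAct_one, hP,
      Submodule.starProjection_apply_eq_zero_iff, Submodule.orthogonal_orthogonal] at h1
    exact h1
  rw [htop] at hK₀s
  exact isSeparable_univ_iff.1 hK₀s

end Factorisation

/-! ### Minimality of the dilation -/

section Minimality

variable {G : Type u} [Group G] [TopologicalSpace G] [IsTopologicalGroup G] [T2Space G]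
  [LocallyCompactSpace G] [SecondCountableTopology G] [MeasurableSpace G] [BorelSpace G]
  {H : Subgroup G} [IsClosed (H : Set G)]
  {μH : Measure H} [μH.IsHaarMeasure] {θ : C(G, ℝ)} {μG : Measure G} [μG.IsHaarMeasure]
  {V : Type v} [NormedAddCommGroup V] [InnerProductSpace ℂ V] [CompleteSpace V]
  {π : UnitaryRep G V} {E : Set (G ⧸ H) → V →L[ℂ] V}
  {K : Type w} [NormedAddCommGroup K] [InnerProductSpace ℂ K] [CompleteSpace K]
  {σ : UnitaryRep H K} {A : π.garding μG →ₗ[ℂ] K}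

theorem IsWeight.integrable_inner (hθ : IsWeight μH θ) (F₁ F₂ : inducedSpace μG θ σ) :
    Integrable (fun x => inner ℂ ((F₂ : G →ₘ[μG] K) x) ((F₁ : G →ₘ[μG] K) x) * (θ x : ℂ)) μG := by
  rw [← hθ.integrable_weightMeasure_iff]
  refine (L2.integrable_inner (𝕜 := ℂ) (inducedToLp μG θ σ F₂) (inducedToLp μG θ σ F₁)).congr ?_
  filter_upwards [coeFn_inducedToLp F₁, coeFn_inducedToLp F₂] with x a b
  rw [a, b]

theorem inner_covariant {σ : UnitaryRep H K} (h : H) (u v : K) :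
    inner ℂ ((Real.sqrt (modularRatio h) : ℂ) • σ h⁻¹ v) ((Real.sqrt (modularRatio h) : ℂ) • σ h⁻¹ u)
      = modularRatio h * inner ℂ v u := by
  rw [inner_smul_left, inner_smul_right, LinearIsometryEquiv.inner_map_map, Complex.conj_ofReal,
    ← mul_assoc, ← Complex.ofReal_mul, Real.mul_self_sqrt (modularRatio_pos h).le]

/-- The condition that `F` be orthogonal to the functions `χ_Y A π(·⁻¹) v` is invariant under left
translation of `F`. -/
theorem setIntegral_inner_translate (hθ : IsWeight μH θ) (hA : IsAdmissible μG θ σ A)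
    (hc : ∀ v, Continuous (waveletFun μG A v)) (F : inducedSpace μG θ σ)
    (hi : ∀ v : π.garding μG, Integrable (fun x =>
      inner ℂ (waveletFun μG A v x) ((F : G →ₘ[μG] K) x) * (θ x : ℂ)) μG)
    (h0 : ∀ Y : Set (G ⧸ H), IsBorel Y → ∀ v : π.garding μG, ∫ x in cosetPreimage Y,
      inner ℂ (waveletFun μG A v x) ((F : G →ₘ[μG] K) x) * (θ x : ℂ) ∂μG = 0)
    {Y : Set (G ⧸ H)} (hY : IsBorel Y) (v : π.garding μG) (g : G) :
    ∫ x in cosetPreimage Y,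
      inner ℂ (waveletFun μG A v x) ((F : G →ₘ[μG] K) (g⁻¹ * x)) * (θ x : ℂ) ∂μG = 0 := by
  set v' := π.gardingAct μG g⁻¹ v with hv'
  have hw : ∀ x, waveletFun μG A v' x = waveletFun μG A v (g * x) := fun x => by
    rw [hv', waveletFun_gardingAct, inv_inv]
  have hY' := hY.smul_image g⁻¹
  have hYm := hY'.measurableSet_cosetPreimage
  set b : G → ℂ := fun x => inner ℂ (waveletFun μG A v' x) ((F : G →ₘ[μG] K) x) with hb
  have hbm : AEMeasurable b μG :=
    ((hc v').stronglyMeasurable.inner (𝕜 := ℂ) F.1.stronglyMeasurable).measurable.aemeasurable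
  have e1 : ∀ x, (cosetPreimage ((fun y => g⁻¹ • y) '' Y)).indicator b x * (θ x : ℂ) =
      (cosetPreimage ((fun y => g⁻¹ • y) '' Y)).indicator (fun x => b x * (θ x : ℂ)) x :=
    fun x => (Set.indicator_mul_left _ b (fun x => (θ x : ℂ))).symm
  obtain ⟨-, h2⟩ := hθ.integral_translate μG
    (φ := (cosetPreimage ((fun y => g⁻¹ • y) '' Y)).indicator b) (hbm.indicator hYm)
    (fun k => by
      filter_upwards [F.2.1 k] with x hx
      have hiff := cosetPreimage_mul_mem (Y := (fun y => g⁻¹ • y) '' Y) x k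
      by_cases hg : x ∈ cosetPreimage ((fun y => g⁻¹ • y) '' Y)
      · rw [Set.indicator_of_mem hg, Set.indicator_of_mem (hiff.2 hg), hb]
        simp only
        rw [hx, hA.waveletFun_mul, inner_covariant]
      · rw [Set.indicator_of_notMem hg, Set.indicator_of_notMem (mt hiff.1 hg), mul_zero])
    (by simpa only [e1] using (hi v').indicator hYm) g
  have e2 : ∀ x, (cosetPreimage ((fun y => g⁻¹ • y) '' Y)).indicator b x * (θ (g * x) : ℂ) =
      (cosetPreimage Y).indicator (fun x =>
        inner ℂ (waveletFun μG A v x) ((F : G →ₘ[μG] K) (g⁻¹ * x)) * (θ x : ℂ)) (g * x) := by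
    intro x
    have hiff := mem_cosetPreimage_smul_image (Y := Y) g⁻¹ x
    rw [inv_inv] at hiff
    by_cases hg : g * x ∈ cosetPreimage Y
    · rw [Set.indicator_of_mem hg, Set.indicator_of_mem (hiff.2 hg), inv_mul_cancel_left, hb]
      simp only [hw]
    · rw [Set.indicator_of_notMem hg, Set.indicator_of_notMem (mt hiff.1 hg), zero_mul]
  simp only [e1, e2] at h2
  rw [← integral_indicator hY.measurableSet_cosetPreimage, ← integral_mul_left_eq_self _ g, h2,
    integral_indicator hYm]
  exact h0 _ hY' v'

/-- Integrability, from the bound `|⟨a, b⟩| ≤ ‖a‖² + ‖b‖²` and the invariance of the norm of the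
induced representation. -/
theorem integrable_prod_inner (hθ : IsWeight μH θ) (hA : IsTightAdmissible μG θ σ A)
    (hc : ∀ v, Continuous (waveletFun μG A v)) (F : inducedSpace μG θ σ) (v : π.garding μG)
    {f : G → ℂ} (hf : Continuous f) (hfc : HasCompactSupport f) :
    Integrable (fun p : G × G => f p.1 * (inner ℂ (waveletFun μG A v p.2)
      ((F : G →ₘ[μG] K) (p.1⁻¹ * p.2)) * (θ p.2 : ℂ))) (μG.prod μG) := by
  have hFs : StronglyMeasurable fun p : G × G => (F : G →ₘ[μG] K) (p.1⁻¹ * p.2) :=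
    F.1.stronglyMeasurable.comp_measurable (by fun_prop)
  have hws : StronglyMeasurable fun p : G × G => waveletFun μG A v p.2 :=
    (hc v).stronglyMeasurable.comp_measurable measurable_snd
  have hm : StronglyMeasurable fun p : G × G => f p.1 * (inner ℂ (waveletFun μG A v p.2)
      ((F : G →ₘ[μG] K) (p.1⁻¹ * p.2)) * (θ p.2 : ℂ)) :=
    (hf.stronglyMeasurable.comp_measurable measurable_fst).mul ((hws.inner (𝕜 := ℂ) hFs).mul
      ((by fun_prop : Continuous fun p : G × G => (θ p.2 : ℂ)).stronglyMeasurable))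
  refine ⟨hm.aestronglyMeasurable, ?_⟩
  unfold HasFiniteIntegral
  rw [lintegral_prod _ hm.measurable.enorm.aemeasurable]
  set M : ℝ≥0∞ := ENNReal.ofReal (‖(v : V)‖ ^ 2) + inducedNormSq μG θ (F : G →ₘ[μG] K) with hM
  have hMt : M < ∞ := ENNReal.add_lt_top.2 ⟨ENNReal.ofReal_lt_top, F.2.2⟩
  have hbound : ∀ g, ∫⁻ x, ‖f g * (inner ℂ (waveletFun μG A v x)
      ((F : G →ₘ[μG] K) (g⁻¹ * x)) * (θ x : ℂ))‖ₑ ∂μG ≤ ‖f g‖ₑ * M := by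
    intro g
    have hF : ∫⁻ x, ‖(F : G →ₘ[μG] K) (g⁻¹ * x)‖ₑ ^ 2 * ENNReal.ofReal (θ x) ∂μG =
        inducedNormSq μG θ (F : G →ₘ[μG] K) := by
      rw [← (inducedAct_mem hθ g F.2).2, inducedNormSq_congr (coeFn_inducedAct g _)]
    calc ∫⁻ x, ‖f g * (inner ℂ (waveletFun μG A v x)
          ((F : G →ₘ[μG] K) (g⁻¹ * x)) * (θ x : ℂ))‖ₑ ∂μG
        ≤ ∫⁻ x, ‖f g‖ₑ * (‖waveletFun μG A v x‖ₑ ^ 2 * ENNReal.ofReal (θ x) +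
            ‖(F : G →ₘ[μG] K) (g⁻¹ * x)‖ₑ ^ 2 * ENNReal.ofReal (θ x)) ∂μG := by
          refine lintegral_mono fun x => ?_
          rw [enorm_mul, enorm_mul, ← add_mul]
          gcongr
          · rw [← ofReal_norm, ← ofReal_norm (waveletFun μG A v x),
              ← ofReal_norm ((F : G →ₘ[μG] K) (g⁻¹ * x)), ← ENNReal.ofReal_pow (norm_nonneg _),
              ← ENNReal.ofReal_pow (norm_nonneg _),
              ← ENNReal.ofReal_add (sq_nonneg _) (sq_nonneg _)]
            refine ENNReal.ofReal_le_ofReal ((norm_inner_le_norm _ _).trans ?_)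
            nlinarith [sq_nonneg (‖waveletFun μG A v x‖ - ‖(F : G →ₘ[μG] K) (g⁻¹ * x)‖),
              sq_nonneg ‖waveletFun μG A v x‖, sq_nonneg ‖(F : G →ₘ[μG] K) (g⁻¹ * x)‖]
          · rw [← ofReal_norm, Complex.norm_real, Real.norm_of_nonneg (hθ.nonneg x)]
      _ = ‖f g‖ₑ * M := by
          rw [lintegral_const_mul' _ _ enorm_ne_top, lintegral_add_left, hA.tight, hF]
          exact ((hc v).enorm.measurable.pow_const 2).mul θ.continuous.measurable.ennreal_ofReal
  calc ∫⁻ g, ∫⁻ x, ‖f g * (inner ℂ (waveletFun μG A v x)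
        ((F : G →ₘ[μG] K) (g⁻¹ * x)) * (θ x : ℂ))‖ₑ ∂μG ∂μG
      ≤ ∫⁻ g, ‖f g‖ₑ * M ∂μG := lintegral_mono hbound
    _ = (∫⁻ g, ‖f g‖ₑ ∂μG) * M := lintegral_mul_const' _ _ hMt.ne
    _ < ∞ := ENNReal.mul_lt_top (hf.integrable_of_hasCompactSupport hfc).2 hMt

/-- A vector of the induced representation which is orthogonal to all `χ_Y A π(·⁻¹) v` vanishes: its
convolutions are continuous and orthogonal to the same vectors, hence orthogonal pointwise to the
dense range of `A`. -/
theorem eq_zero_of_forall_setIntegral_inner_eq_zero (hθ : IsWeight μH θ)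
    (hA : IsTightAdmissible μG θ σ A) (hd : DenseRange A)
    (hc : ∀ v, Continuous (waveletFun μG A v)) (F : inducedSpace μG θ σ)
    (hi : ∀ v : π.garding μG, Integrable (fun x =>
      inner ℂ (waveletFun μG A v x) ((F : G →ₘ[μG] K) x) * (θ x : ℂ)) μG)
    (h0 : ∀ Y : Set (G ⧸ H), IsBorel Y → ∀ v : π.garding μG, ∫ x in cosetPreimage Y,
      inner ℂ (waveletFun μG A v x) ((F : G →ₘ[μG] K) x) * (θ x : ℂ) ∂μG = 0) : F = 0 := by
  apply Subtype.ext
  apply AEEqFun.ext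
  refine Filter.EventuallyEq.trans ?_ AEEqFun.coeFn_zero.symm
  refine ae_eq_zero_of_leftConv_eq_zero F.1.stronglyMeasurable
    (fun C hC => hθ.integrableOn_of_mem F hC) fun f hf hfc => ?_
  set k : G → K := leftConv μG f (F : G →ₘ[μG] K) with hk
  have hkc : Continuous k := hθ.continuous_leftConv hf hfc F
  have hkey : ∀ v : π.garding μG, inner ℂ (waveletFun μG A v 1) (k 1) = 0 := by
    intro v
    have hprod := integrable_prod_inner hθ hA hc F v hf hfc
    -- the pairing of `A π(x⁻¹) v` with the convolution is a convolution
    have hae : ∀ᵐ x ∂μG, inner ℂ (waveletFun μG A v x) (k x) * (θ x : ℂ) =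
        ∫ g, f g * (inner ℂ (waveletFun μG A v x) ((F : G →ₘ[μG] K) (g⁻¹ * x)) * (θ x : ℂ)) ∂μG := by
      have hx : ∀ x, Integrable (fun g => f g • (F : G →ₘ[μG] K) (g⁻¹ * x)) μG := fun x => by
        have h1 := integrableOn_comp_inv F.1.stronglyMeasurable
          (fun C hC => hθ.integrableOn_of_mem F hC)
          (hfc.isCompact.smul x⁻¹)
        have h2 : Integrable (fun y => f (x * y) • (F : G →ₘ[μG] K) y⁻¹) μG := by
          refine IntegrableOn.integrable_of_forall_notMem_eq_zero
            (s := x⁻¹ • tsupport f) ?_ fun y hy => ?_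
          · exact h1.continuousOn_smul (f := fun y => f (x * y)) (by fun_prop)
              (hfc.isCompact.smul x⁻¹)
          · rw [image_eq_zero_of_notMem_tsupport (f := f) (x := x * y), zero_smul]
            intro hm
            exact hy (Set.mem_smul_set_iff_inv_smul_mem.2 (by simpa using hm))
        have h3 := h2.comp_mul_left x⁻¹
        simpa using h3
      refine Filter.Eventually.of_forall fun x => ?_
      rw [hk, leftConv, ← integral_inner (hx x), ← integral_mul_const]
      simp only [inner_smul_right, mul_assoc]
    have hz := hθ.eq_zero_of_setIntegral_eq_zero (μG := μG)
      (b := fun x => inner ℂ (waveletFun μG A v x) (k x)) ((hc v).inner hkc) (fun x h => ?_) ?_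
      (fun Y hY => ?_) 1
    · exact hz
    · rw [hA.waveletFun_mul, hk, leftConv_mul f F.2, inner_covariant]
    · exact hprod.integral_prod_right.congr (hae.mono fun x hx => hx.symm)
    · rw [integral_congr_ae (ae_restrict_of_ae hae), ← integral_integral_swap]
      · simp only [integral_const_mul, setIntegral_inner_translate hθ hA.1 hc F hi h0 hY v,
          mul_zero, integral_zero]
      · have := hprod.restrict (s := Set.univ ×ˢ cosetPreimage Y)
        rwa [← Measure.prod_restrict, Measure.restrict_univ] at this
  refine ext_inner_left ℂ fun x => ?_
  rw [inner_zero_right]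
  refine congrFun (hd.equalizer (g := fun x => inner ℂ x (k 1)) (h := fun _ => 0)
    (by fun_prop) continuous_const ?_) x
  ext v
  have := hkey v
  rwa [waveletFun, inv_one, UnitaryRep.gardingAct_one] at this

/-- An admissible map with dense range and continuous wavelet transforms realises the minimal
dilation of the observable it defines. -/
theorem IsTightAdmissible.isAssociatedRep (hθ : IsWeight μH θ) (hE : E Set.univ = 1)
    (hA : IsTightAdmissible μG θ σ A) (hEA : IsGivenBy μG θ E A) (hd : DenseRange A)
    (hc : ∀ v, Continuous (waveletFun μG A v)) : IsAssociatedRep μG θ π σ E := by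
  obtain ⟨W, hW, hWA⟩ := hA.exists_intertwiner hθ
  set J := inducedToLp μG θ σ with hJ
  have hn : ∀ v, ‖J (W v)‖ = ‖v‖ := fun v => by
    have : ‖J (W v)‖ₑ = ‖v‖ₑ := by
      refine (ENNReal.pow_right_strictMono two_ne_zero).injective ?_
      simp only [hJ, enorm_inducedToLp_sq, hW.isometry]
    simpa only [toReal_enorm] using congrArg ENNReal.toReal this
  let T : V →ₗᵢ[ℂ] Lp K 2 (weightMeasure μG θ) := ⟨J.comp W, hn⟩
  have hT : ∀ v : π.garding μG, T v =ᵐ[weightMeasure μG θ] waveletFun μG A v := fun v =>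
    (coeFn_inducedToLp (W v)).trans (weightMeasure_absolutelyContinuous.ae_eq (hWA v))
  have hTJ : ∀ {Y : Set (G ⧸ H)} (hY : IsBorel Y) (v : V),
      J ⟨inducedLocalisation μG hY (W v), inducedLocalisation_mem hY (W v).2⟩ =
        Lp.indicatorMap hY.measurableSet_cosetPreimage (T v) := fun hY v =>
    inducedToLp_inducedLocalisation hY (W v)
  have hET : ∀ Y, IsBorel Y → E Y = compressedObservable (H := H) T Y := by
    intro Y hY
    refine ext_inner_garding (μG := μG) (π := π) fun v hv => ?_
    rw [inner_compressedObservable T hY]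
    exact ((hEA Y hY ⟨v, hv⟩ ⟨v, hv⟩).2).trans (inner_waveletFun_eq T hθ hT hY ⟨v, hv⟩ ⟨v, hv⟩).2.symm
  refine ⟨W, hW, fun Y hY u v => ?_, fun F hF ε hε => ?_⟩
  · rw [hE, CFC.sqrt_one, one_apply_eq_self, one_apply_eq_self, hET Y hY,
      inner_compressedObservable T hY, ← hTJ hY u]
    exact hθ.inner_inducedToLp ⟨_, inducedLocalisation_mem hY (W u).2⟩ (W v)
  set Z : Set (inducedSpace μG θ σ) := {F' | ∃ (Y : Set (G ⧸ H)) (hY : IsBorel Y) (v : V),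
    (F' : G →ₘ[μG] K) = inducedLocalisation μG hY (W v)} with hZ
  set S : Submodule ℂ (Lp K 2 (weightMeasure μG θ)) :=
    ((Submodule.span ℂ Z).map J).topologicalClosure with hS
  have hSc : IsClosed (S : Set (Lp K 2 (weightMeasure μG θ))) :=
    Submodule.isClosed_topologicalClosure _
  have : CompleteSpace S := hSc.completeSpace_coe
  have hSJ : S ≤ LinearMap.range J :=
    Submodule.topologicalClosure_minimal _ (LinearMap.map_le_range) hθ.isClosed_range_inducedToLp
  have hmem : ∀ {Y : Set (G ⧸ H)} (hY : IsBorel Y) (v : V),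
      Lp.indicatorMap hY.measurableSet_cosetPreimage (T v) ∈ S := fun hY v =>
    Submodule.le_topologicalClosure _ ⟨_, Submodule.subset_span ⟨_, hY, v, rfl⟩, hTJ hY v⟩
  have hJS : J ⟨F, hF⟩ ∈ S := by
    -- the component orthogonal to `S` is again a function in the induced representation because the
    -- range of `J` is closed
    obtain ⟨p, hp, q, hq, hpq⟩ := S.exists_add_mem_mem_orthogonal (J ⟨F, hF⟩)
    obtain ⟨F₁, hF₁⟩ : q ∈ LinearMap.range J := by
      have : q = J ⟨F, hF⟩ - p := by rw [hpq]; abel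
      rw [this]
      exact Submodule.sub_mem _ ⟨_, rfl⟩ (hSJ hp)
    have hJF₁ := coeFn_inducedToLp F₁
    have hcongr : ∀ v : π.garding μG, (fun x => inner ℂ ((W v : G →ₘ[μG] K) x)
        ((F₁ : G →ₘ[μG] K) x) * (θ x : ℂ)) =ᵐ[μG]
        fun x => inner ℂ (waveletFun μG A v x) ((F₁ : G →ₘ[μG] K) x) * (θ x : ℂ) := fun v => by
      filter_upwards [hWA v] with x hx
      rw [hx]
    have hzero : F₁ = 0 := by
      refine eq_zero_of_forall_setIntegral_inner_eq_zero hθ hA hd hc F₁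
        (fun v => (hθ.integrable_inner F₁ (W v)).congr (hcongr v)) fun Y hY v => ?_
      have h1 := S.inner_left_of_mem_orthogonal (hmem hY v) hq
      have e1 : ∫ x in cosetPreimage Y, inner ℂ (J F₁ x) (T v x) ∂weightMeasure μG θ =
          ∫ x in cosetPreimage Y, inner ℂ ((F₁ : G →ₘ[μG] K) x) (waveletFun μG A v x)
            ∂weightMeasure μG θ := by
        refine integral_congr_ae (ae_restrict_of_ae ?_)
        filter_upwards [hJF₁, hT v] with x a b
        rw [a, b]
      rw [← hF₁, Lp.inner_indicatorMap, e1,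
        hθ.setIntegral_weightMeasure _ hY.measurableSet_cosetPreimage] at h1
      have h2 := congrArg (starRingEnd ℂ) h1
      rw [← integral_conj, map_zero] at h2
      simpa only [map_mul, inner_conj_symm, Complex.conj_ofReal] using h2
    rw [hpq, ← hF₁, hzero, map_zero, add_zero]
    exact hp
  obtain ⟨δ, hδ, hδε⟩ : ∃ δ : ℝ, 0 < δ ∧ ENNReal.ofReal δ ^ 2 < ε := by
    obtain ⟨r, hr, hrε⟩ := ENNReal.lt_iff_exists_nnreal_btwn.1 hε
    have hr0 : (0 : ℝ) < r := by exact_mod_cast hr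
    refine ⟨Real.sqrt r, Real.sqrt_pos.2 hr0, ?_⟩
    rw [← ENNReal.ofReal_pow (Real.sqrt_nonneg _), Real.sq_sqrt hr0.le, ENNReal.ofReal_coe_nnreal]
    exact hrε
  obtain ⟨_, ⟨F', hF', rfl⟩, hdist⟩ := Metric.mem_closure_iff.1 hJS δ hδ
  refine ⟨F', ?_, ?_⟩
  · have h1 : (F' : G →ₘ[μG] K) ∈ (Submodule.span ℂ Z).map (inducedSpace μG θ σ).subtype :=
      ⟨F', hF', rfl⟩
    rw [Submodule.map_span] at h1
    refine Submodule.span_mono ?_ h1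
    rintro _ ⟨F'', ⟨Y, hY, v, h⟩, rfl⟩
    exact ⟨Y, hY, v, h⟩
  · refine lt_of_le_of_lt ?_ hδε
    have h1 := enorm_inducedToLp_sq (μG := μG) (θ := θ) (σ := σ) (⟨F, hF⟩ - F')
    change _ = inducedNormSq μG θ (F - (F' : G →ₘ[μG] K)) at h1
    rw [← h1, map_sub, ← ofReal_norm, ← dist_eq_norm]
    gcongr

/-- Existence of the representation associated with an observable: the space `K` is the completion
of the Gårding domain for the form which evaluates densities at the identity. -/
theorem IsNormalisedLocalisationObservable.exists_isAssociatedRep [SeparableSpace V]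
    (hθ : IsWeight μH θ) (hE : IsNormalisedLocalisationObservable π E) :
    ∃ (K : Type v) (_ : NormedAddCommGroup K) (_ : InnerProductSpace ℂ K)
      (_ : CompleteSpace K) (_ : SeparableSpace K) (σ : UnitaryRep H K),
      IsAssociatedRep μG θ π σ E := by
  obtain ⟨K, _, _, _, A, hd, hA⟩ := exists_factorisation (μG := μG) hθ hE.1
  obtain ⟨σ, hσ⟩ := exists_unitaryRep_of_factorisation hθ hE.1 hd hA
  have hT := isTightAdmissible_of_factorisation hθ hE hA hσ
  have hc : ∀ v, Continuous (waveletFun μG A v) := fun v =>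
    (continuous_gardingAct_of_factorisation hθ hE.1 hA v).comp continuous_inv
  exact ⟨K, _, _, inferInstance, hT.separableSpace hθ hd hc, σ,
    hT.isAssociatedRep hθ hE.normalised (isGivenBy_of_factorisation hθ hE.1 hA) hd hc⟩

end Minimality

end

theorem mainTheorem4
    {G : Type u} [Group G] [TopologicalSpace G] [IsTopologicalGroup G] [T2Space G]
    [LocallyCompactSpace G] [SecondCountableTopology G] [MeasurableSpace G] [BorelSpace G]
    (H : Subgroup G) [IsClosed (H : Set G)]
    (μG : Measure G) [μG.IsHaarMeasure] (μH : Measure H) [μH.IsHaarMeasure]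
    (θ : C(G, ℝ)) (hθ : IsWeight μH θ)
    {V : Type v} [NormedAddCommGroup V] [InnerProductSpace ℂ V] [CompleteSpace V]
    [SeparableSpace V] (π : UnitaryRep G V) :
    (∀ E : Set (G ⧸ H) → V →L[ℂ] V, IsNormalisedLocalisationObservable π E →
      (∃ (K : Type v) (_ : NormedAddCommGroup K) (_ : InnerProductSpace ℂ K)
        (_ : CompleteSpace K) (_ : SeparableSpace K) (σ : UnitaryRep H K),
        IsAssociatedRep μG θ π σ E) ∧
      (∀ (K : Type w) [NormedAddCommGroup K] [InnerProductSpace ℂ K] [CompleteSpace K]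
        [SeparableSpace K] (σ : UnitaryRep H K), IsAssociatedRep μG θ π σ E →
        (∃ A : π.garding μG →ₗ[ℂ] K, IsTightAdmissible μG θ σ A ∧ IsGivenBy μG θ E A) ∧
        IsSquareIntegrableModulo μG θ π σ)) ∧
    (∀ (K : Type w) [NormedAddCommGroup K] [InnerProductSpace ℂ K] [CompleteSpace K]
      [SeparableSpace K] (σ : UnitaryRep H K) (A : π.garding μG →ₗ[ℂ] K),
      IsTightAdmissible μG θ σ A →
      ∃ E : Set (G ⧸ H) → V →L[ℂ] V,
        IsNormalisedLocalisationObservable π E ∧ IsGivenBy μG θ E A ∧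
        ∀ E' : Set (G ⧸ H) → V →L[ℂ] V, IsGivenBy μG θ E' A → ∀ Y, IsBorel Y → E' Y = E Y) := 
  ⟨fun _ hE => ⟨hE.exists_isAssociatedRep hθ,
      fun _ _ _ _ _ _ h => h.exists_tightAdmissible hθ hE.normalised⟩,
    fun _ _ _ _ _ _ _ hA => hA.exists_observable hθ⟩
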